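/- Let $0<\alpha<\beta$ and let $\Omega\subseteq\mathbb R^3$ be a standard domain, that is, $\Omega$ is open, bounded, weak Lipschitz (every boundary point has an open neighbourhood $U$ with a bi-Lipschitz bijection onto $(-1,1)^3$ that maps $U\cap\Omega$, $U\cap\partial\Omega$ and $U\setminus\overline\Omega$ onto the parts of the cube where the third coordinate is negative, zero and positive, respectively), has the segment property (every boundary point has an open neighbourhood $U$ and a vector $y\neq0$ with $z+ty\in\Omega$ for all $z\in\overline\Omega\cap U$, $0<t<1$), and is topologically trivial: the only $u\in H_0(\operatorname{curl})$ with $\operatorname{div}u=0$ and $\operatorname{curl}u=0$, and the only $u\in H_0(\operatorname{div})$ with $\operatorname{div}u=0$ and $\operatorname{curl}u=0$, is $u=0$. All function spaces are complex; $H_0^1(\Omega)$, $H_0(\operatorname{curl})$, $H_0(\operatorname{div})$ are the closures of the smooth compactly supported functions (fields) in $H^1(\Omega)$, $H(\operatorname{curl})$, $H(\operatorname{div})$. Let $g_0=\{\operatorname{grad}u;\,u\in H_0^1(\Omega)\}$ and $c=\{\operatorname{curl}u;\,u\in H(\operatorname{curl})\}$, which are closed subspaces of $L^2(\Omega)^3$,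 with canonical embeddings $\iota_0\colon g_0\to L^2(\Omega)^3$ and $\iota_1\colon c\to L^2(\Omega)^3$. For a bounded linear operator $a$ on $L^2(\Omega)^3$ put $a_{jk}=\iota_j^*a\iota_k$ ($j,k\in\{0,1\}$). For an operator $T$ on a Hilbert space write $\operatorname{Re}T\ge r$ if $\operatorname{Re}\langle\varphi,T\varphi\rangle\ge r\|\varphi\|^2$ for all $\varphi$. Let $\mathcal M(\alpha,\beta,\Omega)$ be the set of invertible bounded linear operators $a$ on $L^2(\Omega)^3$ with $$\operatorname{Re}a_{00}\ge\alpha,\quad \operatorname{Re}a_{00}^{-1}\ge 1/\beta,\quad \operatorname{Re}(a^{-1})_{11}\ge 1/\beta,\quad \operatorname{Re}\big((a^{-1})_{11}\big)^{-1}\ge\alpha .$$ Let $\tau_{\mathrm{nlH}}$ be the initial topology on $\mathcal M(\alpha,\beta,\Omega)$ with respect to the four maps $$a\mapsto a_{00}^{-1},\qquad a\mapsto a_{10}a_{00}^{-1},\qquad a\mapsto a_{00}^{-1}a_{01},\qquad a\mapsto a_{11}-a_{10}a_{00}^{-1}a_{01}$$ into the spaces of bounded linear operators on $g_0$, from $g_0$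 to $c$, from $c$ to $g_0$, and on $c$, respectively, each with the weak operator topology. Let $\mathcal B\subseteq\mathcal M(\alpha,\beta,\Omega)$ be bounded in operator norm. Then the closure of $\mathcal B$ in $(\mathcal M(\alpha,\beta,\Omega),\tau_{\mathrm{nlH}})$, with the topology induced by $\tau_{\mathrm{nlH}}$, is compact and metrisable. -/

import Mathlib

open MeasureTheory Topology
open scoped ContDiff

noncomputable section

namespace NonlocalH

/-- Physical space `ℝ³`. -/
abbrev R3 := EuclideanSpace ℝ (Fin 3)

/-- Values of complex vector fields. -/
abbrev C3 := EuclideanSpace ℂ (Fin 3)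

/-- `L²(Ω)`, complex valued. -/
abbrev L2s (Ω : Set R3) := Lp ℂ 2 (volume.restrict Ω)

/-- `L²(Ω)³`, complex valued. -/
abbrev L2v (Ω : Set R3) := Lp C3 2 (volume.restrict Ω)

/-! ### Differential operators -/

/-- The partial derivative `∂ᵢ f`. -/
def pderiv (i : Fin 3) (f : R3 → ℂ) (x : R3) : ℂ :=
  fderiv ℝ f x (EuclideanSpace.single i 1)

/-- The classical gradient. -/
def grad (φ : R3 → ℂ) (x : R3) : C3 :=
  !₂[pderiv 0 φ x, pderiv 1 φ x, pderiv 2 φ x]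

/-- The classical divergence. -/
def dive (ψ : R3 → C3) (x : R3) : ℂ :=
  ∑ i, pderiv i (fun y => ψ y i) x

/-- The classical curl. -/
def curl (ψ : R3 → C3) (x : R3) : C3 :=
  !₂[pderiv 1 (fun y => ψ y 2) x - pderiv 2 (fun y => ψ y 1) x,
     pderiv 2 (fun y => ψ y 0) x - pderiv 0 (fun y => ψ y 2) x,
     pderiv 0 (fun y => ψ y 1) x - pderiv 1 (fun y => ψ y 0) x]

/-- Test functions: `φ ∈ C_c^∞(Ω)` (extended by zero to `ℝ³`). -/
def IsTest {F : Type*} [NormedAddCommGroup F] [NormedSpace ℝ F] (Ω : Set R3) (φ : R3 → F) :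
    Prop :=
  ContDiff ℝ ∞ φ ∧ HasCompactSupport φ ∧ tsupport φ ⊆ Ω

section Graphs

variable {F G : Type*} [NormedAddCommGroup F] [InnerProductSpace ℂ F]
  [NormedAddCommGroup G] [InnerProductSpace ℂ G]

/-- The pairs `(φ, D φ)`, `φ ∈ C_c^∞(Ω; F)`, as elements of `L²(Ω; F) × L²(Ω; G)`, for a
differential operator `D`. -/
def testPairs (Ω : Set R3) (D : (R3 → F) → (R3 → G)) :
    Set (Lp F 2 (volume.restrict Ω) × Lp G 2 (volume.restrict Ω)) :=
  {p | ∃ φ : R3 → F, IsTest Ω φ ∧ p.1 =ᵐ[volume.restrict Ω] φ ∧ p.2 =ᵐ[volume.restrict Ω] D φ}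

/-- The graph of the closure in `L²` of `D` on `C_c^∞(Ω; F)` (homogeneous boundary conditions).
For a linear differential operator `D` the set `testPairs Ω D` is already a linear subspace. -/
def minGraph (Ω : Set R3) (D : (R3 → F) → (R3 → G)) :
    Submodule ℂ (Lp F 2 (volume.restrict Ω) × Lp G 2 (volume.restrict Ω)) :=
  (Submodule.span ℂ (testPairs Ω D)).topologicalClosure

/-- The graph of a distributional differential operator in `L²`, where `D` is its formal adjoint:
`(v, w)` belongs to it iff `⟨D φ, v⟩ = ⟨φ, w⟩` in `L²(Ω)` for all test functions `φ`. -/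
def weakGraph (Ω : Set R3) (D : (R3 → F) → (R3 → G)) :
    Submodule ℂ (Lp G 2 (volume.restrict Ω) × Lp F 2 (volume.restrict Ω)) where
  carrier := {p | ∀ q ∈ testPairs Ω D, inner ℂ q.2 p.1 = inner ℂ q.1 p.2}
  add_mem' := by
    intro a b ha hb q hq
    simp only [Prod.fst_add, Prod.snd_add, inner_add_right, ha q hq, hb q hq]
  zero_mem' := by
    intro q _
    simp only [Prod.fst_zero, Prod.snd_zero, inner_zero_right]
  smul_mem' := by
    intro c a ha q hq
    simp only [Prod.smul_fst, Prod.smul_snd, inner_smul_right, ha q hq]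

end Graphs

/-- The graph of the distributional curl, with domain `H(curl)`. -/
def curlGraph (Ω : Set R3) : Submodule ℂ (L2v Ω × L2v Ω) := weakGraph Ω curl

/-- The graph of the distributional divergence, with domain `H(div)`; the formal adjoint of the
divergence is `-grad`. -/
def diveGraph (Ω : Set R3) : Submodule ℂ (L2v Ω × L2s Ω) := weakGraph Ω (fun φ => -grad φ)

/-- The graph of `grad` on `H_0^1(Ω)`, the closure of the test functions in `H^1(Ω)`. -/
def gradZeroGraph (Ω : Set R3) : Submodule ℂ (L2s Ω × L2v Ω) := minGraph Ω grad

/-- The graph of `curl` on `H_0(curl)`, the closure of the test fields in `H(curl)`. -/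
def curlZeroGraph (Ω : Set R3) : Submodule ℂ (L2v Ω × L2v Ω) := minGraph Ω curl

/-- The graph of `div` on `H_0(div)`, the closure of the test fields in `H(div)`. -/
def diveZeroGraph (Ω : Set R3) : Submodule ℂ (L2v Ω × L2s Ω) := minGraph Ω dive

/-- `g_0(Ω) = {grad u ; u ∈ H_0^1(Ω)}`. -/
def gZero (Ω : Set R3) : Submodule ℂ (L2v Ω) :=
  (gradZeroGraph Ω).map (LinearMap.snd ℂ (L2s Ω) (L2v Ω))

/-- `c(Ω) = {curl u ; u ∈ H(curl)}`. -/
def cRange (Ω : Set R3) : Submodule ℂ (L2v Ω) :=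
  (curlGraph Ω).map (LinearMap.snd ℂ (L2v Ω) (L2v Ω))

/-- The space `H_0(curl)`. -/
def HZeroCurl (Ω : Set R3) : Submodule ℂ (L2v Ω) :=
  (curlZeroGraph Ω).map (LinearMap.fst ℂ (L2v Ω) (L2v Ω))

/-- The space `H_0(div)`. -/
def HZeroDive (Ω : Set R3) : Submodule ℂ (L2v Ω) :=
  (diveZeroGraph Ω).map (LinearMap.fst ℂ (L2v Ω) (L2s Ω))

/-- The fields `u ∈ L²(Ω)³` with `curl u = 0`. -/
def kerCurl (Ω : Set R3) : Submodule ℂ (L2v Ω) :=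
  (curlGraph Ω).comap (LinearMap.inl ℂ (L2v Ω) (L2v Ω))

/-- The fields `u ∈ L²(Ω)³` with `div u = 0`. -/
def kerDive (Ω : Set R3) : Submodule ℂ (L2v Ω) :=
  (diveGraph Ω).comap (LinearMap.inl ℂ (L2v Ω) (L2s Ω))

/-- The harmonic Dirichlet fields. -/
def harmonicD (Ω : Set R3) : Submodule ℂ (L2v Ω) := HZeroCurl Ω ⊓ kerDive Ω ⊓ kerCurl Ω

/-- The harmonic Neumann fields. -/
def harmonicN (Ω : Set R3) : Submodule ℂ (L2v Ω) := HZeroDive Ω ⊓ kerDive Ω ⊓ kerCurl Ω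

/-! ### Standard domains -/

/-- The open cube `(-1,1)³`. -/
def cube : Set R3 := {y | ∀ i, |y i| < 1}

/-- Weak Lipschitz: near each boundary point `Ω` is mapped onto the lower half of the cube by a
bi-Lipschitz bijection that takes the boundary onto the middle slice. -/
def IsWeakLipschitz (Ω : Set R3) : Prop :=
  ∀ x ∈ frontier Ω, ∃ (U : Set R3) (χ : R3 → R3) (K L : NNReal),
    IsOpen U ∧ x ∈ U ∧ Set.BijOn χ U cube ∧ LipschitzOnWith K χ U ∧
    (∀ y ∈ U, ∀ z ∈ U, dist y z ≤ L * dist (χ y) (χ z)) ∧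
    χ '' (U ∩ Ω) = {y ∈ cube | y 2 < 0} ∧
    χ '' (U ∩ frontier Ω) = {y ∈ cube | y 2 = 0} ∧
    χ '' (U \ closure Ω) = {y ∈ cube | 0 < y 2}

/-- The segment property. -/
def HasSegmentProperty (Ω : Set R3) : Prop :=
  ∀ x ∈ frontier Ω, ∃ (U : Set R3) (y : R3), IsOpen U ∧ x ∈ U ∧ y ≠ 0 ∧
    ∀ z ∈ closure Ω ∩ U, ∀ t : ℝ, 0 < t → t < 1 → z + t • y ∈ Ω

/-- Topologically trivial: there are no nonzero harmonic Dirichlet or Neumann fields. -/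
def IsTopologicallyTrivial (Ω : Set R3) : Prop :=
  Module.rank ℂ (harmonicD Ω) = 0 ∧ Module.rank ℂ (harmonicN Ω) = 0

/-- Standard domains. -/
structure IsStandardDomain (Ω : Set R3) : Prop where
  isOpen : IsOpen Ω
  isBounded : Bornology.IsBounded Ω
  weakLipschitz : IsWeakLipschitz Ω
  topologicallyTrivial : IsTopologicallyTrivial Ω
  segmentProperty : HasSegmentProperty Ω

/-! ### Block operators -/

section Blocks

variable {H : Type*} [NormedAddCommGroup H] [InnerProductSpace ℂ H]

open Classical in
/-- The adjoint `ι_K^* : H → K` of the embedding `ι_K : K → H` of a closed subspace `K` of a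
Hilbert space `H`, that is, the orthogonal projection onto `K`, regarded as a map to `K`.
(For standard domains `g_0(Ω)` and `c(Ω)` are closed; the value `0` for other
subspaces is a convention.) -/
def embAdj (K : Submodule ℂ H) : H →L[ℂ] K :=
  if _h : K.HasOrthogonalProjection then K.orthogonalProjectionOnto else 0

/-- The block `ι_K^* a ι_L : L → K` of the operator `a`. -/
def block (a : H →L[ℂ] H) (K L : Submodule ℂ H) : L →L[ℂ] K :=
  embAdj K ∘L a ∘L L.subtypeL

/-- `Re T ≥ r`. -/
def ReGE (T : H →L[ℂ] H) (r : ℝ) : Prop :=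
  ∀ φ : H, r * ‖φ‖ ^ 2 ≤ (inner ℂ φ (T φ)).re

end Blocks

section Coefficients

variable {Ω : Set R3}

/-- `a₀₀`. -/
def a00 (a : L2v Ω →L[ℂ] L2v Ω) : gZero Ω →L[ℂ] gZero Ω := block a (gZero Ω) (gZero Ω)

/-- `a₀₁`. -/
def a01 (a : L2v Ω →L[ℂ] L2v Ω) : cRange Ω →L[ℂ] gZero Ω := block a (gZero Ω) (cRange Ω)

/-- `a₁₀`. -/
def a10 (a : L2v Ω →L[ℂ] L2v Ω) : gZero Ω →L[ℂ] cRange Ω := block a (cRange Ω) (gZero Ω)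

/-- `a₁₁`. -/
def a11 (a : L2v Ω →L[ℂ] L2v Ω) : cRange Ω →L[ℂ] cRange Ω := block a (cRange Ω) (cRange Ω)

end Coefficients

/-- The admissible nonlocal coefficients `𝓜(α, β, Ω)`. Inverses of operators are `Ring.inverse`;
the operators inverted besides `a` are invertible because their real parts are bounded below by a
positive constant. -/
def admissible (α β : ℝ) (Ω : Set R3) : Set (L2v Ω →L[ℂ] L2v Ω) :=
  {a | IsUnit a ∧
    ReGE (a00 a) α ∧
    ReGE (Ring.inverse (a00 a)) (1 / β) ∧
    ReGE (a11 (Ring.inverse a)) (1 / β) ∧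
    ReGE (Ring.inverse (a11 (Ring.inverse a))) α}

/-- The set `𝓜(α, β, Ω)` as a type of its own, to carry the topology `τ_nlH` (and not the norm
topology). -/
structure Coeff (α β : ℝ) (Ω : Set R3) where
  toCLM : L2v Ω →L[ℂ] L2v Ω
  mem : toCLM ∈ admissible α β Ω

/-- The topology `τ_nlH` of nonlocal `H`-convergence with respect to `(g_0(Ω), c(Ω))`: the initial
topology of four maps into spaces of operators with the weak operator topology. -/
instance tauNlH (α β : ℝ) (Ω : Set R3) : TopologicalSpace (Coeff α β Ω) :=
  TopologicalSpace.induced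
      (fun a => (.ofCLM (Ring.inverse (a00 a.toCLM)) : gZero Ω →WOT[ℂ] gZero Ω)) inferInstance ⊓
  TopologicalSpace.induced
      (fun a => (.ofCLM (a10 a.toCLM ∘L Ring.inverse (a00 a.toCLM)) :
        gZero Ω →WOT[ℂ] cRange Ω)) inferInstance ⊓
  TopologicalSpace.induced
      (fun a => (.ofCLM (Ring.inverse (a00 a.toCLM) ∘L a01 a.toCLM) :
        cRange Ω →WOT[ℂ] gZero Ω)) inferInstance ⊓
  TopologicalSpace.induced
      (fun a => (.ofCLM (a11 a.toCLM -
          a10 a.toCLM ∘L Ring.inverse (a00 a.toCLM) ∘L a01 a.toCLM) :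
        cRange Ω →WOT[ℂ] cRange Ω)) inferInstance

end NonlocalH

end

open MeasureTheory Topology
open scoped ContDiff

noncomputable section

namespace NonlocalH

/-! ### The weak operator topology on bounded sets -/

section WOT

variable {K L : Type*} [NormedAddCommGroup K] [InnerProductSpace ℂ K]
  [NormedAddCommGroup L] [InnerProductSpace ℂ L]

/-! Suppose that `L²(Ω)³` is the orthogonal sum of `G = g₀` and `C = c`. The four components `T₁ =
a₀₀⁻¹`, `T₂ = a₁₀a₀₀⁻¹`, `T₃ = a₀₀⁻¹a₀₁` and `T₄` (the Schur complement) then determine `a`, through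
a block triangular factorisation. Since `T₄ = ((a⁻¹)₁₁)⁻¹` (`schur_eq`), admissibility of `a`
restricts only `T₁` and `T₄`: they have to be sectorial, and every such quadruple occurs
(`exists_components_eq`). Sectoriality `Re T ≥ r`, `Re T⁻¹ ≥ s` can be written without inverses as
`s‖Tψ‖² ≤ Re⟨ψ, Tψ⟩`, a condition closed in the weak operator topology, and it bounds `‖T‖` by
`1/s`. A norm bound on `a` bounds `T₂` and `T₃`. So the components of `B` lie in a closed part of a
product of operator balls, which is compact in the weak operator topology and consists entirely of
components of admissible operators. Compactness pulls back along the inducing map. Countably many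
matrix coefficients embed the compact closure into `ℂ^(ℕ×ℕ)`, whence metrisability.

The analytic part is the Helmholtz decomposition `c = g₀ᗮ` with `g₀` closed. Closedness is
Friedrichs' inequality, and `c ⊆ g₀ᗮ` is `curl grad = 0`. The converse inclusion follows by
Hahn-Banach and Riesz once `curl` on `H₀(curl) ∩ g₀ᗮ` is bounded below. It is injective there
because there are no harmonic Dirichlet fields, so it suffices to bound test fields by their curl
modulo `g₀` and a finite-dimensional space (`exists_norm_le_of_finiteDimensional`).

For this estimate, extend a test field `φ` by zero and let `p` be its Poincaré potential, so that `φ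
- ∇p` is controlled by `curl φ` on a large ball. Outside `Ω` the field vanishes, so there `∇p`
itself is controlled, and on each exterior boundary patch `p` is close to a constant `cₖ` by the
Poincaré inequality. Reflecting `p - cₖ` into `Ω` and localising with a partition of unity `θₖ`
gives functions `rₖ` with controlled gradients such that `p - ∑ (rₖ + cₖθₖ)` vanishes on the
boundary. The gradient of this Lipschitz function lies in `g₀`, and the `∇θₖ` span the
finite-dimensional space. -/

theorem exists_clm_of_sesq [CompleteSpace L] {r : ℝ} (hr : 0 ≤ r) (b : K → L → ℂ)
    (hadd : ∀ x x' y, b (x + x') y = b x y + b x' y)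
    (hsmul : ∀ (c : ℂ) x y, b (c • x) y = c * b x y)
    (hadd' : ∀ x y y', b x (y + y') = b x y + b x y')
    (hsmul' : ∀ (c : ℂ) x y, b x (c • y) = (starRingEnd ℂ) c * b x y)
    (hb : ∀ x y, ‖b x y‖ ≤ r * ‖x‖ * ‖y‖) :
    ∃ T : K →L[ℂ] L, (∀ x, ‖T x‖ ≤ r * ‖x‖) ∧ ∀ x y, inner ℂ y (T x) = b x y := by
  -- Riesz' theorem for fixed `x`; the form is conjugate linear in `y`, so its conjugate is the
  -- functional to represent.
  have key : ∀ x, ∃ z : L, ∀ y, inner ℂ y z = b x y := by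
    intro x
    let f : L →ₗ[ℂ] ℂ :=
      { toFun := fun y => (starRingEnd ℂ) (b x y)
        map_add' := by intro y y'; simp [hadd']
        map_smul' := by intro c y; simp [hsmul'] }
    let F : StrongDual ℂ L := f.mkContinuous (r * ‖x‖) (by
      intro y
      simpa [f] using hb x y)
    refine ⟨(InnerProductSpace.toDual ℂ L).symm F, fun y => ?_⟩
    rw [← inner_conj_symm, InnerProductSpace.toDual_symm_apply]
    simp [F, f]
  choose t ht using key
  have hbd : ∀ x, ‖t x‖ ≤ r * ‖x‖ := by
    intro x
    have h1 := hb x (t x)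
    rw [← ht, inner_self_eq_norm_sq_to_K] at h1
    have h1 : ‖t x‖ ^ 2 ≤ r * ‖x‖ * ‖t x‖ := by simpa using h1
    rcases (norm_nonneg (t x)).eq_or_lt with h0 | h0
    · rw [← h0]; positivity
    · nlinarith
  let T : K →ₗ[ℂ] L :=
    { toFun := t
      map_add' := by
        intro x x'
        refine ext_inner_left ℂ fun y => ?_
        rw [inner_add_right, ht, ht, ht, hadd]
      map_smul' := by
        intro c x
        refine ext_inner_left ℂ fun y => ?_
        simp [inner_smul_right, ht, hsmul] }
  exact ⟨T.mkContinuous r hbd, hbd, fun x y => ht x y⟩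

/-- Balls of operators are compact in the weak operator topology. -/
theorem isCompact_wot_ball [CompleteSpace L] {r : ℝ} (hr : 0 ≤ r) :
    IsCompact {T : K →WOT[ℂ] L | ∀ x, ‖T x‖ ≤ r * ‖x‖} := by
  rw [isCompact_iff_ultrafilter_le_nhds]
  intro U hU
  have hU : ∀ᶠ T in (U : Filter (K →WOT[ℂ] L)), ∀ x, ‖T x‖ ≤ r * ‖x‖ := by
    exact Filter.le_principal_iff.1 hU
  have hbd : ∀ x (y : L), ∀ᶠ T in (U : Filter (K →WOT[ℂ] L)),
      inner ℂ y (T x) ∈ Metric.closedBall (0 : ℂ) (r * ‖x‖ * ‖y‖) := by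
    intro x y
    filter_upwards [hU] with T hT
    rw [mem_closedBall_zero_iff]
    calc ‖inner ℂ y (T x)‖ ≤ ‖y‖ * ‖T x‖ := norm_inner_le_norm _ _
      _ ≤ ‖y‖ * (r * ‖x‖) := by gcongr; exact hT x
      _ = _ := by ring
  have key : ∀ x (y : L), ∃ z ∈ Metric.closedBall (0 : ℂ) (r * ‖x‖ * ‖y‖),
      Filter.Tendsto (fun T : K →WOT[ℂ] L => inner ℂ y (T x)) U (𝓝 z) := by
    intro x y
    have := (isCompact_closedBall (0 : ℂ) (r * ‖x‖ * ‖y‖)).ultrafilter_le_nhds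
      (U.map fun T : K →WOT[ℂ] L => inner ℂ y (T x)) (Filter.le_principal_iff.2 (hbd x y))
    exact this
  choose b hb hlim using key
  obtain ⟨T, hT, hTb⟩ := exists_clm_of_sesq hr b
    (fun x x' y => tendsto_nhds_unique (hlim (x + x') y)
      (((hlim x y).add (hlim x' y)).congr fun T => by simp))
    (fun c x y => tendsto_nhds_unique (hlim (c • x) y)
      (((hlim x y).const_mul c).congr fun T => by simp))
    (fun x y y' => tendsto_nhds_unique (hlim x (y + y'))
      (((hlim x y).add (hlim x y')).congr fun T => by simp))
    (fun c x y => tendsto_nhds_unique (hlim x (c • y))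
      (((hlim x y).const_mul _).congr fun T => by simp [mul_comm]))
    (fun x y => by simpa using hb x y)
  refine ⟨.ofCLM T, hT, ?_⟩
  rw [ContinuousLinearMapWOT.le_nhds_iff_forall_inner_apply_le_nhds]
  intro x y
  have := hlim x y
  rw [← hTb] at this
  exact this

/-- `‖y‖²` is the supremum over `z` of `2 Re⟨z, y⟩ - ‖z‖²`, attained at `z = y`. This turns a
quadratic bound into a family of bounds on weakly continuous quantities. -/
theorem mul_norm_sq_le_iff (s c : ℝ) (hs : 0 ≤ s) (y : L) :
    s * ‖y‖ ^ 2 ≤ c ↔ ∀ z : L, s * (2 * (inner ℂ z y).re - ‖z‖ ^ 2) ≤ c := by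
  constructor
  · intro h z
    refine le_trans ?_ h
    refine mul_le_mul_of_nonneg_left ?_ hs
    have h1 : (inner ℂ z y).re ≤ ‖z‖ * ‖y‖ :=
      (Complex.re_le_norm _).trans (norm_inner_le_norm z y)
    nlinarith [sq_nonneg (‖z‖ - ‖y‖)]
  · intro h
    have h1 := h y
    have h2 : (inner ℂ y y).re = ‖y‖ ^ 2 := inner_self_eq_norm_sq (𝕜 := ℂ) y
    rw [h2] at h1
    linarith [h1]

theorem isClosed_wot_ball [CompleteSpace L] (r : ℝ) :
    IsClosed {T : K →WOT[ℂ] L | ∀ x, ‖T x‖ ≤ r * ‖x‖} := by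
  by_cases hr : 0 ≤ r
  · exact (isCompact_wot_ball hr).isClosed
  · push Not at hr
    -- For negative `r` the set is empty, unless `K` is trivial, when it is everything.
    by_cases hK : ∃ x : K, x ≠ 0
    · obtain ⟨x, hx⟩ := hK
      convert isClosed_empty
      rw [Set.eq_empty_iff_forall_notMem]
      intro T hT
      have h1 := hT x
      have h2 : 0 < ‖x‖ := norm_pos_iff.2 hx
      nlinarith [norm_nonneg (T x)]
    · push Not at hK
      convert isClosed_univ
      rw [Set.eq_univ_iff_forall]
      intro T x
      simp [hK x]

/-- `Re T ≥ r` and `Re T⁻¹ ≥ s`, written without the inverse. -/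
def IsSectorial (r s : ℝ) (T : L →L[ℂ] L) : Prop :=
  ∀ ψ, r * ‖ψ‖ ^ 2 ≤ (inner ℂ ψ (T ψ)).re ∧ s * ‖T ψ‖ ^ 2 ≤ (inner ℂ ψ (T ψ)).re

/-- Weak operator limits do not commute with inversion or with `‖Tψ‖²`. Linearising the square with
an auxiliary vector `z` leaves only matrix coefficients. -/
theorem isClosed_isSectorial [CompleteSpace L] (r s : ℝ) (hs : 0 ≤ s) :
    IsClosed {T : L →WOT[ℂ] L | IsSectorial r s T.toCLM} := by
  have hc : ∀ x y : L, Continuous fun T : L →WOT[ℂ] L => (inner ℂ y (T x)).re := fun x y =>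
    Complex.continuous_re.comp (ContinuousLinearMapWOT.continuous_inner_apply continuous_id x y)
  simp only [IsSectorial, mul_norm_sq_le_iff s _ hs]
  have : {T : L →WOT[ℂ] L | ∀ ψ : L, r * ‖ψ‖ ^ 2 ≤ (inner ℂ ψ (T.toCLM ψ)).re ∧
      ∀ z : L, s * (2 * (inner ℂ z (T.toCLM ψ)).re - ‖z‖ ^ 2) ≤ (inner ℂ ψ (T.toCLM ψ)).re} =
      ⋂ ψ : L, ({T : L →WOT[ℂ] L | r * ‖ψ‖ ^ 2 ≤ (inner ℂ ψ (T ψ)).re} ∩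
        ⋂ z : L, {T : L →WOT[ℂ] L | s * (2 * (inner ℂ z (T ψ)).re - ‖z‖ ^ 2) ≤
          (inner ℂ ψ (T ψ)).re}) := by
    ext T
    simp
  rw [this]
  refine isClosed_iInter fun ψ => (isClosed_le continuous_const (hc ψ ψ)).inter
    (isClosed_iInter fun z => isClosed_le ?_ (hc ψ ψ))
  exact (((hc ψ z).const_mul 2).sub continuous_const).const_mul s

theorem IsSectorial.norm_le {r s : ℝ} (hs : 0 < s) {T : L →L[ℂ] L} (hT : IsSectorial r s T)
    (ψ : L) : ‖T ψ‖ ≤ s⁻¹ * ‖ψ‖ := by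
  have h1 := (hT ψ).2.trans ((Complex.re_le_norm _).trans (norm_inner_le_norm ψ (T ψ)))
  rcases (norm_nonneg (T ψ)).eq_or_lt with h0 | h0
  · rw [← h0]; positivity
  · rw [inv_mul_eq_div, le_div_iff₀ hs]
    nlinarith

/-- The Lax-Milgram argument: coercivity implies invertibility. -/
theorem isUnit_of_reGE [CompleteSpace L] {r : ℝ} (hr : 0 < r) {T : L →L[ℂ] L} (hT : ReGE T r) : IsUnit T := by
  refine ContinuousLinearMap.isUnit_of_forall_le_norm_inner_map T (c := ⟨r, hr.le⟩) hr fun x => ?_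
  rw [norm_inner_symm]
  refine le_trans ?_ (Complex.re_le_norm _)
  have := hT x
  calc ‖x‖ ^ 2 * r = r * ‖x‖ ^ 2 := mul_comm _ _
    _ ≤ _ := this

theorem inverse_apply_apply {T : L →L[ℂ] L} (hT : IsUnit T) (x : L) : Ring.inverse T (T x) = x := by
  have := Ring.inverse_mul_cancel T hT
  exact congrArg (fun f : L →L[ℂ] L => f x) this

theorem apply_inverse_apply {T : L →L[ℂ] L} (hT : IsUnit T) (x : L) : T (Ring.inverse T x) = x := by
  have := Ring.mul_inverse_cancel T hT
  exact congrArg (fun f : L →L[ℂ] L => f x) this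

/-- Substitute `Tψ` for the argument of `T⁻¹`; conjugation does not change the real part. -/
theorem isSectorial_iff {r s : ℝ} {T : L →L[ℂ] L} (hT : IsUnit T) :
    IsSectorial r s T ↔ ReGE T r ∧ ReGE (Ring.inverse T) s := by
  constructor
  · refine fun h => ⟨fun ψ => (h ψ).1, fun ψ => ?_⟩
    have := (h (Ring.inverse T ψ)).2
    rw [apply_inverse_apply hT] at this
    rw [← inner_conj_symm, Complex.conj_re]
    exact this
  · refine fun h ψ => ⟨h.1 ψ, ?_⟩
    have := h.2 (T ψ)
    rw [inverse_apply_apply hT] at this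
    rw [← inner_conj_symm, Complex.conj_re]
    exact this

theorem inverse_inverse {T : L →L[ℂ] L} (hT : IsUnit T) : Ring.inverse (Ring.inverse T) = T := by
  obtain ⟨u, rfl⟩ := hT
  simp

theorem inverse_eq_of_comp {S T : L →L[ℂ] L} (h : ∀ x, S (T x) = x) (h' : ∀ x, T (S x) = x) :
    IsUnit S ∧ Ring.inverse S = T := by
  have h1 : S * T = 1 := ContinuousLinearMap.ext h
  have h2 : T * S = 1 := ContinuousLinearMap.ext h'
  let u : (L →L[ℂ] L)ˣ := ⟨S, T, h1, h2⟩
  exact ⟨⟨u, rfl⟩, Ring.inverse_unit u⟩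

end WOT

/-! ### Block operators with respect to an orthogonal decomposition -/

section Decomposition

variable {H : Type*} [NormedAddCommGroup H] [InnerProductSpace ℂ H] {G C : Submodule ℂ H}

theorem embAdj_coe (K : Submodule ℂ H) [K.HasOrthogonalProjection] (x : K) :
    embAdj K (x : H) = x := by
  rw [embAdj, dif_pos ‹_›]
  exact Submodule.orthogonalProjectionOnto_mem_subspace_eq_self x

theorem embAdj_of_mem_orthogonal (K : Submodule ℂ H) [K.HasOrthogonalProjection] {x : H}
    (hx : x ∈ Kᗮ) : embAdj K x = 0 := by
  rw [embAdj, dif_pos ‹_›]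
  exact Submodule.orthogonalProjectionOnto_apply_of_mem_orthogonal hx

theorem embAdj_add_embAdj [G.HasOrthogonalProjection] (h : C = Gᗮ) (x : H) :
    (embAdj G x : H) + (embAdj C x : H) = x := by
  subst h
  rw [embAdj, embAdj, dif_pos ‹_›,
    dif_pos (inferInstance : Gᗮ.HasOrthogonalProjection)]
  rw [Submodule.orthogonalProjectionOnto_orthogonal]
  exact add_sub_cancel _ _

theorem embAdj_left [G.HasOrthogonalProjection] (h : C = Gᗮ) (g : G) (c : C) :
    embAdj G ((g : H) + (c : H)) = g := by
  rw [map_add, embAdj_coe, embAdj_of_mem_orthogonal G (h ▸ c.2), add_zero]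

theorem embAdj_right [G.HasOrthogonalProjection] (h : C = Gᗮ) (g : G) (c : C) :
    embAdj C ((g : H) + (c : H)) = c := by
  subst h
  rw [map_add, embAdj_coe, embAdj_of_mem_orthogonal Gᗮ (Submodule.le_orthogonal_orthogonal G g.2),
    zero_add]

theorem block_apply (a : H →L[ℂ] H) (K L : Submodule ℂ H) (x : L) :
    block a K L x = embAdj K (a x) := rfl

/-- The Schur complement of `a₀₀` is the inverse of the block `(a⁻¹)₁₁`. -/
theorem schur_eq [G.HasOrthogonalProjection] (h : C = Gᗮ) {a : H →L[ℂ] H} (ha : IsUnit a)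
    (h00 : IsUnit (block a G G)) :
    IsUnit (block (Ring.inverse a) C C) ∧ Ring.inverse (block (Ring.inverse a) C C) =
      block a C C - block a C G ∘L Ring.inverse (block a G G) ∘L block a G C := by
  set b := Ring.inverse a with hb
  set T := Ring.inverse (block a G G) with hT
  have hab : ∀ x, a (b x) = x := apply_inverse_apply ha
  have hba : ∀ x, b (a x) = x := inverse_apply_apply ha
  have hdec := embAdj_add_embAdj (G := G) (C := C) h
  have dec : ∀ (f : H →L[ℂ] H) (K : Submodule ℂ H) (x : H),
      embAdj K (f x) = block f K G (embAdj G x) + block f K C (embAdj C x) := by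
    intro f K x
    rw [block_apply, block_apply, ← map_add, ← map_add, hdec]
  have hC0 : ∀ c : C, embAdj G (c : H) = 0 := fun c =>
    embAdj_of_mem_orthogonal G (h ▸ c.2)
  have hG0 : ∀ g : G, embAdj C (g : H) = 0 := fun g => by
    have := embAdj_right h g 0
    simpa using this
  have hCC : ∀ c : C, embAdj C (c : H) = c := fun c => by
    have := embAdj_right h 0 c
    simpa using this
  -- The `G`-row of `a b = 1` applied to `c`: `b₀₁ = -a₀₀⁻¹ a₀₁ b₁₁`.
  have key1 : ∀ c : C, block b G C c = - T (block a G C (block b C C c)) := by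
    intro c
    have h1 := dec a G (b c)
    rw [hab, hC0, ← block_apply, ← block_apply] at h1
    have h2 : block a G G (block b G C c) = - block a G C (block b C C c) :=
      eq_neg_of_add_eq_zero_left h1.symm
    rw [← map_neg, ← h2, hT, inverse_apply_apply h00]
  -- The `C`-row of `b a = 1` applied to `a₀₀⁻¹ g`: `b₁₀ = -b₁₁ a₁₀ a₀₀⁻¹`.
  have key2 : ∀ g : G, block b C G g = - block b C C (block a C G (T g)) := by
    intro g
    have h1 := dec b C (a (T g))
    rw [hba, hG0, ← block_apply, ← block_apply] at h1
    rw [hT, apply_inverse_apply h00] at h1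
    exact eq_neg_of_add_eq_zero_left h1.symm
  refine inverse_eq_of_comp (fun c => ?_) (fun c => ?_)
  · have h1 := dec b C (a c)
    rw [hba, hCC, ← block_apply, ← block_apply, key2] at h1
    simp only [_root_.sub_apply, ContinuousLinearMap.comp_apply, map_sub]
    rw [sub_eq_neg_add]
    exact h1.symm
  · have h1 := dec a C (b c)
    rw [hab, hCC, ← block_apply, ← block_apply, key1, map_neg] at h1
    simp only [_root_.sub_apply, ContinuousLinearMap.comp_apply]
    rw [sub_eq_neg_add]
    exact h1.symm

/-- Reconstruction of an operator from the four components that define nonlocal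
`H`-convergence. -/
theorem exists_of_blocks [G.HasOrthogonalProjection] (h : C = Gᗮ) {T₁ : G →L[ℂ] G}
    (T₂ : G →L[ℂ] C) (T₃ : C →L[ℂ] G) {T₄ : C →L[ℂ] C} (h₁ : IsUnit T₁) (h₄ : IsUnit T₄) :
    ∃ a : H →L[ℂ] H, IsUnit a ∧ block a G G = Ring.inverse T₁ ∧
      block a C G = T₂ ∘L Ring.inverse T₁ ∧ block a G C = Ring.inverse T₁ ∘L T₃ ∧
      block a C C = T₄ + T₂ ∘L Ring.inverse T₁ ∘L T₃ := by
  set A := Ring.inverse T₁ with hA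
  set B := Ring.inverse T₄ with hB
  have hdec := embAdj_add_embAdj (G := G) (C := C) h
  have hl := embAdj_left (G := G) (C := C) h
  have hr := embAdj_right (G := G) (C := C) h
  -- The operator is the product of the lower triangular factor with entry `T₂`, the diagonal
  -- `(T₁⁻¹, T₄)` and the upper triangular factor with entry `T₃`; `m` is its `G`-component.
  let m : H →L[ℂ] G := A ∘L (embAdj G + T₃ ∘L embAdj C)
  let a : H →L[ℂ] H := G.subtypeL ∘L m + C.subtypeL ∘L (T₂ ∘L m + T₄ ∘L embAdj C)
  -- The inverse, by forward and backward substitution: `n` solves for the `C`-component first.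
  let n : H →L[ℂ] C := B ∘L (embAdj C - T₂ ∘L embAdj G)
  let b : H →L[ℂ] H := G.subtypeL ∘L (T₁ ∘L embAdj G - T₃ ∘L n) + C.subtypeL ∘L n
  have hm : ∀ x, m x = A (embAdj G x + T₃ (embAdj C x)) := fun x => rfl
  have hn : ∀ x, n x = B (embAdj C x - T₂ (embAdj G x)) := fun x => rfl
  have ha : ∀ x, a x = (m x : H) + ((T₂ (m x) + T₄ (embAdj C x) : C) : H) := fun x => rfl
  have hb : ∀ x, b x = ((T₁ (embAdj G x) - T₃ (n x) : G) : H) + (n x : H) := fun x => rfl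
  have hC0 : ∀ c : C, embAdj G (c : H) = 0 := fun c => by simpa using hl 0 c
  have hG0 : ∀ g : G, embAdj C (g : H) = 0 := fun g => by simpa using hr g 0
  have hGG : ∀ g : G, embAdj G (g : H) = g := fun g => by simpa using hl g 0
  have hCC : ∀ c : C, embAdj C (c : H) = c := fun c => by simpa using hr 0 c
  refine ⟨a, (inverse_eq_of_comp (T := b) (fun x => ?_) (fun x => ?_)).1, ?_, ?_, ?_, ?_⟩
  · have h1 : m (b x) = embAdj G x := by
      rw [hm, hb, hl, hr, sub_add_cancel, hA, inverse_apply_apply h₁]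
    rw [ha, h1, hb, hr, hn, hB, apply_inverse_apply h₄, add_sub_cancel, hdec]
  · have h1 : n (a x) = embAdj C x := by
      rw [hn, ha, hl, hr, add_sub_cancel_left, hB, inverse_apply_apply h₄]
    rw [hb, h1, ha, hl, hm, hA, apply_inverse_apply h₁, add_sub_cancel_right, hdec]
  · ext1 g
    rw [block_apply, ha, hl, hm, hG0, hGG, map_zero, add_zero]
  · ext1 g
    rw [block_apply, ha, hr, hm, hG0, hGG]
    simp
  · ext1 c
    rw [block_apply, ha, hl, hm, hC0, hCC, zero_add]
    rfl
  · ext1 c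
    rw [block_apply, ha, hr, hm, hC0, hCC, zero_add, add_comm]
    rfl

theorem norm_block_le (a : H →L[ℂ] H) (K L : Submodule ℂ H) [K.HasOrthogonalProjection] (x : L) :
    ‖block a K L x‖ ≤ ‖a‖ * ‖x‖ := by
  rw [block_apply, embAdj, dif_pos ‹_›]
  exact (K.norm_orthogonalProjectionOnto_apply_le _).trans (a.le_opNorm _)

theorem ext_of_blocks [G.HasOrthogonalProjection] (h : C = Gᗮ) {a b : H →L[ℂ] H}
    (h1 : block a G G = block b G G) (h2 : block a C G = block b C G)
    (h3 : block a G C = block b G C) (h4 : block a C C = block b C C) : a = b := by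
  have hdec := embAdj_add_embAdj (G := G) (C := C) h
  have hsub : ∀ K L : Submodule ℂ H, block a K L = block b K L →
      ∀ x : L, embAdj K (a x) = embAdj K (b x) := fun K L e x => by
    rw [← block_apply, ← block_apply, e]
  have hG : ∀ g : G, a g = b g := fun g => by
    rw [← hdec (a g), hsub _ _ h1, hsub _ _ h2, hdec]
  have hC : ∀ c : C, a c = b c := fun c => by
    rw [← hdec (a c), hsub _ _ h3, hsub _ _ h4, hdec]
  ext1 x
  rw [← hdec x, map_add, map_add, hG, hC]

end Decomposition

/-! ### Compactness for nonlocal `H`-convergence -/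

section Compactness

/-- The matrix coefficients of an operator with respect to dense sequences. -/
def wotCoords (K L : Type*) [NormedAddCommGroup K] [InnerProductSpace ℂ K]
    [NormedAddCommGroup L] [InnerProductSpace ℂ L] [TopologicalSpace.SeparableSpace K]
    [TopologicalSpace.SeparableSpace L] (T : K →WOT[ℂ] L) : ℕ × ℕ → ℂ :=
  fun n => inner ℂ (TopologicalSpace.denseSeq L n.2) (T (TopologicalSpace.denseSeq K n.1))

theorem continuous_wotCoords (K L : Type*) [NormedAddCommGroup K] [InnerProductSpace ℂ K]
    [NormedAddCommGroup L] [InnerProductSpace ℂ L] [CompleteSpace L]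
    [TopologicalSpace.SeparableSpace K] [TopologicalSpace.SeparableSpace L] :
    Continuous (wotCoords K L) :=
  continuous_pi fun _ => ContinuousLinearMapWOT.continuous_inner_apply continuous_id _ _

/-- By continuity, the coefficients against a dense set of second vectors determine the values on a
dense sequence, and these determine the operator. -/
theorem injective_wotCoords (K L : Type*) [NormedAddCommGroup K] [InnerProductSpace ℂ K]
    [NormedAddCommGroup L] [InnerProductSpace ℂ L]
    [TopologicalSpace.SeparableSpace K] [TopologicalSpace.SeparableSpace L] :
    Function.Injective (wotCoords K L) := by
  intro S T h
  have h1 : ∀ m n, inner ℂ (TopologicalSpace.denseSeq L n) (S (TopologicalSpace.denseSeq K m)) =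
      inner ℂ (TopologicalSpace.denseSeq L n) (T (TopologicalSpace.denseSeq K m)) :=
    fun m n => congrFun h (m, n)
  have h2 : ∀ m, S (TopologicalSpace.denseSeq K m) = T (TopologicalSpace.denseSeq K m) := by
    intro m
    refine ext_inner_left ℂ fun y => ?_
    have hc : ∀ z : L, Continuous fun y : L => inner ℂ y z := fun z =>
      continuous_id.inner continuous_const
    exact congrFun ((TopologicalSpace.denseRange_denseSeq L).equalizer
      (hc (S (TopologicalSpace.denseSeq K m))) (hc (T (TopologicalSpace.denseSeq K m)))
      (funext fun n => h1 m n)) y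
  refine ContinuousLinearMapWOT.ext fun x => ?_
  exact congrFun ((TopologicalSpace.denseRange_denseSeq K).equalizer
    S.toCLM.continuous T.toCLM.continuous (funext h2)) x


variable {H : Type*} [NormedAddCommGroup H] [InnerProductSpace ℂ H] {G C : Submodule ℂ H}
  {α β : ℝ}

/-- The admissible operators with respect to a pair of subspaces. -/
def admissibleFor (α β : ℝ) (G C : Submodule ℂ H) : Set (H →L[ℂ] H) :=
  {a | IsUnit a ∧ ReGE (block a G G) α ∧ ReGE (Ring.inverse (block a G G)) (1 / β) ∧
    ReGE (block (Ring.inverse a) C C) (1 / β) ∧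
    ReGE (Ring.inverse (block (Ring.inverse a) C C)) α}

/-- The four components that define nonlocal `H`-convergence. -/
def components (G C : Submodule ℂ H) (a : H →L[ℂ] H) :
    (G →WOT[ℂ] G) × (G →WOT[ℂ] C) × (C →WOT[ℂ] G) × (C →WOT[ℂ] C) :=
  (.ofCLM (Ring.inverse (block a G G)),
    .ofCLM (block a C G ∘L Ring.inverse (block a G G)),
    .ofCLM (Ring.inverse (block a G G) ∘L block a G C),
    .ofCLM (block a C C - block a C G ∘L Ring.inverse (block a G G) ∘L block a G C))

/-- The image of the admissible operators: sectorial diagonal components. -/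
def sectorialSet (α β : ℝ) (G C : Submodule ℂ H) :
    Set ((G →WOT[ℂ] G) × (G →WOT[ℂ] C) × (C →WOT[ℂ] G) × (C →WOT[ℂ] C)) :=
  {T | IsSectorial (1 / β) α T.1.toCLM ∧ IsSectorial α (1 / β) T.2.2.2.toCLM}

/-- The operators whose off-diagonal components are bounded by `r`. -/
def offDiagonalLE (G C : Submodule ℂ H) (r : ℝ) :
    Set ((G →WOT[ℂ] G) × (G →WOT[ℂ] C) × (C →WOT[ℂ] G) × (C →WOT[ℂ] C)) :=
  {T | (∀ x, ‖T.2.1 x‖ ≤ r * ‖x‖) ∧ ∀ x, ‖T.2.2.1 x‖ ≤ r * ‖x‖}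

theorem isUnit_block [CompleteSpace G] (hα : 0 < α) {a : H →L[ℂ] H}
    (ha : a ∈ admissibleFor α β G C) : IsUnit (block a G G) :=
  isUnit_of_reGE hα ha.2.1

/-- The Schur complement inverts `(a⁻¹)₁₁`, so the four inequalities of admissibility are exactly
sectoriality of the two diagonal components. -/
theorem components_mem_sectorialSet [CompleteSpace G] (hα : 0 < α)
    (hC : C = Gᗮ) {a : H →L[ℂ] H} (ha : a ∈ admissibleFor α β G C) :
    components G C a ∈ sectorialSet α β G C := by
  have h00 := isUnit_block hα ha
  obtain ⟨hu, h1, h2, h3, h4⟩ := ha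
  obtain ⟨hu, he⟩ := schur_eq hC hu h00
  refine ⟨(isSectorial_iff h00.ringInverse).2 ⟨h2, ?_⟩, ?_⟩
  · rwa [inverse_inverse h00]
  · change IsSectorial α (1 / β) (block a C C - _)
    rw [← he]
    refine (isSectorial_iff hu.ringInverse).2 ⟨h4, ?_⟩
    rwa [inverse_inverse hu]

/-- Surjectivity onto the sectorial set is what makes the limit of components again the components
of an admissible operator, with no condition on `T₂` and `T₃`. -/
theorem exists_components_eq [CompleteSpace G] [CompleteSpace C] (hα : 0 < α) (hβ : 0 < β)
    (hC : C = Gᗮ) {T : (G →WOT[ℂ] G) × (G →WOT[ℂ] C) × (C →WOT[ℂ] G) × (C →WOT[ℂ] C)}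
    (hT : T ∈ sectorialSet α β G C) : ∃ a ∈ admissibleFor α β G C, components G C a = T := by
  obtain ⟨⟨T₁⟩, ⟨T₂⟩, ⟨T₃⟩, ⟨T₄⟩⟩ := T
  obtain ⟨h1, h4⟩ := hT
  change IsSectorial (1 / β) α T₁ at h1
  change IsSectorial α (1 / β) T₄ at h4
  have hu1 : IsUnit T₁ := isUnit_of_reGE (by positivity : 0 < 1 / β) fun ψ => (h1 ψ).1
  have hu4 : IsUnit T₄ := isUnit_of_reGE hα fun ψ => (h4 ψ).1
  have hs1 := (isSectorial_iff hu1).1 h1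
  have hs4 := (isSectorial_iff hu4).1 h4
  obtain ⟨a, ha, e1, e2, e3, e4⟩ := exists_of_blocks hC T₂ T₃ hu1 hu4
  have h00 : IsUnit (block a G G) := by rw [e1]; exact hu1.ringInverse
  have hT1T : ∀ x, Ring.inverse T₁ (T₁ x) = x := inverse_apply_apply hu1
  have hTT1 : ∀ x, T₁ (Ring.inverse T₁ x) = x := apply_inverse_apply hu1
  have hS : block a C C - block a C G ∘L Ring.inverse (block a G G) ∘L block a G C = T₄ := by
    rw [e1, e2, e3, e4, inverse_inverse hu1]
    ext1 x
    simp [hTT1]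
  obtain ⟨hu, he⟩ := schur_eq hC ha h00
  rw [hS] at he
  refine ⟨a, ⟨ha, ?_, ?_, ?_, ?_⟩, ?_⟩
  · rw [e1]; exact hs1.2
  · rw [e1, inverse_inverse hu1]; exact hs1.1
  · have := hs4.2
    rwa [← he, inverse_inverse hu] at this
  · rw [he]; exact hs4.1
  · have e2' : block a C G ∘L Ring.inverse (block a G G) = T₂ := by
      rw [e1, e2, inverse_inverse hu1]
      ext1 x
      simp [hT1T]
    have e3' : Ring.inverse (block a G G) ∘L block a G C = T₃ := by
      rw [e1, e3, inverse_inverse hu1]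
      ext1 x
      simp [hTT1]
    rw [components, hS, e2', e3', e1, inverse_inverse hu1]

theorem injOn_components [CompleteSpace G] (hα : 0 < α) (hC : C = Gᗮ) :
    Set.InjOn (components G C) (admissibleFor α β G C) := by
  intro a ha b hb hab
  simp only [components, Prod.mk.injEq, ContinuousLinearMapWOT.ofCLM_injective.eq_iff] at hab
  obtain ⟨h1, h2, h3, h4⟩ := hab
  have ha := isUnit_block hα ha
  have hb := isUnit_block hα hb
  have e1 : block a G G = block b G G := by
    rw [← inverse_inverse ha, h1, inverse_inverse hb]
  rw [← h1] at h2 h3 h4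
  have e2 : block a C G = block b C G := by
    ext1 x
    have := congrArg (fun f : G →L[ℂ] C => f (block a G G x)) h2
    simpa [inverse_apply_apply ha] using this
  have e3 : block a G C = block b G C := by
    ext1 x
    have := congrArg (fun f : C →L[ℂ] G => block a G G (f x)) h3
    simpa [apply_inverse_apply ha] using this
  rw [e2, e3] at h4
  exact ext_of_blocks hC e1 e2 e3 (sub_left_injective h4)

theorem isClosed_offDiagonalLE [CompleteSpace G] [CompleteSpace C] (r : ℝ) :
    IsClosed (offDiagonalLE G C r) :=
  ((isClosed_wot_ball r).preimage (continuous_fst.comp continuous_snd)).inter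
    ((isClosed_wot_ball r).preimage (continuous_fst.comp (continuous_snd.comp continuous_snd)))

theorem isCompact_sectorialSet_inter [CompleteSpace G] [CompleteSpace C] (hα : 0 < α) (hβ : 0 < β)
    {r : ℝ} (hr : 0 ≤ r) : IsCompact (sectorialSet α β G C ∩ offDiagonalLE G C r) := by
  have h1 : IsCompact ({T : G →WOT[ℂ] G | ∀ x, ‖T x‖ ≤ α⁻¹ * ‖x‖} ×ˢ
      {T : G →WOT[ℂ] C | ∀ x, ‖T x‖ ≤ r * ‖x‖} ×ˢ
      {T : C →WOT[ℂ] G | ∀ x, ‖T x‖ ≤ r * ‖x‖} ×ˢ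
      {T : C →WOT[ℂ] C | ∀ x, ‖T x‖ ≤ (1 / β)⁻¹ * ‖x‖}) :=
    (isCompact_wot_ball (by positivity)).prod ((isCompact_wot_ball hr).prod
      ((isCompact_wot_ball hr).prod (isCompact_wot_ball (by positivity))))
  have h2 : IsClosed (sectorialSet α β G C) :=
    ((isClosed_isSectorial (1 / β) α hα.le).preimage continuous_fst).inter
      ((isClosed_isSectorial α (1 / β) (by positivity)).preimage
        (continuous_snd.comp (continuous_snd.comp continuous_snd)))
  refine h1.of_isClosed_subset (h2.inter (isClosed_offDiagonalLE r)) ?_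
  rintro T ⟨hs, hT⟩
  exact ⟨hs.1.norm_le hα, hT.1, hT.2, hs.2.norm_le (by positivity)⟩

theorem exists_components_subset [CompleteSpace G] [CompleteSpace C] (hα : 0 < α)
    {B : Set (H →L[ℂ] H)} (hB : Bornology.IsBounded B) :
    ∃ r, 0 ≤ r ∧ ∀ a ∈ B, a ∈ admissibleFor α β G C → components G C a ∈ offDiagonalLE G C r := by
  obtain ⟨R, hR0, hR⟩ := hB.exists_pos_norm_le
  -- `R` bounds every block of `a`, and `α⁻¹` bounds `a₀₀⁻¹` because `Re a₀₀ ≥ α`.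
  refine ⟨R * α⁻¹, by positivity, fun a haB ha => ?_⟩
  have hinv : ∀ x, ‖Ring.inverse (block a G G) x‖ ≤ α⁻¹ * ‖x‖ := by
    have h00 := isUnit_block hα ha
    refine IsSectorial.norm_le (r := 1 / β) hα ((isSectorial_iff h00.ringInverse).2
      ⟨ha.2.2.1, ?_⟩)
    rw [inverse_inverse h00]
    exact ha.2.1
  have hbl : ∀ (K L : Submodule ℂ H) [K.HasOrthogonalProjection] (x : L),
      ‖block a K L x‖ ≤ R * ‖x‖ := fun K L _ x =>
    (norm_block_le _ _ _ x).trans (by gcongr; exact hR _ haB)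
  constructor
  · intro x
    calc ‖block a C G (Ring.inverse (block a G G) x)‖
        ≤ R * ‖Ring.inverse (block a G G) x‖ := hbl _ _ _
      _ ≤ R * (α⁻¹ * ‖x‖) := by gcongr; exact hinv x
      _ = _ := by ring
  · intro x
    calc ‖Ring.inverse (block a G G) (block a G C x)‖
        ≤ α⁻¹ * ‖block a G C x‖ := hinv _
      _ ≤ α⁻¹ * (R * ‖x‖) := by gcongr; exact hbl _ _ _
      _ = _ := by ring

/-- Bounded sets of admissible operators have compact and metrisable closure, for any
parametrisation `A` of the admissible operators. -/
theorem compact_metrizable_closure [TopologicalSpace.SeparableSpace G]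
    [TopologicalSpace.SeparableSpace C] [CompleteSpace G] [CompleteSpace C] (hα : 0 < α)
    (hβ : 0 < β) (hC : C = Gᗮ) {X : Type*} [TopologicalSpace X] {A : X → H →L[ℂ] H}
    (hA : Function.Injective A) (hrange : Set.range A = admissibleFor α β G C)
    (hind : IsInducing fun x => components G C (A x))
    {B : Set (H →L[ℂ] H)} (hB : Bornology.IsBounded B) :
    IsCompact (closure {x | A x ∈ B}) ∧
      TopologicalSpace.MetrizableSpace (closure {x | A x ∈ B}) := by
  have hmem : ∀ x, A x ∈ admissibleFor α β G C := fun x => hrange ▸ ⟨x, rfl⟩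
  obtain ⟨r, hr, hBr⟩ := exists_components_subset (α := α) (β := β) (G := G) (C := C) hα hB
  set Φ := fun x => components G C (A x) with hΦ
  have hcl : closure {x | A x ∈ B} ⊆ Φ ⁻¹' offDiagonalLE G C r :=
    closure_minimal (fun x hx => hBr _ hx (hmem x))
      ((isClosed_offDiagonalLE r).preimage hind.continuous)
  have hK : IsCompact (Φ ⁻¹' offDiagonalLE G C r) := by
    rw [hind.isCompact_iff]
    -- The image of the preimage is the full sectorial part, because every sectorial quadruple is
    -- attained.
    convert isCompact_sectorialSet_inter (G := G) (C := C) hα hβ hr using 1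
    ext T
    constructor
    · rintro ⟨x, hx, rfl⟩
      exact ⟨components_mem_sectorialSet hα hC (hmem x), hx⟩
    · rintro ⟨hs, hT⟩
      obtain ⟨a, ha, rfl⟩ := exists_components_eq hα hβ hC hs
      rw [← hrange] at ha
      obtain ⟨x, rfl⟩ := ha
      exact ⟨x, hT, rfl⟩
  have hcomp := hK.of_isClosed_subset isClosed_closure hcl
  refine ⟨hcomp, ?_⟩
  have : CompactSpace (closure {x | A x ∈ B}) := isCompact_iff_compactSpace.1 hcomp
  -- A continuous injection of a compact space into a metrisable space is an embedding.
  let f := Prod.map (wotCoords G G) (Prod.map (wotCoords G C)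
    (Prod.map (wotCoords C G) (wotCoords C C)))
  have hf : Continuous f := (continuous_wotCoords _ _).prodMap ((continuous_wotCoords _ _).prodMap
    ((continuous_wotCoords _ _).prodMap (continuous_wotCoords _ _)))
  have hfi : Function.Injective f := (injective_wotCoords _ _).prodMap
    ((injective_wotCoords _ _).prodMap
      ((injective_wotCoords _ _).prodMap (injective_wotCoords _ _)))
  have hΦi : Function.Injective Φ := fun x y h =>
    hA (injOn_components hα hC (hmem x) (hmem y) h)
  have hg : Continuous fun x : closure {x | A x ∈ B} => f (Φ x) :=
    hf.comp (hind.continuous.comp continuous_subtype_val)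
  exact (hg.isClosedEmbedding (hfi.comp (hΦi.comp
    Subtype.val_injective))).isEmbedding.metrizableSpace

end Compactness

/-! ### The topology `τ_nlH` as the topology induced by the four components -/

theorem isInducing_four {X Y₁ Y₂ Y₃ Y₄ : Type*} [t₁ : TopologicalSpace Y₁]
    [t₂ : TopologicalSpace Y₂] [t₃ : TopologicalSpace Y₃] [t₄ : TopologicalSpace Y₄]
    (f₁ : X → Y₁) (f₂ : X → Y₂) (f₃ : X → Y₃) (f₄ : X → Y₄) :
    @IsInducing X (Y₁ × Y₂ × Y₃ × Y₄)
      (t₁.induced f₁ ⊓ t₂.induced f₂ ⊓ t₃.induced f₃ ⊓ t₄.induced f₄) _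
      fun x => (f₁ x, f₂ x, f₃ x, f₄ x) := by
  let : TopologicalSpace X := t₁.induced f₁ ⊓ t₂.induced f₂ ⊓ t₃.induced f₃ ⊓ t₄.induced f₄
  refine ⟨?_⟩
  simp only [instTopologicalSpaceProd, induced_inf, induced_compose, inf_assoc]
  rfl

theorem isInducing_components (α β : ℝ) (Ω : Set R3) :
    IsInducing fun a : Coeff α β Ω => components (gZero Ω) (cRange Ω) a.toCLM :=
  isInducing_four _ _ _ _

/-! ### Calculus of test functions -/

section Calculus

variable {Ω : Set R3}

section
variable {F : Type*} [NormedAddCommGroup F] [NormedSpace ℝ F]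

theorem IsTest.differentiable {φ : R3 → F} (h : IsTest Ω φ) : Differentiable ℝ φ :=
  h.1.differentiable (by simp)

theorem IsTest.continuous {φ : R3 → F} (h : IsTest Ω φ) : Continuous φ := h.1.continuous

theorem IsTest.memLp {φ : R3 → F} (h : IsTest Ω φ) (μ : Measure R3) [IsFiniteMeasureOnCompacts μ] :
    MemLp φ 2 μ :=
  h.continuous.memLp_of_hasCompactSupport h.2.1

theorem IsTest.eq_zero {φ : R3 → F} (h : IsTest Ω φ) {x : R3} (hx : x ∉ Ω) : φ x = 0 :=
  image_eq_zero_of_notMem_tsupport fun hx' => hx (h.2.2 hx')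

theorem isTest_of_tsupport_subset {G : Type*} [NormedAddCommGroup G] [NormedSpace ℝ G]
    {φ : R3 → F} {ψ : R3 → G} (h : IsTest Ω φ) (hψ : ContDiff ℝ ∞ ψ)
    (hs : tsupport ψ ⊆ tsupport φ) : IsTest Ω ψ :=
  ⟨hψ, h.2.1.of_isClosed_subset (isClosed_tsupport _) hs, hs.trans h.2.2⟩

theorem IsTest.add {φ ψ : R3 → F} (h : IsTest Ω φ) (h' : IsTest Ω ψ) : IsTest Ω (φ + ψ) :=
  ⟨h.1.add h'.1, h.2.1.add h'.2.1, (tsupport_add φ ψ).trans (Set.union_subset h.2.2 h'.2.2)⟩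

theorem IsTest.smul [NormedSpace ℂ F] [IsScalarTower ℝ ℂ F] {φ : R3 → F} (h : IsTest Ω φ) (c : ℂ) :
    IsTest Ω (c • φ) :=
  isTest_of_tsupport_subset h (h.1.const_smul c)
    (closure_mono (Function.support_const_smul_subset c φ))

theorem isTest_zero : IsTest Ω (0 : R3 → F) :=
  ⟨contDiff_const, HasCompactSupport.zero, by simp [tsupport]⟩

end

theorem fderiv_apply_eq_sum (f : R3 → ℂ) (x v : R3) :
    fderiv ℝ f x v = ∑ i, v i • pderiv i f x := by
  have hv : v = ∑ i, v i • (EuclideanSpace.single i 1 : R3) := by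
    ext j
    simp [Fin.sum_univ_three]
    fin_cases j <;> simp
  conv_lhs => rw [hv]
  rw [map_sum]
  simp only [map_smul, pderiv]

@[simp] theorem grad_apply (f : R3 → ℂ) (x : R3) (i : Fin 3) : grad f x i = pderiv i f x := by
  fin_cases i <;> rfl

/-- Cauchy-Schwarz. With `norm_grad_le` this compares the operator norm of the derivative with the
Euclidean norm of the gradient; the factor `2` there is a convenient bound for `√3`. -/
theorem norm_fderiv_le (f : R3 → ℂ) (x : R3) : ‖fderiv ℝ f x‖ ≤ ‖grad f x‖ := by
  refine ContinuousLinearMap.opNorm_le_bound _ (norm_nonneg _) fun v => ?_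
  rw [fderiv_apply_eq_sum, EuclideanSpace.norm_eq, EuclideanSpace.norm_eq]
  simp only [grad_apply]
  refine (norm_sum_le _ _).trans ?_
  simp only [norm_smul]
  rw [mul_comm]
  exact Real.sum_mul_le_sqrt_mul_sqrt _ _ _

theorem norm_grad_le (f : R3 → ℂ) (x : R3) : ‖grad f x‖ ≤ 2 * ‖fderiv ℝ f x‖ := by
  have h : ∀ i, ‖pderiv i f x‖ ≤ ‖fderiv ℝ f x‖ := fun i => by
    refine (ContinuousLinearMap.le_opNorm _ _).trans ?_
    simp
  rw [EuclideanSpace.norm_eq]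
  simp only [grad_apply]
  refine Real.sqrt_le_iff.2 ⟨by positivity, ?_⟩
  have h2 : ∀ i, ‖pderiv i f x‖ ^ 2 ≤ ‖fderiv ℝ f x‖ ^ 2 := fun i => by gcongr; exact h i
  rw [Fin.sum_univ_three]
  nlinarith [h2 0, h2 1, h2 2, sq_nonneg ‖fderiv ℝ f x‖]

theorem contDiff_pderiv {f : R3 → ℂ} (hf : ContDiff ℝ ∞ f) (i : Fin 3) :
    ContDiff ℝ ∞ (pderiv i f) :=
  (hf.fderiv_right (m := ∞) le_rfl).clm_apply contDiff_const

theorem tsupport_pderiv_subset (f : R3 → ℂ) (i : Fin 3) : tsupport (pderiv i f) ⊆ tsupport f := by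
  refine Set.Subset.trans (closure_mono ?_) (tsupport_fderiv_subset ℝ (f := f))
  intro x hx h0
  exact hx (by simp [pderiv, h0])

theorem IsTest.pderiv {f : R3 → ℂ} (hf : IsTest Ω f) (i : Fin 3) : IsTest Ω (pderiv i f) :=
  isTest_of_tsupport_subset hf (contDiff_pderiv hf.1 i) (tsupport_pderiv_subset f i)

theorem IsTest.apply {ψ : R3 → C3} (h : IsTest Ω ψ) (i : Fin 3) : IsTest Ω fun x => ψ x i := by
  refine isTest_of_tsupport_subset h ?_ ?_
  · exact ((EuclideanSpace.proj (𝕜 := ℂ) i).restrictScalars ℝ).contDiff.comp h.1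
  · refine closure_mono fun x hx h0 => hx ?_
    simp [h0]

theorem isTest_of_apply {ψ : R3 → C3} (h : ∀ i, IsTest Ω fun x => ψ x i) : IsTest Ω ψ := by
  have hs : tsupport ψ ⊆ ⋃ i, tsupport fun x => ψ x i := by
    refine closure_minimal (fun x hx => ?_) (isClosed_iUnion_of_finite fun i => isClosed_tsupport _)
    have : ∃ i, ψ x i ≠ 0 := by
      by_contra hc
      push Not at hc
      exact hx (by ext i; simp [hc i])
    obtain ⟨i, hi⟩ := this
    exact Set.mem_iUnion.2 ⟨i, subset_tsupport _ hi⟩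
  refine ⟨?_, ?_, hs.trans (Set.iUnion_subset fun i => (h i).2.2)⟩
  · exact (contDiff_piLp 2).2 fun i => (h i).1
  · exact (isCompact_iUnion fun i => (h i).2.1).of_isClosed_subset (isClosed_tsupport _) hs

theorem IsTest.sub {F : Type*} [NormedAddCommGroup F] [NormedSpace ℝ F] {φ ψ : R3 → F}
    (h : IsTest Ω φ) (h' : IsTest Ω ψ) : IsTest Ω (φ - ψ) := by
  rw [sub_eq_add_neg]
  refine h.add (isTest_of_tsupport_subset h' h'.1.neg ?_)
  exact closure_mono (by simp)

theorem IsTest.grad {f : R3 → ℂ} (hf : IsTest Ω f) : IsTest Ω (grad f) :=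
  isTest_of_apply fun i => by simpa using hf.pderiv i

theorem IsTest.curl {ψ : R3 → C3} (h : IsTest Ω ψ) : IsTest Ω (curl ψ) := by
  refine isTest_of_apply fun i => ?_
  fin_cases i
  · exact ((h.apply 2).pderiv 1).sub ((h.apply 1).pderiv 2)
  · exact ((h.apply 0).pderiv 2).sub ((h.apply 2).pderiv 0)
  · exact ((h.apply 1).pderiv 0).sub ((h.apply 0).pderiv 1)

theorem pderiv_add {f g : R3 → ℂ} {x : R3} (hf : DifferentiableAt ℝ f x)
    (hg : DifferentiableAt ℝ g x) (i : Fin 3) :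
    pderiv i (fun y => f y + g y) x = pderiv i f x + pderiv i g x := by
  simp [pderiv, fderiv_fun_add hf hg]

theorem pderiv_const_mul {f : R3 → ℂ} {x : R3} (hf : DifferentiableAt ℝ f x) (c : ℂ) (i : Fin 3) :
    pderiv i (fun y => c * f y) x = c * pderiv i f x := by
  simp [pderiv, fderiv_const_mul hf]

theorem grad_add {f g : R3 → ℂ} (hf : Differentiable ℝ f) (hg : Differentiable ℝ g) :
    grad (f + g) = grad f + grad g := by
  ext x i
  rw [Pi.add_apply, PiLp.add_apply, grad_apply, grad_apply, grad_apply]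
  exact pderiv_add (hf x) (hg x) i

theorem grad_smul {f : R3 → ℂ} (hf : Differentiable ℝ f) (c : ℂ) :
    grad (c • f) = c • grad f := by
  ext x i
  rw [Pi.smul_apply, PiLp.smul_apply, grad_apply, grad_apply]
  exact pderiv_const_mul (hf x) c i

theorem curl_add {φ ψ : R3 → C3} (hφ : ∀ i, Differentiable ℝ fun x => φ x i)
    (hψ : ∀ i, Differentiable ℝ fun x => ψ x i) : curl (φ + ψ) = curl φ + curl ψ := by
  ext x i
  have h := fun i j => pderiv_add (hφ i x) (hψ i x) j
  fin_cases i <;> simp [curl, h] <;> ring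

theorem curl_smul {φ : R3 → C3} (hφ : ∀ i, Differentiable ℝ fun x => φ x i) (c : ℂ) :
    curl (c • φ) = c • curl φ := by
  ext x i
  have h := fun i j => pderiv_const_mul (hφ i x) c j
  fin_cases i <;> simp [curl, h] <;> ring

theorem pderiv_comm {f : R3 → ℂ} (hf : ContDiff ℝ ∞ f) (i j : Fin 3) (x : R3) :
    pderiv i (pderiv j f) x = pderiv j (pderiv i f) x := by
  have hs : IsSymmSndFDerivAt ℝ f x := hf.contDiffAt.isSymmSndFDerivAt (by
    rw [minSmoothness_of_isRCLikeNormedField]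
    exact WithTop.coe_le_coe.2 le_top)
  have hd : DifferentiableAt ℝ (fderiv ℝ f) x :=
    (hf.fderiv_right (m := ∞) le_rfl).differentiable (by simp) x
  have h : ∀ i j, pderiv i (pderiv j f) x =
      fderiv ℝ (fderiv ℝ f) x (EuclideanSpace.single i 1) (EuclideanSpace.single j 1) := by
    intro i j
    change fderiv ℝ (fun y => fderiv ℝ f y (EuclideanSpace.single j 1)) x _ = _
    rw [fderiv_clm_apply hd (differentiableAt_const _)]
    simp
  rw [h, h, hs.eq]

theorem curl_grad {f : R3 → ℂ} (hf : ContDiff ℝ ∞ f) : curl (grad f) = 0 := by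
  have h : ∀ i, (fun y => grad f y i) = pderiv i f := fun i => funext fun y => grad_apply f y i
  ext x i
  fin_cases i
  · change pderiv 1 (fun y => grad f y 2) x - pderiv 2 (fun y => grad f y 1) x = 0
    rw [h, h, pderiv_comm hf, sub_self]
  · change pderiv 2 (fun y => grad f y 0) x - pderiv 0 (fun y => grad f y 2) x = 0
    rw [h, h, pderiv_comm hf, sub_self]
  · change pderiv 0 (fun y => grad f y 1) x - pderiv 1 (fun y => grad f y 0) x = 0
    rw [h, h, pderiv_comm hf, sub_self]

theorem pderiv_conj (f : R3 → ℂ) (i : Fin 3) (x : R3) :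
    pderiv i (fun y => (starRingEnd ℂ) (f y)) x = (starRingEnd ℂ) (pderiv i f x) := by
  have := Complex.conjCLE.comp_fderiv (f := f) (x := x)
  simp only [pderiv]
  change fderiv ℝ (Complex.conjCLE ∘ f) x _ = _
  rw [this]
  simp

/-- Integration by parts on the whole space; compact support removes boundary terms. -/
theorem integral_pderiv_mul {f g : R3 → ℂ} (hf : IsTest Ω f) (hg : IsTest Ω g) (i : Fin 3) :
    ∫ x, (starRingEnd ℂ) (pderiv i f x) * g x = - ∫ x, (starRingEnd ℂ) (f x) * pderiv i g x := by
  have hint : ∀ {a b : R3 → ℂ}, IsTest Ω a → IsTest Ω b →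
      Integrable (fun x => (starRingEnd ℂ) (a x) * b x) := fun ha hb =>
    ((Complex.continuous_conj.comp ha.continuous).mul hb.continuous).integrable_of_hasCompactSupport
      hb.2.1.mul_left
  have hd : Differentiable ℝ fun x => (starRingEnd ℂ) (f x) :=
    Complex.conjCLE.differentiable.comp hf.differentiable
  have key := integral_mul_fderiv_eq_neg_fderiv_mul_of_integrable (μ := (volume : Measure R3))
    (f := fun x => (starRingEnd ℂ) (f x)) (g := g) (v := EuclideanSpace.single i 1) ?_
    (hint hf (hg.pderiv i)) (hint hf hg) (fun x _ => hd x) (fun x _ => hg.differentiable x)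
  · change ∫ x, (starRingEnd ℂ) (f x) * pderiv i g x =
      -∫ x, pderiv i (fun y => (starRingEnd ℂ) (f y)) x * g x at key
    simp only [pderiv_conj] at key
    rw [key, neg_neg]
  · have := hint (hf.pderiv i) hg
    simp only [← pderiv_conj] at this
    exact this

theorem integral_sub_add_sub {a b c d e f : R3 → ℂ} (ha : Integrable a) (hb : Integrable b)
    (hc : Integrable c) (hd : Integrable d) (he : Integrable e) (hf : Integrable f) :
    ∫ x, (((a x - b x) + (c x - d x)) + (e x - f x)) =
      (((∫ x, a x) - ∫ x, b x) + ((∫ x, c x) - ∫ x, d x)) + ((∫ x, e x) - ∫ x, f x) := by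
  exact (integral_add ((ha.sub hb).add (hc.sub hd)) (he.sub hf)).trans
    (congrArg₂ (· + ·) ((integral_add (ha.sub hb) (hc.sub hd)).trans
      (congrArg₂ (· + ·) (integral_sub ha hb) (integral_sub hc hd))) (integral_sub he hf))

theorem integral_inner_curl {φ ψ : R3 → C3} (hφ : IsTest Ω φ) (hψ : IsTest Ω ψ) :
    ∫ x, inner ℂ (curl φ x) (ψ x) = ∫ x, inner ℂ (φ x) (curl ψ x) := by
  have hint : ∀ {a b : R3 → ℂ}, IsTest Ω a → IsTest Ω b →
      Integrable (fun x => (starRingEnd ℂ) (a x) * b x) := fun ha hb =>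
    ((Complex.continuous_conj.comp ha.continuous).mul hb.continuous).integrable_of_hasCompactSupport
      hb.2.1.mul_left
  have hI := fun i j k => hint ((hφ.apply i).pderiv j) (hψ.apply k)
  have hJ := fun i j k => hint (hφ.apply i) ((hψ.apply k).pderiv j)
  have hP := fun i j k => integral_pderiv_mul (hφ.apply i) (hψ.apply k) j
  have e1 : ∀ x, inner ℂ (curl φ x) (ψ x) =
      (((starRingEnd ℂ) (pderiv 1 (fun y => φ y 2) x) * ψ x 0 -
        (starRingEnd ℂ) (pderiv 2 (fun y => φ y 1) x) * ψ x 0) +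
      ((starRingEnd ℂ) (pderiv 2 (fun y => φ y 0) x) * ψ x 1 -
        (starRingEnd ℂ) (pderiv 0 (fun y => φ y 2) x) * ψ x 1)) +
      ((starRingEnd ℂ) (pderiv 0 (fun y => φ y 1) x) * ψ x 2 -
        (starRingEnd ℂ) (pderiv 1 (fun y => φ y 0) x) * ψ x 2) := by
    intro x
    simp [PiLp.inner_apply, Fin.sum_univ_three, curl]
    ring
  have e2 : ∀ x, inner ℂ (φ x) (curl ψ x) =
      (((starRingEnd ℂ) (φ x 0) * pderiv 1 (fun y => ψ y 2) x -
        (starRingEnd ℂ) (φ x 0) * pderiv 2 (fun y => ψ y 1) x) +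
      ((starRingEnd ℂ) (φ x 1) * pderiv 2 (fun y => ψ y 0) x -
        (starRingEnd ℂ) (φ x 1) * pderiv 0 (fun y => ψ y 2) x)) +
      ((starRingEnd ℂ) (φ x 2) * pderiv 0 (fun y => ψ y 1) x -
        (starRingEnd ℂ) (φ x 2) * pderiv 1 (fun y => ψ y 0) x) := by
    intro x
    simp [PiLp.inner_apply, Fin.sum_univ_three, curl]
    ring
  simp only [e1, e2]
  rw [integral_sub_add_sub (hI 2 1 0) (hI 1 2 0) (hI 0 2 1) (hI 2 0 1) (hI 1 0 2) (hI 0 1 2),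
    integral_sub_add_sub (hJ 0 1 2) (hJ 0 2 1) (hJ 1 2 0) (hJ 1 0 2) (hJ 2 0 1) (hJ 2 1 0)]
  simp only [hP]
  ring

end Calculus

/-! ### The graphs of the differential operators -/

section GraphTheory

variable {Ω : Set R3} {F G : Type*} [NormedAddCommGroup F] [InnerProductSpace ℂ F]
  [NormedAddCommGroup G] [InnerProductSpace ℂ G]

/-- Since the operator is linear on test functions, taking the span adds nothing, and closed
conditions need only be checked on genuine test pairs. -/
theorem mem_testPairs_of_mem_span {D : (R3 → F) → (R3 → G)}
    (hadd : ∀ φ ψ, IsTest Ω φ → IsTest Ω ψ → D (φ + ψ) = D φ + D ψ)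
    (hsmul : ∀ (c : ℂ) φ, IsTest Ω φ → D (c • φ) = c • D φ)
    {p : Lp F 2 (volume.restrict Ω) × Lp G 2 (volume.restrict Ω)}
    (hp : p ∈ Submodule.span ℂ (testPairs Ω D)) : p ∈ testPairs Ω D := by
  induction hp using Submodule.span_induction with
  | mem x hx => exact hx
  | zero =>
    refine ⟨0, isTest_zero, Lp.coeFn_zero _ _ _, ?_⟩
    have h0 : D 0 = 0 := by simpa using hsmul 0 0 isTest_zero
    rw [h0]
    exact Lp.coeFn_zero _ _ _
  | add x y _ _ hx hy =>
    obtain ⟨φ, hφ, h1, h2⟩ := hx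
    obtain ⟨ψ, hψ, h3, h4⟩ := hy
    refine ⟨φ + ψ, hφ.add hψ, (Lp.coeFn_add _ _).trans (h1.add h3), ?_⟩
    rw [hadd φ ψ hφ hψ]
    exact (Lp.coeFn_add _ _).trans (h2.add h4)
  | smul c x _ hx =>
    obtain ⟨φ, hφ, h1, h2⟩ := hx
    refine ⟨c • φ, hφ.smul c, (Lp.coeFn_smul _ _).trans (h1.const_smul c), ?_⟩
    rw [hsmul c φ hφ]
    exact (Lp.coeFn_smul _ _).trans (h2.const_smul c)

/-- A closed condition that holds for test pairs holds on the graph of the closure. -/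
theorem minGraph_induction {D : (R3 → F) → (R3 → G)}
    (hadd : ∀ φ ψ, IsTest Ω φ → IsTest Ω ψ → D (φ + ψ) = D φ + D ψ)
    (hsmul : ∀ (c : ℂ) φ, IsTest Ω φ → D (c • φ) = c • D φ)
    {P : Lp F 2 (volume.restrict Ω) × Lp G 2 (volume.restrict Ω) → Prop}
    (hP : IsClosed {p | P p}) (h : ∀ p ∈ testPairs Ω D, P p) {p} (hp : p ∈ minGraph Ω D) : P p :=
  closure_minimal (fun _ hq => h _ (mem_testPairs_of_mem_span hadd hsmul hq)) hP hp

theorem testPairs_subset_minGraph (D : (R3 → F) → (R3 → G)) :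
    testPairs Ω D ⊆ minGraph Ω D :=
  Submodule.subset_span.trans (Submodule.le_topologicalClosure _)

theorem gradZeroGraph_induction {P : L2s Ω × L2v Ω → Prop} (hP : IsClosed {p | P p})
    (h : ∀ p ∈ testPairs Ω grad, P p) {p} (hp : p ∈ gradZeroGraph Ω) : P p :=
  minGraph_induction (fun _ _ hφ hψ => grad_add hφ.differentiable hψ.differentiable)
    (fun c _ hφ => grad_smul hφ.differentiable c) hP h hp

theorem curlZeroGraph_induction {P : L2v Ω × L2v Ω → Prop} (hP : IsClosed {p | P p})
    (h : ∀ p ∈ testPairs Ω curl, P p) {p} (hp : p ∈ curlZeroGraph Ω) : P p :=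
  minGraph_induction (fun _ _ hφ hψ => curl_add (fun i => (hφ.apply i).differentiable)
      fun i => (hψ.apply i).differentiable)
    (fun c _ hφ => curl_smul (fun i => (hφ.apply i).differentiable) c) hP h hp

theorem isClosed_gradZeroGraph : IsClosed (gradZeroGraph Ω : Set (L2s Ω × L2v Ω)) :=
  Submodule.isClosed_topologicalClosure _

theorem isClosed_curlZeroGraph : IsClosed (curlZeroGraph Ω : Set (L2v Ω × L2v Ω)) :=
  Submodule.isClosed_topologicalClosure _

theorem grad_mem_gZero {q : L2s Ω × L2v Ω} (hq : q ∈ testPairs Ω grad) : q.2 ∈ gZero Ω :=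
  ⟨q, testPairs_subset_minGraph _ hq, rfl⟩

/-- A closed condition that holds for gradients of test functions holds on `g_0`. -/
theorem gZero_induction {P : L2v Ω → Prop} (hP : IsClosed {w | P w})
    (h : ∀ p ∈ testPairs Ω grad, P p.2) {w} (hw : w ∈ gZero Ω) : P w := by
  obtain ⟨p, hp, rfl⟩ := hw
  exact gradZeroGraph_induction (P := fun p => P p.2) (hP.preimage continuous_snd) h hp

theorem curl_grad_mem_testPairs {q : L2s Ω × L2v Ω} (hq : q ∈ testPairs Ω grad) :
    (q.2, (0 : L2v Ω)) ∈ testPairs Ω curl := by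
  obtain ⟨φ, hφ, -, h2⟩ := hq
  refine ⟨grad φ, hφ.grad, h2, ?_⟩
  rw [curl_grad hφ.1]
  exact Lp.coeFn_zero _ _ _

theorem mk_zero_mem_curlZeroGraph {w : L2v Ω} (hw : w ∈ gZero Ω) :
    (w, (0 : L2v Ω)) ∈ curlZeroGraph Ω :=
  gZero_induction (P := fun w => (w, (0 : L2v Ω)) ∈ curlZeroGraph Ω)
    (isClosed_curlZeroGraph.preimage (continuous_id.prodMk continuous_const))
    (fun _ hp => testPairs_subset_minGraph _ (curl_grad_mem_testPairs hp)) hw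

/-- A gradient of a test function is a curl-free test field; inserting it in the weak definition of
the curl gives orthogonality, which extends to `g₀` by closure. -/
theorem cRange_le_orthogonal : cRange Ω ≤ (gZero Ω)ᗮ := by
  rintro _ ⟨p, hp, rfl⟩
  rw [Submodule.mem_orthogonal]
  intro w hw
  refine gZero_induction (P := fun w => inner ℂ w p.2 = 0)
    (isClosed_eq (continuous_id.inner continuous_const) continuous_const) (fun q hq => ?_) hw
  have := hp _ (curl_grad_mem_testPairs hq)
  simpa using this.symm

theorem orthogonal_le_kerDive : (gZero Ω)ᗮ ≤ kerDive Ω := by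
  intro w hw q hq
  obtain ⟨φ, hφ, h1, h2⟩ := hq
  have hmem : (-q.2) ∈ gZero Ω := by
    refine grad_mem_gZero (q := (q.1, -q.2)) ⟨φ, hφ, h1, ?_⟩
    refine (Lp.coeFn_neg _).trans ?_
    have := h2.neg
    simpa using this
  have := Submodule.mem_orthogonal _ _ |>.1 hw _ hmem
  simpa using this

theorem inner_testPairs_curl {p q : L2v Ω × L2v Ω} (hp : p ∈ testPairs Ω curl)
    (hq : q ∈ testPairs Ω curl) : inner ℂ q.2 p.1 = inner ℂ q.1 p.2 := by
  obtain ⟨φ, hφ, h1, h2⟩ := hp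
  obtain ⟨ψ, hψ, h3, h4⟩ := hq
  rw [L2.inner_def, L2.inner_def]
  have e1 : ∫ a, inner ℂ (q.2 a) (p.1 a) ∂(volume.restrict Ω) =
      ∫ a in Ω, inner ℂ (curl ψ a) (φ a) := by
    refine integral_congr_ae ?_
    filter_upwards [h1, h4] with a ha hb
    rw [ha, hb]
  have e2 : ∫ a, inner ℂ (q.1 a) (p.2 a) ∂(volume.restrict Ω) =
      ∫ a in Ω, inner ℂ (ψ a) (curl φ a) := by
    refine integral_congr_ae ?_
    filter_upwards [h2, h3] with a ha hb
    rw [ha, hb]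
  rw [e1, e2, setIntegral_eq_integral_of_forall_compl_eq_zero
      (fun x hx => by rw [hφ.eq_zero hx, inner_zero_right]),
    setIntegral_eq_integral_of_forall_compl_eq_zero
      (fun x hx => by rw [hψ.eq_zero hx, inner_zero_left])]
  exact integral_inner_curl hψ hφ

/-- The curl is formally self-adjoint on test fields, and the weak identity is stable under graph
limits. -/
theorem curlZeroGraph_le_curlGraph : curlZeroGraph Ω ≤ curlGraph Ω := by
  intro p hp q hq
  refine curlZeroGraph_induction (P := fun p => inner ℂ q.2 p.1 = inner ℂ q.1 p.2)
    (isClosed_eq (continuous_const.inner continuous_fst) (continuous_const.inner continuous_snd))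
    (fun p hp => inner_testPairs_curl hp hq) hp

theorem eq_zero_of_mem_curlZeroGraph (hΩ : IsTopologicallyTrivial Ω) {w : L2v Ω}
    (hw : w ∈ (gZero Ω)ᗮ) (hc : (w, (0 : L2v Ω)) ∈ curlZeroGraph Ω) : w = 0 := by
  have hmem : w ∈ harmonicD Ω :=
    ⟨⟨⟨_, hc, rfl⟩, orthogonal_le_kerDive hw⟩, curlZeroGraph_le_curlGraph hc⟩
  have := rank_zero_iff_forall_zero.1 hΩ.1 ⟨w, hmem⟩
  simpa using this

/-- The Friedrichs inequality for test functions. -/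
theorem exists_norm_le_norm_grad (hΩ : IsOpen Ω) (hb : Bornology.IsBounded Ω) :
    ∃ C : NNReal, ∀ p ∈ testPairs Ω grad, ‖p.1‖ ≤ C * ‖p.2‖ := by
  set C := eLpNormLESNormFDerivOfLeConst ℂ (volume : Measure R3) Ω 2 2
  refine ⟨C, ?_⟩
  rintro p ⟨φ, hφ, h1, h2⟩
  have hsupp : Function.support φ ⊆ Ω := (subset_tsupport φ).trans hφ.2.2
  have key := eLpNorm_le_eLpNorm_fderiv (F := ℂ) (volume : Measure R3)
    (hφ.1.of_le (by exact_mod_cast le_top)) hsupp (p := 2) (by norm_num)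
    (by simp; norm_num) hb
  have e1 : eLpNorm p.1 2 (volume.restrict Ω) ≤ eLpNorm φ 2 volume := by
    rw [eLpNorm_congr_ae h1]
    exact eLpNorm_mono_measure _ Measure.restrict_le_self
  have e2 : eLpNorm (fderiv ℝ φ) 2 volume ≤ eLpNorm p.2 2 (volume.restrict Ω) := by
    rw [eLpNorm_congr_ae h2]
    calc eLpNorm (fderiv ℝ φ) 2 volume ≤ eLpNorm (grad φ) 2 volume :=
          eLpNorm_mono (norm_fderiv_le φ)
      _ = eLpNorm (grad φ) 2 (volume.restrict Ω) := by
          rw [← eLpNorm_indicator_eq_eLpNorm_restrict hΩ.measurableSet]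
          congr 1
          refine (Set.indicator_eq_self.2 fun x hx => ?_).symm
          by_contra hx'
          exact hx (hφ.grad.eq_zero hx')
  rw [Lp.norm_def, Lp.norm_def]
  have : eLpNorm p.1 2 (volume.restrict Ω) ≤ C * eLpNorm p.2 2 (volume.restrict Ω) :=
    e1.trans (key.trans (by gcongr; exact e2))
  have := ENNReal.toReal_mono (ENNReal.mul_ne_top ENNReal.coe_ne_top (Lp.eLpNorm_ne_top _)) this
  simpa using this

/-- Friedrichs' inequality passes to the closed graph of `grad` on `H₀¹` and makes the projection to
the gradient bounded below, so its range is closed. -/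
theorem isClosed_gZero (hΩ : IsOpen Ω) (hb : Bornology.IsBounded Ω) :
    IsClosed (gZero Ω : Set (L2v Ω)) := by
  obtain ⟨C, h⟩ := exists_norm_le_norm_grad hΩ hb
  have h' : ∀ p ∈ gradZeroGraph Ω, ‖p.1‖ ≤ C * ‖p.2‖ := fun p hp =>
    gradZeroGraph_induction (P := fun p => ‖p.1‖ ≤ C * ‖p.2‖)
      (isClosed_le (by fun_prop) (by fun_prop)) h hp
  have : CompleteSpace (gradZeroGraph Ω) := isClosed_gradZeroGraph.completeSpace_coe
  let f : gradZeroGraph Ω →L[ℂ] L2v Ω :=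
    (ContinuousLinearMap.snd ℂ (L2s Ω) (L2v Ω)) ∘L (gradZeroGraph Ω).subtypeL
  -- The graph carries the maximum norm: `C` handles the function and `1` the gradient.
  have hf : AntilipschitzWith (max C 1) f := by
    refine f.antilipschitz_of_bound fun p => ?_
    have h1 := h' p p.2
    have h2 : ‖p‖ = max ‖(p : L2s Ω × L2v Ω).1‖ ‖(p : L2s Ω × L2v Ω).2‖ := rfl
    rw [h2, NNReal.coe_max, max_mul_of_nonneg _ _ (norm_nonneg _)]
    refine max_le_max h1 ?_
    simp [f]
  have hr := hf.isClosed_range f.uniformContinuous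
  convert hr using 1
  ext w
  constructor
  · rintro ⟨p, hp, rfl⟩
    exact ⟨⟨p, hp⟩, rfl⟩
  · rintro ⟨p, rfl⟩
    exact ⟨p, p.2, rfl⟩

/-- The key estimate: up to gradients and a finite-dimensional space, test fields are controlled
by their curl. -/
def HasCurlEstimate (Ω : Set R3) : Prop :=
  ∃ (C : ℝ) (V : Submodule ℂ (L2v Ω)), FiniteDimensional ℂ V ∧
    ∀ q ∈ testPairs Ω curl, ∃ g ∈ gZero Ω, ∃ f ∈ V, ‖q.1 - g - f‖ ≤ C * ‖q.2‖

/-! ### Bounded below curl and the Helmholtz decomposition -/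

theorem starProjection_orthogonal_mem_curlZeroGraph [(gZero Ω).HasOrthogonalProjection]
    {p : L2v Ω × L2v Ω} (hp : p ∈ curlZeroGraph Ω) :
    ((gZero Ω)ᗮ.starProjection p.1, p.2) ∈ curlZeroGraph Ω := by
  -- Removing the `g₀`-part keeps the field in `H₀(curl)` and does not change its curl.
  have h := (curlZeroGraph Ω).sub_mem hp
    (mk_zero_mem_curlZeroGraph ((gZero Ω).starProjection_apply_mem p.1))
  convert h using 1
  ext1
  · exact Submodule.starProjection_orthogonal_val p.1
  · simp

/-- Let `Γ` be the graph of a closed operator. If the operator is injective on the orthogonal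
complement of `K` and bounded below modulo `K` and a finite-dimensional space, then it is bounded
below on the orthogonal complement of `K`. -/
theorem exists_norm_le_of_finiteDimensional {H : Type*} [NormedAddCommGroup H]
    [InnerProductSpace ℂ H] {Γ : Submodule ℂ (H × H)} (hΓ : IsClosed (Γ : Set (H × H)))
    {K : Submodule ℂ H} [K.HasOrthogonalProjection]
    (hinj : ∀ w ∈ Kᗮ, (w, (0 : H)) ∈ Γ → w = 0) {T : Set (H × H)}
    (hT : (Γ : Set (H × H)) ⊆ closure T) {C : ℝ} {V : Submodule ℂ H} [FiniteDimensional ℂ V]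
    (hest : ∀ q ∈ T, ∃ g ∈ K, ∃ f ∈ V, ‖q.1 - g - f‖ ≤ C * ‖q.2‖) :
    ∃ C : NNReal, ∀ p ∈ Γ, p.1 ∈ Kᗮ → ‖p.1‖ ≤ C * ‖p.2‖ := by
  set P := Kᗮ.starProjection with hP
  set V' := V.map P.toLinearMap with hV'
  have hfin : FiniteDimensional ℂ V' := inferInstance
  set Q := V'ᗮ.starProjection with hQ
  -- Projecting away `K` and then the image of `V` eliminates the choices of `g` and `f`. What
  -- remains is a closed condition on `p`, so it passes from `T` to `Γ`.
  have hQP : ∀ p ∈ Γ, ‖Q (P p.1)‖ ≤ C * ‖p.2‖ := fun p hp => by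
    refine closure_minimal (t := {p : H × H | ‖Q (P p.1)‖ ≤ C * ‖p.2‖}) (fun q hq => ?_)
      (isClosed_le (by fun_prop) (by fun_prop)) (hT hp)
    rw [Set.mem_ofPred_eq]
    obtain ⟨g, hg, f, hf, hle⟩ := hest q hq
    have h1 : P g = 0 := by
      rw [hP, Submodule.starProjection_apply_eq_zero_iff]
      exact Submodule.le_orthogonal_orthogonal _ hg
    have h2 : Q (P f) = 0 := by
      rw [hQ, Submodule.starProjection_apply_eq_zero_iff]
      exact Submodule.le_orthogonal_orthogonal _ ⟨f, hf, rfl⟩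
    have h3 : Q (P q.1) = Q (P (q.1 - g - f)) := by
      rw [map_sub, map_sub, map_sub, h1, map_sub, h2]
      simp
    rw [h3]
    exact ((V'ᗮ.norm_starProjection_apply_le _).trans
      (Kᗮ.norm_starProjection_apply_le _)).trans hle
  by_contra hcon
  push Not at hcon
  have hseq : ∀ n : ℕ, ∃ p ∈ Γ, p.1 ∈ Kᗮ ∧ ‖p.1‖ = 1 ∧
      ‖p.2‖ ≤ 1 / ((n : ℝ) + 1) := by
    intro n
    obtain ⟨p, hp, hp1, hlt⟩ := hcon (n + 1)
    have hpos : 0 < ‖p.1‖ := lt_of_le_of_lt (by positivity) hlt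
    refine ⟨((‖p.1‖⁻¹ : ℝ) : ℂ) • p, Submodule.smul_mem _ _ hp, Submodule.smul_mem _ _ hp1, ?_, ?_⟩
    · simp [norm_smul, hpos.ne']
    · rw [Prod.smul_snd, norm_smul]
      have : ‖((‖p.1‖⁻¹ : ℝ) : ℂ)‖ = ‖p.1‖⁻¹ := by simp
      rw [this, inv_mul_eq_div, div_le_div_iff₀ hpos (by positivity), one_mul, mul_comm]
      push_cast at hlt
      exact hlt.le
  choose p hp hp1 hnorm hlim using hseq
  have hlim2 : Filter.Tendsto (fun n => (p n).2) Filter.atTop (𝓝 0) :=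
    squeeze_zero_norm hlim tendsto_one_div_add_atTop_nhds_zero_nat
  have hPp : ∀ n, P (p n).1 = (p n).1 := fun n =>
    Submodule.starProjection_eq_self_iff.2 (hp1 n)
  have hlimQ : Filter.Tendsto (fun n => Q (p n).1) Filter.atTop (𝓝 0) := by
    refine squeeze_zero_norm (fun n => ?_)
      (by simpa using (hlim2.norm).const_mul C)
    have := hQP _ (hp n)
    rwa [hPp] at this
  -- The part of the normalised sequence that does not tend to zero lives in a finite-dimensional
  -- ball, so it has a convergent subsequence.
  let v : ℕ → V' := fun n => V'.orthogonalProjectionOnto (p n).1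
  have hv : ∀ n, (v n : H) = (p n).1 - Q (p n).1 := by
    intro n
    have := Submodule.starProjection_orthogonal_val (K := V') (p n).1
    rw [hQ, this, sub_sub_cancel]
    rfl
  have hvb : ∀ n, v n ∈ Metric.closedBall (0 : V') 1 := by
    intro n
    rw [mem_closedBall_zero_iff, ← hnorm n]
    exact V'.norm_orthogonalProjectionOnto_apply_le _
  have hproper : ProperSpace V' := FiniteDimensional.proper ℂ V'
  obtain ⟨f, -, s, hs, hf⟩ := (isCompact_closedBall (0 : V') 1).tendsto_subseq hvb
  have hlim1 : Filter.Tendsto (fun n => (p (s n)).1) Filter.atTop (𝓝 (f : H)) := by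
    have h1 : Filter.Tendsto (fun n => (v (s n) : H)) Filter.atTop (𝓝 (f : H)) :=
      (continuous_subtype_val.tendsto f).comp hf
    have h2 := h1.add (hlimQ.comp hs.tendsto_atTop)
    rw [add_zero] at h2
    refine h2.congr fun n => ?_
    simp [hv]
  -- The limit is a unit vector in `Kᗮ` which the closed operator maps to zero, contrary to
  -- injectivity.
  have hf0 : (f : H) = 0 := by
    refine hinj _ ?_ ?_
    · exact K.isClosed_orthogonal.mem_of_tendsto hlim1
        (Filter.Eventually.of_forall fun n => hp1 _)
    · exact hΓ.mem_of_tendsto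
        (hlim1.prodMk_nhds (hlim2.comp hs.tendsto_atTop))
        (Filter.Eventually.of_forall fun n => hp _)
  have h1 : ‖(f : H)‖ = 1 :=
    tendsto_nhds_unique hlim1.norm (by simp [hnorm])
  rw [hf0, norm_zero] at h1
  exact zero_ne_one h1

/-- Riesz' theorem gives preimages under the adjoint of an operator that is bounded below. -/
theorem exists_adjoint_preimage {H : Type*} [NormedAddCommGroup H] [InnerProductSpace ℂ H]
    [CompleteSpace H] {Γ : Submodule ℂ (H × H)} {K : Submodule ℂ H} [K.HasOrthogonalProjection]
    (hproj : ∀ p ∈ Γ, (Kᗮ.starProjection p.1, p.2) ∈ Γ) {C : NNReal}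
    (hC : ∀ p ∈ Γ, p.1 ∈ Kᗮ → ‖p.1‖ ≤ C * ‖p.2‖) {w : H} (hw : w ∈ Kᗮ) :
    ∃ z : H, ∀ q ∈ Γ, inner ℂ q.2 z = inner ℂ q.1 w := by
  let M : Submodule ℂ (H × H) :=
    Γ ⊓ Kᗮ.comap (LinearMap.fst ℂ H H)
  let S : M →ₗ[ℂ] H := LinearMap.snd ℂ H H ∘ₗ M.subtype
  have hSb : ∀ p : M, ‖(p : H × H).1‖ ≤ C * ‖S p‖ := fun p => hC p p.2.1 p.2.2
  have hS : Function.Injective S := by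
    rw [← LinearMap.ker_eq_bot, LinearMap.ker_eq_bot']
    intro p hp
    have h1 := hSb p
    rw [hp, norm_zero, mul_zero] at h1
    ext1
    exact Prod.ext (norm_le_zero_iff.1 h1) hp
  let e := LinearEquiv.ofInjective S hS
  -- The functional `S p ↦ ⟨w, p.1⟩` is well defined and bounded because the operator is bounded
  -- below on `Kᗮ`.
  let ℓ : S.range →ₗ[ℂ] ℂ := (innerSL ℂ w).toLinearMap ∘ₗ LinearMap.fst ℂ H H ∘ₗ
    M.subtype ∘ₗ e.symm.toLinearMap
  have hℓ : ∀ p : M, ℓ (e p) = inner ℂ w (p : H × H).1 := fun p => by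
    simp [ℓ]
  let ℓ' : StrongDual ℂ S.range := ℓ.mkContinuous (‖w‖ * C) (by
    intro r
    obtain ⟨p, rfl⟩ := e.surjective r
    rw [hℓ, mul_assoc]
    exact (norm_inner_le_norm _ _).trans (by gcongr; exact hSb p))
  obtain ⟨L, hL, -⟩ := exists_extension_norm_eq S.range ℓ'
  refine ⟨(InnerProductSpace.toDual ℂ H).symm L, fun q hq => ?_⟩
  -- A general `q` may be replaced by its projection: the second entry is the same, and `w ∈ Kᗮ`
  -- does not see the difference.
  have hqm : (Kᗮ.starProjection q.1, q.2) ∈ M :=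
    ⟨hproj q hq,
      Kᗮ.starProjection_apply_mem q.1⟩
  have h1 : L q.2 = inner ℂ w (Kᗮ.starProjection q.1) :=
    (hL (e ⟨_, hqm⟩)).trans (hℓ ⟨_, hqm⟩)
  have h2 : inner ℂ w (Kᗮ.starProjection q.1) = inner ℂ w q.1 := by
    rw [← Submodule.inner_starProjection_left_eq_right, Submodule.starProjection_eq_self_iff.2 hw]
  rw [h2, ← InnerProductSpace.toDual_symm_apply] at h1
  have := congrArg (starRingEnd ℂ) h1
  rwa [inner_conj_symm, inner_conj_symm] at this

theorem curlZeroGraph_subset_closure :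
    (curlZeroGraph Ω : Set (L2v Ω × L2v Ω)) ⊆ closure (testPairs Ω curl) := fun _ hp =>
  curlZeroGraph_induction (P := fun p => p ∈ closure (testPairs Ω curl)) isClosed_closure
    (fun _ hq => subset_closure hq) hp

/-- The Helmholtz decomposition: `c` is the orthogonal complement of `g_0`. -/
theorem cRange_eq_orthogonal (htriv : IsTopologicallyTrivial Ω)
    [(gZero Ω).HasOrthogonalProjection] (hest : HasCurlEstimate Ω) :
    cRange Ω = (gZero Ω)ᗮ := by
  refine le_antisymm cRange_le_orthogonal fun w hw => ?_
  obtain ⟨C, V, hV, hest⟩ := hest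
  obtain ⟨C', hC'⟩ := exists_norm_le_of_finiteDimensional isClosed_curlZeroGraph
    (fun w hw hc => eq_zero_of_mem_curlZeroGraph htriv hw hc) curlZeroGraph_subset_closure hest
  obtain ⟨z, hz⟩ := exists_adjoint_preimage
    (fun p hp => starProjection_orthogonal_mem_curlZeroGraph hp) hC' hw
  exact ⟨(z, w), fun q hq => hz q (testPairs_subset_minGraph _ hq), rfl⟩

end GraphTheory

/-! ### Bi-Lipschitz changes of variables and the Poincaré inequality -/

section Poincare

/-- Lebesgue measure is a multiple of three-dimensional Hausdorff measure, which scales under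
Lipschitz maps by the cube of the constant. -/
theorem volume_image_le {g : R3 → R3} {S : Set R3} {K : NNReal} (hg : LipschitzOnWith K g S) :
    volume (g '' S) ≤ (K : ENNReal) ^ 3 * volume S := by
  have hfin : (Module.finrank ℝ R3 : ℝ) = (3 : ℕ) := by simp
  have hhaar : (μH[(3 : ℕ)] : Measure R3).IsAddHaarMeasure := by
    rw [← hfin]; infer_instance
  have hvol : (volume : Measure R3) =
      Measure.addHaarScalarFactor volume (μH[(3 : ℕ)] : Measure R3) • μH[(3 : ℕ)] :=
    Measure.isAddLeftInvariant_eq_smul _ _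
  have key := hg.hausdorffMeasure_image_le (d := ((3 : ℕ) : ℝ)) (by positivity)
  rw [ENNReal.rpow_natCast] at key
  rw [hvol]
  simp only [Measure.smul_apply]
  rw [ENNReal.smul_def, ENNReal.smul_def, smul_eq_mul, smul_eq_mul, mul_left_comm]
  gcongr

/-- Change of variables for maps with a Lipschitz inverse. -/
theorem lintegral_comp_le {A B : Set R3} (hA : MeasurableSet A) {ψ : R3 → R3}
    (hψ : ContinuousOn ψ A) (hm : Set.MapsTo ψ A B) {K : NNReal}
    (hK : ∀ x ∈ A, ∀ y ∈ A, dist x y ≤ K * dist (ψ x) (ψ y)) {h : R3 → ENNReal}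
    (hh : Measurable h) :
    ∫⁻ x in A, h (ψ x) ≤ (K : ENNReal) ^ 3 * ∫⁻ y in B, h y := by
  have hae : AEMeasurable ψ (volume.restrict A) := hψ.aemeasurable hA
  rw [← lintegral_map' hh.aemeasurable hae, ← smul_eq_mul, ← lintegral_smul_measure]
  -- The preimage of `S` is the image of a subset of `S ∩ B` under the `K`-Lipschitz inverse of `ψ`.
  have hle : Measure.map ψ (volume.restrict A) ≤ ((K : ENNReal) ^ 3) • volume.restrict B := by
    rw [Measure.le_iff]
    intro S hS
    rw [Measure.map_apply_of_aemeasurable hae hS, Measure.restrict_apply' hA, Measure.smul_apply,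
      Measure.restrict_apply hS, smul_eq_mul]
    set E := ψ ⁻¹' S ∩ A with hE
    have hinj : Set.InjOn ψ A := by
      intro x hx y hy hxy
      have := hK x hx y hy
      rw [hxy, dist_self, mul_zero] at this
      exact dist_le_zero.1 this
    have hinv : ∀ x ∈ A, Function.invFunOn ψ A (ψ x) = x := fun x hx => hinj.leftInvOn_invFunOn hx
    have hlip : LipschitzOnWith K (Function.invFunOn ψ A) (ψ '' E) := by
      refine LipschitzOnWith.of_dist_le_mul ?_
      rintro _ ⟨x, hx, rfl⟩ _ ⟨y, hy, rfl⟩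
      rw [hinv x hx.2, hinv y hy.2]
      exact hK x hx.2 y hy.2
    have himg : Function.invFunOn ψ A '' (ψ '' E) = E := by
      rw [Set.image_image]
      ext z
      constructor
      · rintro ⟨x, hx, rfl⟩
        change Function.invFunOn ψ A (ψ x) ∈ E
        rwa [hinv x hx.2]
      · exact fun hz => ⟨z, hz, hinv z hz.2⟩
    calc volume E = volume (Function.invFunOn ψ A '' (ψ '' E)) := by rw [himg]
      _ ≤ (K : ENNReal) ^ 3 * volume (ψ '' E) := volume_image_le hlip
      _ ≤ (K : ENNReal) ^ 3 * volume (S ∩ B) := by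
          gcongr
          rintro _ ⟨x, hx, rfl⟩
          exact ⟨hx.1, hm hx.2⟩
  exact lintegral_mono' hle le_rfl

theorem sq_lintegral_le {X : Type*} [MeasurableSpace X] {μ : Measure X} [IsProbabilityMeasure μ]
    {f : X → ENNReal} (hf : AEMeasurable f μ) : (∫⁻ x, f x ∂μ) ^ 2 ≤ ∫⁻ x, f x ^ 2 ∂μ := by
  have h := ENNReal.lintegral_mul_le_Lp_mul_Lq μ Real.HolderConjugate.two_two hf
    (aemeasurable_const (b := (1 : ENNReal)))
  simp only [Pi.mul_apply, mul_one, ENNReal.one_rpow, lintegral_const, measure_univ] at h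
  calc (∫⁻ x, f x ∂μ) ^ 2 ≤ ((∫⁻ x, f x ^ (2 : ℝ) ∂μ) ^ (1 / 2 : ℝ)) ^ 2 := by gcongr
    _ = ∫⁻ x, f x ^ 2 ∂μ := by
      rw [← ENNReal.rpow_natCast, ← ENNReal.rpow_mul]
      norm_num

theorem isProbabilityMeasure_unitInterval :
    IsProbabilityMeasure (volume.restrict (Set.Icc (0 : ℝ) 1)) :=
  ⟨by simp⟩

/-- The fundamental theorem of calculus along Lipschitz paths, as an inequality. -/
theorem enorm_sub_le_lintegral_path {p : R3 → ℂ} (hp : ContDiff ℝ 1 p) {γ : ℝ → R3} {M : NNReal}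
    (hγ : LipschitzWith M γ) :
    ‖p (γ 1) - p (γ 0)‖ₑ ≤ ∫⁻ t in Set.Icc (0 : ℝ) 1, M * ‖fderiv ℝ p (γ t)‖ₑ := by
  set G : ℝ → ℝ := fun t => M * ‖fderiv ℝ p (γ t)‖ with hG
  have hGc : Continuous G :=
    continuous_const.mul ((hp.continuous_fderiv one_ne_zero).comp hγ.continuous).norm
  have key : ‖p (γ 1) - p (γ 0)‖ ≤ ∫ t in (0 : ℝ)..1, G t := by
    -- The path need not be differentiable, so only the upper slope of `t ↦ ‖p (γ t) - p (γ 0)‖` is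
    -- estimated, using differentiability of `p`.
    refine image_le_of_liminf_slope_right_le_deriv_boundary
      (f := fun t => ‖p (γ t) - p (γ 0)‖) (a := 0) (b := 1)
      (B := fun x => ∫ t in (0 : ℝ)..x, G t) (B' := G) ?_ ?_ ?_ ?_ ?_ (by simp)
    · exact (((hp.continuous.comp hγ.continuous).sub continuous_const).norm).continuousOn
    · simp
    · exact (intervalIntegral.continuous_primitive (fun a b => hGc.intervalIntegrable a b)
        0).continuousOn
    · intro x _
      exact (hGc.integral_hasStrictDerivAt 0 x).hasDerivAt.hasDerivWithinAt
    · intro x _ r hr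
      apply Filter.Eventually.frequently
      obtain ⟨ε, hε, hεr⟩ : ∃ ε > 0, M * (‖fderiv ℝ p (γ x)‖ + ε) < r := by
        have hr' : M * ‖fderiv ℝ p (γ x)‖ < r := hr
        refine ⟨(r - M * ‖fderiv ℝ p (γ x)‖) / (M + 1), by
          apply div_pos <;> [linarith; positivity], ?_⟩
        rw [mul_add, ← lt_sub_iff_add_lt', ← mul_div_assoc, div_lt_iff₀ (by positivity)]
        nlinarith
      have hd := (hp.differentiable one_ne_zero (γ x)).hasFDerivAt.isLittleO.def hε
      have hd' := (hγ.continuous.tendsto x).eventually hd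
      filter_upwards [nhdsWithin_le_nhds hd', self_mem_nhdsWithin] with z hz hzx
      have hzx : 0 < z - x := sub_pos.2 hzx
      rw [slope_def_field, div_lt_iff₀ hzx]
      have h1 : ‖p (γ z) - p (γ x)‖ ≤ (‖fderiv ℝ p (γ x)‖ + ε) * ‖γ z - γ x‖ := by
        calc ‖p (γ z) - p (γ x)‖ ≤ ‖p (γ z) - p (γ x) - fderiv ℝ p (γ x) (γ z - γ x)‖ +
              ‖fderiv ℝ p (γ x) (γ z - γ x)‖ := by
                simpa using norm_add_le (p (γ z) - p (γ x) - fderiv ℝ p (γ x) (γ z - γ x))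
                  (fderiv ℝ p (γ x) (γ z - γ x))
          _ ≤ ε * ‖γ z - γ x‖ + ‖fderiv ℝ p (γ x)‖ * ‖γ z - γ x‖ :=
              add_le_add hz (ContinuousLinearMap.le_opNorm _ _)
          _ = _ := by ring
      have h2 : ‖γ z - γ x‖ ≤ M * (z - x) := by
        have := hγ.dist_le_mul z x
        rwa [dist_eq_norm, Real.dist_eq, abs_of_pos hzx] at this
      have h3 : ‖p (γ z) - p (γ 0)‖ - ‖p (γ x) - p (γ 0)‖ ≤ ‖p (γ z) - p (γ x)‖ := by
        simpa using norm_sub_norm_le (p (γ z) - p (γ 0)) (p (γ x) - p (γ 0))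
      calc _ ≤ _ := h3
        _ ≤ _ := h1
        _ ≤ (‖fderiv ℝ p (γ x)‖ + ε) * (M * (z - x)) := by gcongr
        _ = M * (‖fderiv ℝ p (γ x)‖ + ε) * (z - x) := by ring
        _ < r * (z - x) := by gcongr
  have hGi : IntegrableOn G (Set.Icc 0 1) := hGc.continuousOn.integrableOn_Icc
  rw [intervalIntegral.integral_of_le zero_le_one, ← integral_Icc_eq_integral_Ioc] at key
  rw [← ofReal_norm]
  refine (ENNReal.ofReal_le_ofReal key).trans ?_
  rw [ofReal_integral_eq_lintegral_ofReal hGi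
    (Filter.Eventually.of_forall fun t => by positivity)]
  refine le_of_eq (lintegral_congr fun t => ?_)
  rw [hG, ENNReal.ofReal_mul (by positivity), ofReal_norm, ENNReal.ofReal_coe_nnreal]

/-- A bi-Lipschitz parametrisation of `W` by the convex bounded set `Q`. -/
structure IsConvexChart (W Q : Set R3) (χ χ' : R3 → R3) (K L d : NNReal) : Prop where
  isOpen : IsOpen W
  nonempty : W.Nonempty
  volume_ne_top : volume W ≠ ⊤
  convex : Convex ℝ Q
  dist_le : ∀ a ∈ Q, ∀ b ∈ Q, dist a b ≤ d
  mapsTo : Set.MapsTo χ W Q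
  mapsTo' : Set.MapsTo χ' Q W
  left_inv : ∀ x ∈ W, χ' (χ x) = x
  right_inv : ∀ a ∈ Q, χ (χ' a) = a
  lip : LipschitzOnWith K χ W
  lip' : LipschitzOnWith L χ' Q

/-- The curved segment from `x` to `y`. -/
def curvedSegment (χ χ' : R3 → R3) (x y : R3) (t : ℝ) : R3 := χ' ((1 - t) • χ x + t • χ y)

namespace IsConvexChart

variable {W Q : Set R3} {χ χ' : R3 → R3} {K L d : NNReal} (h : IsConvexChart W Q χ χ' K L d)
include h

theorem comb_mem {x y : R3} (hx : x ∈ W) (hy : y ∈ W) {t : ℝ} (ht : t ∈ Set.Icc (0 : ℝ) 1) :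
    (1 - t) • χ x + t • χ y ∈ Q :=
  h.convex (h.mapsTo hx) (h.mapsTo hy) (sub_nonneg.2 ht.2) ht.1 (by ring)

theorem continuousOn_curvedSegment :
    ContinuousOn (fun z : (R3 × R3) × ℝ => curvedSegment χ χ' z.1.1 z.1.2 z.2)
      ((W ×ˢ W) ×ˢ Set.Icc (0 : ℝ) 1) := by
  refine h.lip'.continuousOn.comp ?_ fun z hz => h.comb_mem hz.1.1 hz.1.2 hz.2
  have h1 : ContinuousOn (fun z : (R3 × R3) × ℝ => χ z.1.1) ((W ×ˢ W) ×ˢ Set.Icc (0 : ℝ) 1) :=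
    h.lip.continuousOn.comp (by fun_prop) fun z hz => hz.1.1
  have h2 : ContinuousOn (fun z : (R3 × R3) × ℝ => χ z.1.2) ((W ×ˢ W) ×ˢ Set.Icc (0 : ℝ) 1) :=
    h.lip.continuousOn.comp (by fun_prop) fun z hz => hz.1.2
  exact ((continuousOn_const.sub continuousOn_snd).smul h1).add (continuousOn_snd.smul h2)

/-- For `t ≤ 1/2` the weight `1 - t` of `χ x` is at least `1/2`, so `x` can be recovered from the
intermediate point in a Lipschitz way; this permits a change of variables in `x`. -/
theorem dist_le_curvedSegment {y : R3} (hy : y ∈ W) {t : ℝ} (ht : t ∈ Set.Icc (0 : ℝ) (1 / 2))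
    {x x' : R3} (hx : x ∈ W) (hx' : x' ∈ W) :
    dist x x' ≤ (2 * K * L : NNReal) * dist (curvedSegment χ χ' x y t)
      (curvedSegment χ χ' x' y t) := by
  have ht' : t ∈ Set.Icc (0 : ℝ) 1 := ⟨ht.1, ht.2.trans (by norm_num)⟩
  have hq := h.comb_mem hx hy ht'
  have hq' := h.comb_mem hx' hy ht'
  have h1 : dist x x' ≤ L * dist (χ x) (χ x') := by
    have := h.lip'.dist_le_mul _ (h.mapsTo hx) _ (h.mapsTo hx')
    rwa [h.left_inv x hx, h.left_inv x' hx'] at this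
  have h2 : dist ((1 - t) • χ x + t • χ y) ((1 - t) • χ x' + t • χ y) =
      (1 - t) * dist (χ x) (χ x') := by
    rw [dist_add_right, dist_smul₀, Real.norm_of_nonneg (by linarith [ht'.2])]
  have h3 := h.lip.dist_le_mul _ (h.mapsTo' hq) _ (h.mapsTo' hq')
  rw [h.right_inv _ hq, h.right_inv _ hq', h2] at h3
  have h4 : dist (χ x) (χ x') ≤ 2 * (K * dist (curvedSegment χ χ' x y t)
      (curvedSegment χ χ' x' y t)) := by
    have : (1 / 2 : ℝ) * dist (χ x) (χ x') ≤ (1 - t) * dist (χ x) (χ x') := by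
      gcongr; linarith [ht.2]
    unfold curvedSegment
    linarith
  calc dist x x' ≤ L * dist (χ x) (χ x') := h1
    _ ≤ L * (2 * (K * dist (curvedSegment χ χ' x y t) (curvedSegment χ χ' x' y t))) := by gcongr
    _ = _ := by push_cast; ring

theorem lintegral_curvedSegment_le {y : R3} (hy : y ∈ W) {t : ℝ}
    (ht : t ∈ Set.Icc (0 : ℝ) (1 / 2)) {g : R3 → ENNReal} (hg : Measurable g) :
    ∫⁻ x in W, g (curvedSegment χ χ' x y t) ≤ ((2 * K * L : NNReal) : ENNReal) ^ 3 *
      ∫⁻ x in W, g x := by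
  have ht' : t ∈ Set.Icc (0 : ℝ) 1 := ⟨ht.1, ht.2.trans (by norm_num)⟩
  refine lintegral_comp_le h.isOpen.measurableSet ?_
    (fun x hx => h.mapsTo' (h.comb_mem hx hy ht'))
    (fun x hx x' hx' => h.dist_le_curvedSegment hy ht hx hx') hg
  exact h.continuousOn_curvedSegment.comp (f := fun x => ((x, y), t)) (by fun_prop)
    fun x hx => ⟨⟨hx, hy⟩, ht'⟩

omit h in
theorem curvedSegment_symm (χ χ' : R3 → R3) (x y : R3) (t : ℝ) :
    curvedSegment χ χ' x y t = curvedSegment χ χ' y x (1 - t) := by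
  simp [curvedSegment, add_comm]

theorem enorm_sub_sq_le {p : R3 → ℂ} (hp : ContDiff ℝ 1 p) {x y : R3} (hx : x ∈ W) (hy : y ∈ W) :
    ‖p x - p y‖ₑ ^ 2 ≤ ∫⁻ t in Set.Icc (0 : ℝ) 1,
      ((L * d : NNReal) : ENNReal) ^ 2 * ‖fderiv ℝ p (curvedSegment χ χ' x y t)‖ₑ ^ 2 := by
  have := isProbabilityMeasure_unitInterval
  -- The parameter is clamped to `[0, 1]`, since outside it the segment may leave `Q`.
  let γ : ℝ → R3 := fun t => curvedSegment χ χ' x y (Set.projIcc (0 : ℝ) 1 zero_le_one t)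
  have hγt : ∀ t ∈ Set.Icc (0 : ℝ) 1, γ t = curvedSegment χ χ' x y t := fun t ht => by
    simp only [γ, Set.projIcc_of_mem zero_le_one ht]
  have hγ : LipschitzWith (L * d) γ := by
    refine LipschitzWith.of_dist_le_mul fun s t => ?_
    set s' : ℝ := (Set.projIcc (0 : ℝ) 1 zero_le_one s).1
    set t' : ℝ := (Set.projIcc (0 : ℝ) 1 zero_le_one t).1
    have hst : |s' - t'| ≤ dist s t := by
      have := (LipschitzWith.projIcc (zero_le_one (α := ℝ))).dist_le_mul s t
      simpa [Subtype.dist_eq, Real.dist_eq] using this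
    have h1 := h.lip'.dist_le_mul _ (h.comb_mem hx hy (Set.projIcc (0 : ℝ) 1 zero_le_one s).2) _
      (h.comb_mem hx hy (Set.projIcc (0 : ℝ) 1 zero_le_one t).2)
    have h2 : dist ((1 - s') • χ x + s' • χ y) ((1 - t') • χ x + t' • χ y) =
        |s' - t'| * dist (χ x) (χ y) := by
      rw [dist_eq_norm, dist_eq_norm, ← Real.norm_eq_abs, ← norm_neg (χ x - χ y), ← norm_smul]
      congr 1
      module
    calc dist (γ s) (γ t) ≤ L * (|s' - t'| * dist (χ x) (χ y)) := by rw [← h2]; exact h1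
      _ ≤ L * (dist s t * d) := by
          gcongr
          exact h.dist_le _ (h.mapsTo hx) _ (h.mapsTo hy)
      _ = _ := by push_cast; ring
  have key := enorm_sub_le_lintegral_path hp hγ
  have h0 : γ 0 = x := by
    rw [hγt 0 (by simp)]
    simp [curvedSegment, h.left_inv x hx]
  have h1 : γ 1 = y := by
    rw [hγt 1 (by simp)]
    simp [curvedSegment, h.left_inv y hy]
  rw [h0, h1] at key
  have hm : Measurable fun t => ((L * d : NNReal) : ENNReal) * ‖fderiv ℝ p (γ t)‖ₑ := by
    refine Measurable.const_mul ?_ _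
    exact ((hp.continuous_fderiv one_ne_zero).comp hγ.continuous).enorm.measurable
  calc ‖p x - p y‖ₑ ^ 2 = ‖p y - p x‖ₑ ^ 2 := by rw [← enorm_neg, neg_sub]
    _ ≤ (∫⁻ t in Set.Icc (0 : ℝ) 1, ((L * d : NNReal) : ENNReal) * ‖fderiv ℝ p (γ t)‖ₑ) ^ 2 := by
        gcongr
    _ ≤ ∫⁻ t in Set.Icc (0 : ℝ) 1, (((L * d : NNReal) : ENNReal) * ‖fderiv ℝ p (γ t)‖ₑ) ^ 2 :=
        sq_lintegral_le hm.aemeasurable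
    _ = _ := by
        refine setLIntegral_congr_fun measurableSet_Icc fun t ht => ?_
        simp only [hγt t ht, mul_pow]

/-- The Poincaré inequality on a set that is bi-Lipschitz to a convex set. -/
theorem exists_poincare : ∃ C : NNReal, ∀ p : R3 → ℂ, ContDiff ℝ 1 p → ∃ c : ℂ,
    ∫⁻ x in W, ‖p x - c‖ₑ ^ 2 ≤ C * ∫⁻ x in W, ‖fderiv ℝ p x‖ₑ ^ 2 := by
  have := isProbabilityMeasure_unitInterval
  have hWm := h.isOpen.measurableSet
  have hvol0 : volume W ≠ 0 := (h.isOpen.measure_pos volume h.nonempty).ne'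
  -- The first factor is the squared speed of the curved segments, the second the Jacobian bound of
  -- the change of variables.
  refine ⟨(L * d) ^ 2 * (2 * K * L) ^ 3, fun p hp => ?_⟩
  set μ : Measure R3 := volume.restrict W with hμ
  set ν : Measure ℝ := volume.restrict (Set.Icc (0 : ℝ) 1) with hν
  set I := ∫⁻ x in W, ‖fderiv ℝ p x‖ₑ ^ 2 with hI
  set c₁ : ENNReal := ((L * d : NNReal) : ENNReal) ^ 2 with hc₁
  set c₂ : ENNReal := ((2 * K * L : NNReal) : ENNReal) ^ 3 with hc₂
  have hfin : SFinite μ := by infer_instance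
  have hgm : Measurable fun x => ‖fderiv ℝ p x‖ₑ ^ 2 :=
    (hp.continuous_fderiv one_ne_zero).enorm.measurable.pow_const 2
  let F : (R3 × R3) → ℝ → ENNReal := fun z t => ‖fderiv ℝ p (curvedSegment χ χ' z.1 z.2 t)‖ₑ ^ 2
  have hFm : AEMeasurable (Function.uncurry F) ((μ.prod μ).prod ν) := by
    rw [hμ, hν, Measure.prod_restrict, Measure.prod_restrict]
    exact hgm.comp_aemeasurable
      (h.continuousOn_curvedSegment.aemeasurable ((hWm.prod hWm).prod measurableSet_Icc))
  have hFt : ∀ t ∈ Set.Icc (0 : ℝ) 1, AEMeasurable (fun z => F z t) (μ.prod μ) := by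
    intro t ht
    rw [hμ, Measure.prod_restrict]
    refine hgm.comp_aemeasurable (ContinuousOn.aemeasurable ?_ (hWm.prod hWm))
    exact h.continuousOn_curvedSegment.comp (f := fun z => (z, t)) (by fun_prop)
      fun z hz => ⟨hz, ht⟩
  -- For `t ≤ 1/2` integrate first in `x`, otherwise first in `y`: the variable with the larger
  -- weight is the one to change.
  have hslice : ∀ t ∈ Set.Icc (0 : ℝ) 1, ∫⁻ z, F z t ∂(μ.prod μ) ≤ c₂ * I * volume W := by
    intro t ht
    rcases le_total t (1 / 2) with ht2 | ht2
    · rw [lintegral_prod_symm _ (hFt t ht)]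
      calc ∫⁻ y, ∫⁻ x, F (x, y) t ∂μ ∂μ ≤ ∫⁻ y in W, c₂ * I := by
            refine setLIntegral_mono measurable_const fun y hy => ?_
            exact h.lintegral_curvedSegment_le hy ⟨ht.1, ht2⟩ hgm
        _ = _ := by simp
    · rw [lintegral_prod _ (hFt t ht)]
      calc ∫⁻ x, ∫⁻ y, F (x, y) t ∂μ ∂μ ≤ ∫⁻ x in W, c₂ * I := by
            refine setLIntegral_mono measurable_const fun x hx => ?_
            have := h.lintegral_curvedSegment_le hx (t := 1 - t)
              ⟨by linarith [ht.2], by linarith⟩ hgm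
            simp only [← curvedSegment_symm χ χ' x _ t] at this
            exact this
        _ = _ := by simp
  have hdouble : ∫⁻ y, ∫⁻ x, ‖p x - p y‖ₑ ^ 2 ∂μ ∂μ ≤ c₁ * (c₂ * I * volume W) := by
    have hm2 : Measurable fun z : R3 × R3 => ‖p z.1 - p z.2‖ₑ ^ 2 :=
      ((hp.continuous.comp continuous_fst).sub
        (hp.continuous.comp continuous_snd)).enorm.measurable.pow_const 2
    rw [← lintegral_prod_symm (fun z : R3 × R3 => ‖p z.1 - p z.2‖ₑ ^ 2) hm2.aemeasurable]
    calc ∫⁻ z, ‖p z.1 - p z.2‖ₑ ^ 2 ∂(μ.prod μ)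
        ≤ ∫⁻ z, ∫⁻ t, c₁ * F z t ∂ν ∂(μ.prod μ) := by
          rw [hμ, Measure.prod_restrict]
          refine setLIntegral_mono' (hWm.prod hWm) fun z hz => ?_
          exact h.enorm_sub_sq_le hp hz.1 hz.2
      _ = ∫⁻ t, ∫⁻ z, c₁ * F z t ∂(μ.prod μ) ∂ν :=
          lintegral_lintegral_swap (f := fun z t => c₁ * F z t) (hFm.const_mul c₁)
      _ ≤ ∫⁻ t in Set.Icc (0 : ℝ) 1, c₁ * (c₂ * I * volume W) := by
          refine setLIntegral_mono measurable_const fun t ht => ?_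
          rw [lintegral_const_mul'' _ (hFt t ht)]
          gcongr
          exact hslice t ht
      _ = _ := by simp
  have hym : Measurable fun y => ∫⁻ x, ‖p x - p y‖ₑ ^ 2 ∂μ := by
    refine Measurable.lintegral_prod_left' (f := fun z : R3 × R3 => ‖p z.1 - p z.2‖ₑ ^ 2) ?_
    exact ((hp.continuous.comp continuous_fst).sub
      (hp.continuous.comp continuous_snd)).enorm.measurable.pow_const 2
  -- Some `y` does no worse than the average in the double integral; its value `p y` serves as the
  -- constant.
  obtain ⟨y, -, hy⟩ := exists_le_setLAverage hvol0 h.volume_ne_top hym.aemeasurable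
  refine ⟨p y, hy.trans ?_⟩
  rw [setLAverage_eq]
  refine ENNReal.div_le_of_le_mul ?_
  refine hdouble.trans (le_of_eq ?_)
  rw [hc₁, hc₂]
  push_cast
  ring

end IsConvexChart

end Poincare

/-! ### Gradients of Lipschitz functions that vanish outside `Ω` -/

section Lipschitz

open scoped Convolution

variable {Ω : Set R3}

theorem measurable_pderiv (f : R3 → ℂ) (i : Fin 3) : Measurable (pderiv i f) :=
  measurable_fderiv_apply_const ℝ f _

theorem measurable_grad (f : R3 → ℂ) : Measurable (grad f) := by
  have h : grad f = fun x => WithLp.toLp 2 fun i => pderiv i f x := by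
    ext x i
    simp
  rw [h]
  exact (PiLp.continuous_toLp 2 _).measurable.comp
    (measurable_pi_lambda _ fun i => measurable_pderiv f i)

theorem norm_grad_le_of_lipschitz {f : R3 → ℂ} {C : NNReal} (hf : LipschitzWith C f) (x : R3) :
    ‖grad f x‖ ≤ 2 * C :=
  (norm_grad_le f x).trans (by gcongr; exact norm_fderiv_le_of_lipschitz ℝ hf)

theorem isFiniteMeasure_restrict (hb : Bornology.IsBounded Ω) :
    IsFiniteMeasure (volume.restrict Ω : Measure R3) :=
  ⟨by simpa using hb.measure_lt_top⟩

theorem memLp_grad_of_lipschitz (hb : Bornology.IsBounded Ω) {f : R3 → ℂ} {C : NNReal}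
    (hf : LipschitzWith C f) : MemLp (grad f) 2 (volume.restrict Ω) := by
  have := isFiniteMeasure_restrict hb
  exact MemLp.of_bound (measurable_grad f).aestronglyMeasurable (2 * C)
    (Filter.Eventually.of_forall (norm_grad_le_of_lipschitz hf))

/-- A closed subspace of `L²` is closed under bounded almost everywhere convergence. -/
theorem mem_of_ae_tendsto (hb : Bornology.IsBounded Ω) {V : Submodule ℂ (L2v Ω)}
    (hV : IsClosed (V : Set (L2v Ω))) {u : ℕ → L2v Ω} {w : L2v Ω} (hu : ∀ n, u n ∈ V) {M : ℝ}
    (hM : ∀ n, ∀ᵐ x ∂(volume.restrict Ω), ‖u n x‖ ≤ M)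
    (hlim : ∀ᵐ x ∂(volume.restrict Ω), Filter.Tendsto (fun n => u n x) Filter.atTop (𝓝 (w x))) :
    w ∈ V := by
  have := isFiniteMeasure_restrict hb
  have hVc : IsComplete (V : Set (L2v Ω)) := hV.isComplete
  have : CompleteSpace V := hV.completeSpace_coe
  -- Bounded almost everywhere convergence on a set of finite measure gives weak convergence by
  -- dominated convergence, and `V = Vᗮᗮ` is weakly closed.
  rw [← Submodule.orthogonal_orthogonal V, Submodule.mem_orthogonal]
  intro v hv
  have h0 : ∀ n, inner ℂ v (u n) = 0 := fun n =>
    (Submodule.mem_orthogonal' _ _).1 hv _ (hu n)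
  have hvi : Integrable v (volume.restrict Ω) := (Lp.memLp v).integrable (by norm_num)
  have ht : Filter.Tendsto (fun n => inner ℂ v (u n)) Filter.atTop (𝓝 (inner ℂ v w)) := by
    simp only [L2.inner_def]
    refine tendsto_integral_of_dominated_convergence (fun x => ‖v x‖ * M) (fun n => ?_)
      (hvi.norm.mul_const M) (fun n => ?_) ?_
    · exact (Lp.aestronglyMeasurable v).inner (Lp.aestronglyMeasurable (u n))
    · filter_upwards [hM n] with x hx
      exact (norm_inner_le_norm _ _).trans (by gcongr)
    · filter_upwards [hlim] with x hx
      exact tendsto_const_nhds.inner hx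
  exact tendsto_nhds_unique ht (by simp [h0])

/-- Differentiation under the integral needs only a Lipschitz bound and, by Rademacher's theorem,
differentiability of `f` at almost every point. -/
theorem fderiv_convolution_bump {f : R3 → ℂ} {C : NNReal} (hf : LipschitzWith C f)
    (φ : ContDiffBump (0 : R3)) (x : R3) :
    HasFDerivAt (φ.normed volume ⋆[ContinuousLinearMap.lsmul ℝ ℝ, volume] f)
      ((φ.normed volume ⋆[ContinuousLinearMap.lsmul ℝ ℝ, volume] fderiv ℝ f) x) x := by
  have hφc : Continuous (φ.normed volume) := φ.continuous_normed
  have hφi : Integrable (φ.normed volume) volume := φ.integrable_normed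
  have hmeas : ∀ y, AEStronglyMeasurable (fun t => φ.normed volume t • f (y - t)) volume :=
    fun y => (hφc.smul (hf.continuous.comp (continuous_const.sub continuous_id))).aestronglyMeasurable
  refine (hasFDerivAt_integral_of_dominated_loc_of_lip (μ := volume)
    (F := fun y t => φ.normed volume t • f (y - t))
    (F' := fun t => φ.normed volume t • fderiv ℝ f (x - t))
    (bound := fun t => φ.normed volume t * C) Filter.univ_mem
    (Filter.Eventually.of_forall hmeas) ?_ ?_ ?_ (hφi.mul_const _) ?_).2
  · exact (hφc.smul (hf.continuous.comp
      (continuous_const.sub continuous_id))).integrable_of_hasCompactSupport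
        φ.hasCompactSupport_normed.smul_right
  · refine hφc.aestronglyMeasurable.smul ?_
    exact ((measurable_fderiv ℝ f).comp (measurable_const.sub measurable_id)).aestronglyMeasurable
  · refine Filter.Eventually.of_forall fun t => ?_
    refine LipschitzOnWith.of_dist_le_mul fun y _ z _ => ?_
    rw [dist_smul₀, Real.norm_eq_abs, Real.coe_nnabs, abs_mul, NNReal.abs_eq, mul_assoc]
    refine mul_le_mul_of_nonneg_left ?_ (abs_nonneg _)
    simpa using hf.dist_le_mul (y - t) (z - t)
  · have hae : ∀ᵐ t ∂(volume : Measure R3), DifferentiableAt ℝ f (x - t) :=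
      (Measure.measurePreserving_sub_left volume x).quasiMeasurePreserving.ae hf.ae_differentiableAt
    filter_upwards [hae] with t ht
    have h1 : HasFDerivAt (fun y => f (y - t)) (fderiv ℝ f (x - t)) x := by
      have := ht.hasFDerivAt.comp x ((hasFDerivAt_id x).sub_const t)
      rw [ContinuousLinearMap.comp_id] at this
      exact this
    exact h1.const_smul (φ.normed volume t)

theorem norm_convolution_bump_le {E : Type*} [NormedAddCommGroup E] [NormedSpace ℝ E]
    {g : R3 → E} {M : ℝ} (hg : ∀ x, ‖g x‖ ≤ M)
    (φ : ContDiffBump (0 : R3)) (x : R3) :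
    ‖(φ.normed volume ⋆[ContinuousLinearMap.lsmul ℝ ℝ, volume] g) x‖ ≤ M := by
  have h := norm_integral_le_of_norm_le (μ := (volume : Measure R3))
    (f := fun t => φ.normed volume t • g (x - t)) (g := fun t => φ.normed volume t * M)
    (φ.integrable_normed.mul_const M) (Filter.Eventually.of_forall fun t => by
      rw [norm_smul, Real.norm_of_nonneg (φ.nonneg_normed t)]
      exact mul_le_mul_of_nonneg_left (hg _) (φ.nonneg_normed t))
  rwa [integral_mul_const, φ.integral_normed, one_mul] at h

theorem isTest_convolution_bump {f : R3 → ℂ} (hf : Continuous f) {δ : ℝ}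
    (hc : HasCompactSupport f) (hδ : Metric.cthickening δ (tsupport f) ⊆ Ω)
    (φ : ContDiffBump (0 : R3)) (hφ : φ.rOut ≤ δ) :
    IsTest Ω (φ.normed volume ⋆[ContinuousLinearMap.lsmul ℝ ℝ, volume] f) := by
  have hs : tsupport (φ.normed volume ⋆[ContinuousLinearMap.lsmul ℝ ℝ, volume] f) ⊆
      Metric.cthickening δ (tsupport f) := by
    refine closure_minimal ?_ Metric.isClosed_cthickening
    refine (support_convolution_subset _).trans ?_
    rintro _ ⟨a, ha, b, hb, rfl⟩
    rw [φ.support_normed_eq] at ha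
    refine Metric.mem_cthickening_of_dist_le _ b _ _ (subset_tsupport f hb) ?_
    have : dist a 0 < φ.rOut := ha
    simp only [dist_add_self_left]
    rw [dist_zero_right] at this
    linarith
  refine ⟨?_, ?_, hs.trans hδ⟩
  · exact φ.hasCompactSupport_normed.contDiff_convolution_left _ φ.contDiff_normed
      hf.locallyIntegrable
  · exact φ.hasCompactSupport_normed.convolution _ hc

/-- Mollifications are test functions, their gradients are uniformly bounded, and they converge at
the Lebesgue points of the derivative. -/
theorem grad_mem_gZero_of_compactSupport (hΩ : IsOpen Ω) (hb : Bornology.IsBounded Ω) {f : R3 → ℂ}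
    {C : NNReal} (hf : LipschitzWith C f) (hc : HasCompactSupport f) (hs : tsupport f ⊆ Ω)
    {w : L2v Ω} (hw : w =ᵐ[volume.restrict Ω] grad f) : w ∈ gZero Ω := by
  obtain ⟨δ, hδ, hδΩ⟩ := hc.isCompact.exists_cthickening_subset_open hΩ hs
  -- The outer radii tend to zero and stay below `δ`, while the ratio of the radii is fixed at `2`,
  -- as Lebesgue differentiation requires.
  let φ : ℕ → ContDiffBump (0 : R3) := fun n =>
    ⟨δ / 2 / (n + 1), δ / (n + 1), by positivity, by gcongr; linarith⟩
  set fn : ℕ → R3 → ℂ := fun n =>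
    (φ n).normed volume ⋆[ContinuousLinearMap.lsmul ℝ ℝ, volume] f with hfn
  have htest : ∀ n, IsTest Ω (fn n) := fun n =>
    isTest_convolution_bump hf.continuous hc hδΩ (φ n)
      (div_le_self hδ.le (by linarith [n.cast_nonneg (α := ℝ)]))
  have hmem1 : ∀ n, MemLp (fn n) 2 (volume.restrict Ω) := fun n => (htest n).memLp _
  have hmem2 : ∀ n, MemLp (grad (fn n)) 2 (volume.restrict Ω) := fun n => (htest n).grad.memLp _
  have hfd : ∀ n x, fderiv ℝ (fn n) x =
      ((φ n).normed volume ⋆[ContinuousLinearMap.lsmul ℝ ℝ, volume] fderiv ℝ f) x := fun n x =>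
    (fderiv_convolution_bump hf (φ n) x).fderiv
  have hbd : ∀ n x, ‖grad (fn n) x‖ ≤ 2 * C := fun n x => by
    refine (norm_grad_le _ x).trans ?_
    gcongr
    rw [hfd]
    exact norm_convolution_bump_le (fun y => norm_fderiv_le_of_lipschitz ℝ hf) (φ n) x
  have hloc : LocallyIntegrable (fderiv ℝ f) (volume : Measure R3) := by
    refine (memLp_top_of_bound (measurable_fderiv ℝ f).aestronglyMeasurable C
      (Filter.Eventually.of_forall fun x => norm_fderiv_le_of_lipschitz ℝ hf)).locallyIntegrable ?_
    exact le_top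
  have hae := ContDiffBump.ae_convolution_tendsto_right_of_locallyIntegrable
    (μ := (volume : Measure R3)) (φ := φ) (l := Filter.atTop) (K := 2) (g := fderiv ℝ f)
    (by
      have := tendsto_one_div_add_atTop_nhds_zero_nat (𝕜 := ℝ)
      simpa [φ, div_eq_mul_inv] using this.const_mul δ)
    (Filter.Eventually.of_forall fun n => by
      simp only [φ]
      apply le_of_eq
      ring) hloc
  refine mem_of_ae_tendsto hb (isClosed_gZero hΩ hb) (u := fun n => (hmem2 n).toLp _)
    (M := 2 * C) (fun n => ?_) (fun n => ?_) ?_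
  · exact grad_mem_gZero (q := ((hmem1 n).toLp _, (hmem2 n).toLp _))
      ⟨fn n, htest n, (hmem1 n).coeFn_toLp, (hmem2 n).coeFn_toLp⟩
  · filter_upwards [(hmem2 n).coeFn_toLp] with x hx
    rw [hx]
    exact hbd n x
  · have hall : ∀ᵐ x ∂(volume.restrict Ω), ∀ n, (hmem2 n).toLp _ x = grad (fn n) x :=
      ae_all_iff.2 fun n => (hmem2 n).coeFn_toLp
    filter_upwards [hall, hw, ae_restrict_of_ae hae] with x hx hwx hlim
    rw [hwx]
    simp only [hx]
    have h1 : ∀ i, Filter.Tendsto (fun n => pderiv i (fn n) x) Filter.atTop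
        (𝓝 (pderiv i f x)) := fun i => by
      have h2 : Filter.Tendsto (fun n => fderiv ℝ (fn n) x) Filter.atTop (𝓝 (fderiv ℝ f x)) := by
        simpa only [hfd] using hlim
      exact ((ContinuousLinearMap.apply ℝ ℂ
        (EuclideanSpace.single i 1 : R3)).continuous.tendsto _).comp h2
    have h3 : ∀ g : R3 → ℂ, grad g x = WithLp.toLp 2 fun i => pderiv i g x := fun g => by
      ext i; simp
    simp only [h3]
    exact ((PiLp.continuous_toLp 2 _).tendsto _).comp (tendsto_pi_nhds.2 h1)

end Lipschitz

/-! ### Cut-off near the boundary and extension by zero -/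

section Cutoff

variable {Ω : Set R3}

/-- The cut-off of `q` away from the complement of `Ω`. -/
def innerCutoff (Ω : Set R3) (N : ℝ) (q : R3 → ℂ) (x : R3) : ℂ :=
  (Set.projIcc (0 : ℝ) 1 zero_le_one (N * Metric.infDist x Ωᶜ - 1)).1 • q x

theorem norm_le_mul_infDist (hΩ : IsOpen Ω) (hne : (Ωᶜ).Nonempty) {q : R3 → ℂ} {C : NNReal}
    (hq : LipschitzWith C q) (h0 : ∀ x ∉ Ω, q x = 0) (x : R3) :
    ‖q x‖ ≤ C * Metric.infDist x Ωᶜ := by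
  obtain ⟨y, hy, hxy⟩ := hΩ.isClosed_compl.exists_infDist_eq_dist hne x
  have := hq.dist_le_mul x y
  rwa [h0 y hy, dist_zero_right, ← hxy] at this

/-- The cut-off has slope `N` but varies only within distance `2 / N` of the complement, where `|q|
≤ 2C / N`. Hence the Lipschitz constant is independent of `N`. -/
theorem lipschitzWith_innerCutoff (hΩ : IsOpen Ω) (hne : (Ωᶜ).Nonempty) {q : R3 → ℂ} {C : NNReal}
    (hq : LipschitzWith C q) (h0 : ∀ x ∉ Ω, q x = 0) {N : ℝ} (hN : 0 < N) :
    LipschitzWith (3 * C) (innerCutoff Ω N q) := by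
  set d : R3 → ℝ := fun x => Metric.infDist x Ωᶜ with hd
  set η : R3 → ℝ := fun x => (Set.projIcc (0 : ℝ) 1 zero_le_one (N * d x - 1)).1 with hη
  have hη0 : ∀ x, 0 ≤ η x := fun x => (Set.projIcc (0 : ℝ) 1 zero_le_one (N * d x - 1)).2.1
  have hη1 : ∀ x, η x ≤ 1 := fun x => (Set.projIcc (0 : ℝ) 1 zero_le_one (N * d x - 1)).2.2
  have hηd : ∀ x y, |η x - η y| ≤ N * dist x y := fun x y => by
    have h1 := (LipschitzWith.projIcc (zero_le_one (α := ℝ))).dist_le_mul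
      (N * d x - 1) (N * d y - 1)
    have h2 : |η x - η y| ≤ |(N * d x - 1) - (N * d y - 1)| := by
      simpa [Subtype.dist_eq, Real.dist_eq] using h1
    have h3 : |d x - d y| ≤ dist x y := by
      simpa [Real.dist_eq] using (Metric.lipschitz_infDist_pt Ωᶜ).dist_le_mul x y
    calc |η x - η y| ≤ |N * (d x - d y)| := by convert h2 using 2; ring
      _ = N * |d x - d y| := by rw [abs_mul, abs_of_pos hN]
      _ ≤ _ := by gcongr
  have hone : ∀ x, 2 ≤ N * d x → η x = 1 := fun x hx => by
    have : Set.projIcc (0 : ℝ) 1 zero_le_one (N * d x - 1) = ⟨1, by simp⟩ :=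
      Set.projIcc_of_right_le _ (by linarith)
    simp only [hη, this]
  have hqd : ∀ x, ‖q x‖ ≤ C * d x := norm_le_mul_infDist hΩ hne hq h0
  have hqL : ∀ x y, ‖q x - q y‖ ≤ C * dist x y := fun x y => by
    simpa [dist_eq_norm] using hq.dist_le_mul x y
  -- In the product rule the difference of cut-offs is paired with `q` at the point close to the
  -- complement.
  have key : ∀ x y, N * d y ≤ 2 → ‖η x • q x - η y • q y‖ ≤ 3 * C * dist x y := by
    intro x y hy
    have e : η x • q x - η y • q y = η x • (q x - q y) + (η x - η y) • q y := by
      rw [smul_sub, sub_smul]; abel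
    rw [e]
    have h1 : ‖η x • (q x - q y)‖ ≤ C * dist x y := by
      rw [norm_smul, Real.norm_of_nonneg (hη0 x)]
      exact (mul_le_of_le_one_left (norm_nonneg _) (hη1 x)).trans (hqL x y)
    have h2 : ‖(η x - η y) • q y‖ ≤ 2 * C * dist x y := by
      rw [norm_smul, Real.norm_eq_abs]
      calc |η x - η y| * ‖q y‖ ≤ (N * dist x y) * (C * d y) := by
            gcongr
            · exact hηd x y
            · exact hqd y
        _ = (N * d y) * (C * dist x y) := by ring
        _ ≤ 2 * (C * dist x y) := by gcongr
        _ = _ := by ring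
    calc _ ≤ _ := norm_add_le _ _
      _ ≤ C * dist x y + 2 * C * dist x y := add_le_add h1 h2
      _ = _ := by ring
  refine LipschitzWith.of_dist_le_mul fun x y => ?_
  change dist (η x • q x) (η y • q y) ≤ _
  rw [dist_eq_norm]
  push_cast
  rcases le_total (N * d y) 2 with hy | hy
  · exact key x y hy
  rcases le_total (N * d x) 2 with hx | hx
  · rw [norm_sub_rev, dist_comm]
    exact key y x hx
  · rw [hone x hx, hone y hy, one_smul, one_smul]
    refine (hqL x y).trans ?_
    have : 0 ≤ (C : ℝ) * dist x y := by positivity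
    linarith

/-- The gradient of a Lipschitz function that vanishes outside `Ω` belongs to `g_0`. -/
theorem grad_mem_gZero_of_lipschitz (hΩ : IsOpen Ω) (hb : Bornology.IsBounded Ω) {q : R3 → ℂ}
    {C : NNReal} (hq : LipschitzWith C q) (h0 : ∀ x ∉ Ω, q x = 0) {w : L2v Ω}
    (hw : w =ᵐ[volume.restrict Ω] grad q) : w ∈ gZero Ω := by
  have hne : (Ωᶜ).Nonempty := by
    rw [Set.nonempty_compl]
    rintro rfl
    exact NormedSpace.unbounded_univ ℝ R3 hb
  let f : ℕ → R3 → ℂ := fun n => innerCutoff Ω (n + 1) q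
  have hN : ∀ n : ℕ, (0 : ℝ) < n + 1 := fun n => by positivity
  have hf : ∀ n, LipschitzWith (3 * C) (f n) := fun n =>
    lipschitzWith_innerCutoff hΩ hne hq h0 (hN n)
  have hdc : Continuous fun x : R3 => Metric.infDist x Ωᶜ := Metric.continuous_infDist_pt _
  have hsupp : ∀ n, tsupport (f n) ⊆ {x | 1 ≤ ((n : ℝ) + 1) * Metric.infDist x Ωᶜ} := by
    intro n
    refine closure_minimal (fun x hx => ?_)
      (isClosed_le continuous_const (continuous_const.mul hdc))
    by_contra hlt
    have hlt : ((n : ℝ) + 1) * Metric.infDist x Ωᶜ < 1 := not_le.1 hlt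
    apply hx
    have : Set.projIcc (0 : ℝ) 1 zero_le_one (((n : ℝ) + 1) * Metric.infDist x Ωᶜ - 1) =
        ⟨0, by simp⟩ := Set.projIcc_of_le_left _ (by linarith)
    simp [f, innerCutoff, this]
  have hsΩ : ∀ n, tsupport (f n) ⊆ Ω := fun n x hx => by
    by_contra hxΩ
    have h1 : 1 ≤ ((n : ℝ) + 1) * Metric.infDist x Ωᶜ := hsupp n hx
    rw [Metric.infDist_zero_of_mem (show x ∈ Ωᶜ from hxΩ)] at h1
    norm_num at h1
  have hcomp : ∀ n, HasCompactSupport (f n) := fun n =>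
    Metric.isCompact_of_isClosed_isBounded (isClosed_tsupport _) (hb.subset (hsΩ n))
  have hmem : ∀ n, MemLp (grad (f n)) 2 (volume.restrict Ω) := fun n =>
    memLp_grad_of_lipschitz hb (hf n)
  refine mem_of_ae_tendsto hb (isClosed_gZero hΩ hb) (u := fun n => (hmem n).toLp _)
    (M := 2 * (3 * C : NNReal)) (fun n => ?_) (fun n => ?_) ?_
  · exact grad_mem_gZero_of_compactSupport hΩ hb (hf n) (hcomp n) (hsΩ n) (hmem n).coeFn_toLp
  · filter_upwards [(hmem n).coeFn_toLp] with x hx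
    rw [hx]
    exact norm_grad_le_of_lipschitz (hf n) x
  · have hall : ∀ᵐ x ∂(volume.restrict Ω), ∀ n, (hmem n).toLp _ x = grad (f n) x :=
      ae_all_iff.2 fun n => (hmem n).coeFn_toLp
    filter_upwards [hall, hw, ae_restrict_mem hΩ.measurableSet] with x hx hwx hxΩ
    rw [hwx]
    simp only [hx]
    have hpos : 0 < Metric.infDist x Ωᶜ :=
      (hΩ.isClosed_compl.notMem_iff_infDist_pos hne).1 (by simpa using hxΩ)
    refine tendsto_const_nhds.congr' ?_
    obtain ⟨n₀, hn₀⟩ := exists_nat_gt (2 / Metric.infDist x Ωᶜ)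
    filter_upwards [Filter.eventually_ge_atTop n₀] with n hn
    have hev : ∀ᶠ y in 𝓝 x, 2 < ((n : ℝ) + 1) * Metric.infDist y Ωᶜ := by
      refine (continuous_const.mul hdc).continuousAt.eventually_const_lt ?_
      rw [div_lt_iff₀ hpos] at hn₀
      have : (n₀ : ℝ) ≤ n := by exact_mod_cast hn
      change 2 < ((n : ℝ) + 1) * Metric.infDist x Ωᶜ
      nlinarith
    have heq : f n =ᶠ[𝓝 x] q := by
      filter_upwards [hev] with y hy
      have : Set.projIcc (0 : ℝ) 1 zero_le_one (((n : ℝ) + 1) * Metric.infDist y Ωᶜ - 1) =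
          ⟨1, by simp⟩ := Set.projIcc_of_right_le _ (by linarith)
      simp [f, innerCutoff, this]
    ext i
    rw [grad_apply, grad_apply, pderiv, pderiv, heq.fderiv_eq]

/-- A Lipschitz function that vanishes on the boundary of `Ω`, extended by zero. -/
theorem lipschitzWith_indicator {q : R3 → ℂ} {C : NNReal}
    (hq : LipschitzWith C q) (h0 : ∀ x ∈ frontier Ω, q x = 0) :
    LipschitzWith C (Ω.indicator q) := by
  have key : ∀ x ∈ Ω, ∀ y ∉ Ω, ‖q x‖ ≤ C * dist x y := by
    intro x hx y hy
    -- By connectedness a segment leaving `Ω` meets the boundary, where `q` vanishes.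
    obtain ⟨z, hz, hzf⟩ : ∃ z ∈ segment ℝ x y, z ∈ frontier Ω := by
      by_contra hcon
      push Not at hcon
      have hpre : IsPreconnected (segment ℝ x y) := (convex_segment x y).isPreconnected
      have hcov : segment ℝ x y ⊆ interior Ω ∪ (closure Ω)ᶜ := by
        intro z hz
        by_cases hzc : z ∈ closure Ω
        · left
          by_contra hzi
          exact hcon z hz ⟨hzc, hzi⟩
        · exact Or.inr hzc
      have hxi : x ∈ interior Ω := by
        by_contra hxi
        exact hcon x (left_mem_segment ℝ x y) ⟨subset_closure hx, hxi⟩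
      have hyc : y ∉ closure Ω := fun hyc =>
        hcon y (right_mem_segment ℝ x y) ⟨hyc, fun hyi => hy (interior_subset hyi)⟩
      obtain ⟨z, -, hz1, hz2⟩ := hpre (interior Ω) (closure Ω)ᶜ isOpen_interior
        isClosed_closure.isOpen_compl hcov
        ⟨x, left_mem_segment ℝ x y, hxi⟩ ⟨y, right_mem_segment ℝ x y, hyc⟩
      exact hz2 (subset_closure (interior_subset hz1))
    have h1 := hq.dist_le_mul x z
    rw [h0 z hzf, dist_zero_right] at h1
    refine h1.trans ?_
    gcongr
    have := dist_add_dist_of_mem_segment hz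
    linarith [dist_nonneg (x := z) (y := y)]
  refine LipschitzWith.of_dist_le_mul fun x y => ?_
  by_cases hx : x ∈ Ω <;> by_cases hy : y ∈ Ω
  · simpa [hx, hy] using hq.dist_le_mul x y
  · simpa [hx, hy] using key x hx y hy
  · rw [dist_comm x y, dist_comm]
    simpa [hx, hy] using key y hy x hx
  · simp [hx, hy]
    positivity

end Cutoff

/-! ### Reflection across the boundary -/

section Reflection

variable {Ω : Set R3}

/-- The reflection at the plane `y 2 = 0`. -/
def planeReflection (y : R3) : R3 := !₂[y 0, y 1, -y 2]

theorem planeReflection_planeReflection (y : R3) : planeReflection (planeReflection y) = y := by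
  ext i
  fin_cases i <;> simp [planeReflection]

theorem dist_planeReflection (x y : R3) :
    dist (planeReflection x) (planeReflection y) = dist x y := by
  rw [EuclideanSpace.dist_eq, EuclideanSpace.dist_eq, Fin.sum_univ_three, Fin.sum_univ_three]
  simp [planeReflection, dist_neg_neg]

theorem planeReflection_mem_cube {y : R3} (hy : y ∈ cube) : planeReflection y ∈ cube := by
  intro i
  have h0 := hy 0
  have h1 := hy 1
  have h2 := hy 2
  fin_cases i <;> simpa [planeReflection]

theorem planeReflection_of_eq_zero {y : R3} (hy : y 2 = 0) : planeReflection y = y := by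
  ext i
  fin_cases i <;> simp [planeReflection, hy]

theorem convex_cube : Convex ℝ cube := by
  intro x hx y hy a b ha hb hab i
  have h1 := abs_lt.1 (hx i)
  have h2 := abs_lt.1 (hy i)
  have := convex_Ioo (-1 : ℝ) 1 ⟨h1.1, h1.2⟩ ⟨h2.1, h2.2⟩ ha hb hab
  rw [abs_lt]
  simpa using this

theorem convex_upper_cube : Convex ℝ {y : R3 | y ∈ cube ∧ 0 < y 2} := by
  intro x hx y hy a b ha hb hab
  refine ⟨convex_cube hx.1 hy.1 ha hb hab, ?_⟩
  have := convex_Ioi (0 : ℝ) hx.2 hy.2 ha hb hab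
  simpa using this

theorem dist_le_of_mem_cube {x y : R3} (hx : x ∈ cube) (hy : y ∈ cube) : dist x y ≤ 4 := by
  rw [EuclideanSpace.dist_eq]
  refine Real.sqrt_le_iff.2 ⟨by norm_num, ?_⟩
  have h : ∀ i, dist (x i) (y i) ^ 2 ≤ 4 := fun i => by
    have h1 := abs_lt.1 (hx i)
    have h2 := abs_lt.1 (hy i)
    rw [Real.dist_eq, sq_abs]
    nlinarith
  rw [Fin.sum_univ_three]
  linarith [h 0, h 1, h 2]

/-- A neighbourhood `U` of a boundary point with a bi-Lipschitz reflection `ρ` that maps the part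
of `U` inside `Ω` to the part outside, where the Poincaré inequality holds. -/
structure IsReflectionChart (Ω U : Set R3) (ρ : R3 → R3) (K C : NNReal) : Prop where
  isOpen : IsOpen U
  isBounded : Bornology.IsBounded U
  mapsTo : Set.MapsTo ρ U U
  lip : LipschitzOnWith K ρ U
  dist_le : ∀ x ∈ U, ∀ y ∈ U, dist x y ≤ K * dist (ρ x) (ρ y)
  mapsTo_exterior : Set.MapsTo ρ (U ∩ Ω) (U \ closure Ω)
  eq_self : ∀ x ∈ U ∩ frontier Ω, ρ x = x
  poincare : ∀ p : R3 → ℂ, ContDiff ℝ 1 p → ∃ c : ℂ,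
    ∫⁻ x in U \ closure Ω, ‖p x - c‖ₑ ^ 2 ≤ C * ∫⁻ x in U \ closure Ω, ‖fderiv ℝ p x‖ₑ ^ 2

theorem exists_isReflectionChart (hΩ : IsWeakLipschitz Ω) {x₀ : R3} (hx₀ : x₀ ∈ frontier Ω) :
    ∃ (U : Set R3) (ρ : R3 → R3) (K C : NNReal), x₀ ∈ U ∧ IsReflectionChart Ω U ρ K C := by
  obtain ⟨U, χ, K, L, hU, hx₀U, hbij, hlip, hexp, hint, hbd, hext⟩ := hΩ x₀ hx₀
  set χ' := Function.invFunOn χ U with hχ'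
  have hleft : ∀ x ∈ U, χ' (χ x) = x := fun x hx => hbij.injOn.leftInvOn_invFunOn hx
  have hright : ∀ y ∈ cube, χ (χ' y) = y := fun y hy =>
    hbij.surjOn.rightInvOn_invFunOn hy
  have hmaps' : Set.MapsTo χ' cube U := hbij.surjOn.mapsTo_invFunOn
  have hlip' : LipschitzOnWith L χ' cube := by
    refine LipschitzOnWith.of_dist_le_mul fun a ha b hb => ?_
    have := hexp _ (hmaps' ha) _ (hmaps' hb)
    rwa [hright a ha, hright b hb] at this
  have hpart : ∀ (S : Set R3) (P : R3 → Prop), χ '' (U ∩ S) = {y ∈ cube | P y} →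
      ∀ x ∈ U, (x ∈ S ↔ P (χ x)) := by
    intro S P hS x hx
    constructor
    · intro hxS
      have : χ x ∈ {y ∈ cube | P y} := hS ▸ ⟨x, ⟨hx, hxS⟩, rfl⟩
      exact this.2
    · intro hP
      have : χ x ∈ χ '' (U ∩ S) := hS ▸ ⟨hbij.mapsTo hx, hP⟩
      obtain ⟨z, hz, hzx⟩ := this
      exact hbij.injOn hz.1 hx hzx ▸ hz.2
  have hin := hpart Ω (fun y => y 2 < 0) hint
  have hfr := hpart (frontier Ω) (fun y => y 2 = 0) hbd
  have hex := hpart (closure Ω)ᶜ (fun y => 0 < y 2) (by rw [← Set.sdiff_eq]; exact hext)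
  have hUb : Bornology.IsBounded U := by
    rw [Metric.isBounded_iff]
    refine ⟨L * 4, fun x hx y hy => (hexp x hx y hy).trans ?_⟩
    gcongr
    exact dist_le_of_mem_cube (hbij.mapsTo hx) (hbij.mapsTo hy)
  have hW : IsConvexChart (U \ closure Ω) {y : R3 | y ∈ cube ∧ 0 < y 2} χ χ' K L 4 :=
    { isOpen := hU.sdiff isClosed_closure
      nonempty := by
        have hy : (!₂[0, 0, 1 / 2] : R3) ∈ {y ∈ cube | 0 < y 2} := by
          refine ⟨fun i => ?_, by simp⟩
          fin_cases i <;> simp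
          norm_num
        rw [← hext] at hy
        exact Set.Nonempty.of_image ⟨_, hy⟩
      volume_ne_top := (hUb.subset Set.sdiff_subset).measure_lt_top.ne
      convex := convex_upper_cube
      dist_le := fun a ha b hb => dist_le_of_mem_cube ha.1 hb.1
      mapsTo := fun x hx => ⟨hbij.mapsTo hx.1, (hex x hx.1).1 hx.2⟩
      mapsTo' := fun y hy => ⟨hmaps' hy.1, (hex _ (hmaps' hy.1)).2 (by
        rw [hright y hy.1]; exact hy.2)⟩
      left_inv := fun x hx => hleft x hx.1
      right_inv := fun y hy => hright y hy.1
      lip := hlip.mono Set.sdiff_subset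
      lip' := hlip'.mono fun y hy => hy.1 }
  obtain ⟨C, hC⟩ := hW.exists_poincare
  -- The plane reflection transported to `U` is a bi-Lipschitz involution that exchanges the two
  -- sides and fixes the boundary.
  let ρ : R3 → R3 := fun x => χ' (planeReflection (χ x))
  have hRc : ∀ x ∈ U, planeReflection (χ x) ∈ cube := fun x hx =>
    planeReflection_mem_cube (hbij.mapsTo hx)
  have hρU : Set.MapsTo ρ U U := fun x hx => hmaps' (hRc x hx)
  have hχρ : ∀ x ∈ U, χ (ρ x) = planeReflection (χ x) := fun x hx => hright _ (hRc x hx)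
  have hρρ : ∀ x ∈ U, ρ (ρ x) = x := fun x hx => by
    change χ' (planeReflection (χ (ρ x))) = x
    rw [hχρ x hx, planeReflection_planeReflection, hleft x hx]
  have hρlip : ∀ x ∈ U, ∀ y ∈ U, dist (ρ x) (ρ y) ≤ (L * K : NNReal) * dist x y := by
    intro x hx y hy
    calc dist (ρ x) (ρ y) ≤ L * dist (planeReflection (χ x)) (planeReflection (χ y)) :=
          hlip'.dist_le_mul _ (hRc x hx) _ (hRc y hy)
      _ = L * dist (χ x) (χ y) := by rw [dist_planeReflection]
      _ ≤ L * (K * dist x y) := by gcongr; exact hlip.dist_le_mul _ hx _ hy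
      _ = _ := by push_cast; ring
  refine ⟨U, ρ, L * K, C, hx₀U,
    { isOpen := hU
      isBounded := hUb
      mapsTo := hρU
      lip := LipschitzOnWith.of_dist_le_mul hρlip
      dist_le := fun x hx y hy => ?_
      mapsTo_exterior := fun x hx => ⟨hρU hx.1, (hex _ (hρU hx.1)).2 ?_⟩
      eq_self := fun x hx => ?_
      poincare := hC }⟩
  · have := hρlip _ (hρU hx) _ (hρU hy)
    rwa [hρρ x hx, hρρ y hy] at this
  · rw [hχρ x hx.1]
    have := (hin x hx.1).1 hx.2
    simpa [planeReflection] using this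
  · change χ' (planeReflection (χ x)) = x
    rw [planeReflection_of_eq_zero ((hfr x hx.1).1 hx.2), hleft x hx.1]

/-- The reflected and localised function. -/
def reflected (θ : R3 → ℝ) (ρ : R3 → R3) (p : R3 → ℂ) (c : ℂ) (x : R3) : ℂ :=
  θ x • (p (ρ x) - c)

namespace IsReflectionChart

variable {U : Set R3} {ρ : R3 → R3} {K C : NNReal} (h : IsReflectionChart Ω U ρ K C)
  {θ : R3 → ℝ} (hθU : tsupport θ ⊆ U) {T Lθ : NNReal} (hT : ∀ x, ‖θ x‖ ≤ T)
  (hLθ : LipschitzWith Lθ θ) {p : R3 → ℂ}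
include h hθU

theorem reflected_eq_of_mem_frontier (c : ℂ) {x : R3} (hx : x ∈ frontier Ω) :
    reflected θ ρ p c x = θ x • (p x - c) := by
  by_cases hxU : x ∈ U
  · rw [reflected, h.eq_self x ⟨hxU, hx⟩]
  · have : θ x = 0 := image_eq_zero_of_notMem_tsupport fun hx' => hxU (hθU hx')
    simp [reflected, this]

include hT hLθ in
-- Only qualitative: the constant depends on `p` and `c`. Across the boundary of `U` the vanishing
-- of `θ` replaces control of `ρ`.
theorem exists_lipschitzWith_reflected {P : NNReal} (hp : LipschitzWith P p) (c : ℂ) :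
    ∃ D : NNReal, LipschitzWith D (reflected θ ρ p c) := by
  have hθ0 : ∀ x ∉ U, θ x = 0 := fun x hx =>
    image_eq_zero_of_notMem_tsupport fun hx' => hx (hθU hx')
  obtain ⟨M, hM⟩ : ∃ M : NNReal, ∀ x ∈ U, ‖p (ρ x) - c‖ ≤ M := by
    have hb : Bornology.IsBounded (p '' U) := hp.isBounded_image h.isBounded
    obtain ⟨M, hM0, hM⟩ := hb.exists_pos_norm_le
    refine ⟨⟨M + ‖c‖, by positivity⟩, fun x hx => ?_⟩
    exact (norm_sub_le _ _).trans (add_le_add (hM _ ⟨ρ x, h.mapsTo hx, rfl⟩) le_rfl)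
  have hθL : ∀ x y, ‖θ x - θ y‖ ≤ Lθ * dist x y := fun x y => by
    simpa [dist_eq_norm] using hLθ.dist_le_mul x y
  have key : ∀ x ∈ U, ∀ y ∉ U, ‖reflected θ ρ p c x‖ ≤ (T * P * K + Lθ * M) * dist x y := by
    intro x hx y hy
    have h1 := hθL x y
    rw [hθ0 y hy, sub_zero] at h1
    rw [reflected, norm_smul]
    calc ‖θ x‖ * ‖p (ρ x) - c‖ ≤ (Lθ * dist x y) * M := by gcongr; exact hM x hx
      _ = 0 * dist x y + Lθ * M * dist x y := by ring
      _ ≤ (T * P * K) * dist x y + Lθ * M * dist x y := by gcongr; positivity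
      _ = _ := by ring
  refine ⟨T * P * K + Lθ * M, LipschitzWith.of_dist_le_mul fun x y => ?_⟩
  push_cast
  rw [dist_eq_norm]
  have hz : ∀ x ∉ U, reflected θ ρ p c x = 0 := fun x hx => by simp [reflected, hθ0 x hx]
  by_cases hx : x ∈ U <;> by_cases hy : y ∈ U
  · have e : reflected θ ρ p c x - reflected θ ρ p c y =
        θ x • (p (ρ x) - p (ρ y)) + (θ x - θ y) • (p (ρ y) - c) := by
      simp only [reflected, smul_sub, sub_smul]; abel
    rw [e]
    refine (norm_add_le _ _).trans ?_
    rw [norm_smul, norm_smul]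
    have h1 : ‖p (ρ x) - p (ρ y)‖ ≤ P * (K * dist x y) := by
      rw [← dist_eq_norm]
      exact (hp.dist_le_mul _ _).trans (by gcongr; exact h.lip.dist_le_mul _ hx _ hy)
    calc _ ≤ T * (P * (K * dist x y)) + (Lθ * dist x y) * M := by
          gcongr
          · exact hT x
          · exact hθL x y
          · exact hM y hy
      _ = _ := by ring
  · rw [hz y hy, sub_zero]
    exact key x hx y hy
  · rw [hz x hx, zero_sub, norm_neg, dist_comm]
    exact key y hy x hx
  · rw [hz x hx, hz y hy, sub_zero, norm_zero]
    positivity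

include hT hLθ in
omit hθU in
-- A chain rule inequality without differentiability of `ρ`: a local Lipschitz estimate at `x`
-- bounds `fderiv`, which is zero by convention if the derivative does not exist.
theorem norm_fderiv_reflected_le (hp : ContDiff ℝ 1 p) (c : ℂ) {x : R3} (hx : x ∈ U) :
    ‖fderiv ℝ (reflected θ ρ p c) x‖ ≤ Lθ * ‖p (ρ x) - c‖ + T * K * ‖fderiv ℝ p (ρ x)‖ := by
  refine le_of_forall_pos_le_add fun δ hδ => ?_
  obtain ⟨ε, hε, hεδ⟩ : ∃ ε > 0, (T : ℝ) * K * ε ≤ δ := by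
    refine ⟨δ / (T * K + 1), by positivity, ?_⟩
    rw [← mul_div_assoc, div_le_iff₀ (by positivity)]
    nlinarith [mul_nonneg T.2 K.2]
  refine norm_fderiv_le_of_lip' ℝ (by positivity) ?_
  have hd := (hp.differentiable one_ne_zero (ρ x)).hasFDerivAt.isLittleO.def hε
  have hcont : ContinuousAt ρ x := h.lip.continuousOn.continuousAt (h.isOpen.mem_nhds hx)
  filter_upwards [hcont.eventually hd, h.isOpen.mem_nhds hx] with z hz hzU
  have e : reflected θ ρ p c z - reflected θ ρ p c x =
      θ z • (p (ρ z) - p (ρ x)) + (θ z - θ x) • (p (ρ x) - c) := by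
    simp only [reflected, smul_sub, sub_smul]; abel
  rw [e]
  refine (norm_add_le _ _).trans ?_
  rw [norm_smul, norm_smul]
  have h1 : ‖p (ρ z) - p (ρ x)‖ ≤ (‖fderiv ℝ p (ρ x)‖ + ε) * ‖ρ z - ρ x‖ := by
    calc ‖p (ρ z) - p (ρ x)‖ ≤ ‖p (ρ z) - p (ρ x) - fderiv ℝ p (ρ x) (ρ z - ρ x)‖ +
          ‖fderiv ℝ p (ρ x) (ρ z - ρ x)‖ := by
            simpa using norm_add_le (p (ρ z) - p (ρ x) - fderiv ℝ p (ρ x) (ρ z - ρ x))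
              (fderiv ℝ p (ρ x) (ρ z - ρ x))
      _ ≤ ε * ‖ρ z - ρ x‖ + ‖fderiv ℝ p (ρ x)‖ * ‖ρ z - ρ x‖ :=
          add_le_add hz (ContinuousLinearMap.le_opNorm _ _)
      _ = _ := by ring
  have h2 : ‖ρ z - ρ x‖ ≤ K * ‖z - x‖ := by
    simpa [dist_eq_norm] using h.lip.dist_le_mul _ hzU _ hx
  have h3 : ‖θ z - θ x‖ ≤ Lθ * ‖z - x‖ := by
    simpa [dist_eq_norm] using hLθ.dist_le_mul z x
  calc _ ≤ T * ((‖fderiv ℝ p (ρ x)‖ + ε) * (K * ‖z - x‖)) + (Lθ * ‖z - x‖) * ‖p (ρ x) - c‖ := by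
        gcongr
        · exact hT z
        · exact h1.trans (by gcongr)
    _ = (Lθ * ‖p (ρ x) - c‖ + T * K * ‖fderiv ℝ p (ρ x)‖ + T * K * ε) * ‖z - x‖ := by ring
    _ ≤ _ := by gcongr

include hT hLθ in
/-- The gradient of the reflected function inside `Ω` is controlled by the gradient outside. -/
theorem exists_lintegral_reflected_le (hΩ : IsOpen Ω) (hp : ContDiff ℝ 1 p) : ∃ c : ℂ,
    ∫⁻ x in Ω, ‖fderiv ℝ (reflected θ ρ p c) x‖ₑ ^ 2 ≤
      ((2 * Lθ ^ 2 * K ^ 3 * C + 2 * (T * K) ^ 2 * K ^ 3 : NNReal) : ENNReal) *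
        ∫⁻ x in U \ closure Ω, ‖fderiv ℝ p x‖ₑ ^ 2 := by
  -- Subtracting the Poincaré constant lets the term with the derivative of `θ` be bounded by the
  -- exterior gradient.
  obtain ⟨c, hc⟩ := h.poincare p hp
  refine ⟨c, ?_⟩
  set s := reflected θ ρ p c with hs
  have hUΩ : MeasurableSet (U ∩ Ω) := (h.isOpen.inter hΩ).measurableSet
  have hzero : ∀ x ∉ U, fderiv ℝ s x = 0 := by
    intro x hx
    have hev : s =ᶠ[𝓝 x] fun _ => 0 := by
      have hxt : x ∉ tsupport θ := fun hx' => hx (hθU hx')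
      filter_upwards [(isClosed_tsupport θ).isOpen_compl.mem_nhds hxt] with y hy
      have : θ y = 0 := image_eq_zero_of_notMem_tsupport hy
      simp [hs, reflected, this]
    rw [hev.fderiv_eq]
    simp
  have h1 : ∫⁻ x in Ω, ‖fderiv ℝ s x‖ₑ ^ 2 ≤ ∫⁻ x in U ∩ Ω, ‖fderiv ℝ s x‖ₑ ^ 2 := by
    rw [← lintegral_indicator hΩ.measurableSet, ← lintegral_indicator hUΩ]
    refine lintegral_mono fun x => ?_
    by_cases hxU : x ∈ U
    · by_cases hxΩ : x ∈ Ω <;> simp [hxU, hxΩ]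
    · have h0 : ‖(0 : R3 →L[ℝ] ℂ)‖ₑ ^ 2 = 0 := by rw [← ofReal_norm]; simp
      by_cases hxΩ : x ∈ Ω <;> simp [hxΩ, hzero x hxU, h0]
  have hm1 : Measurable fun x => ‖p x - c‖ₑ ^ 2 :=
    (hp.continuous.sub continuous_const).enorm.measurable.pow_const 2
  have hm2 : Measurable fun x => ‖fderiv ℝ p x‖ₑ ^ 2 :=
    (hp.continuous_fderiv one_ne_zero).enorm.measurable.pow_const 2
  have hcv : ∀ {g : R3 → ENNReal}, Measurable g → ∫⁻ x in U ∩ Ω, g (ρ x) ≤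
      (K : ENNReal) ^ 3 * ∫⁻ x in U \ closure Ω, g x := fun hg =>
    lintegral_comp_le hUΩ (h.lip.continuousOn.mono Set.inter_subset_left) h.mapsTo_exterior
      (fun x hx y hy => h.dist_le x hx.1 y hy.1) hg
  have hρc : ContinuousOn ρ (U ∩ Ω) := h.lip.continuousOn.mono Set.inter_subset_left
  have hm1' : AEMeasurable (fun x => ‖p (ρ x) - c‖ₑ ^ 2) (volume.restrict (U ∩ Ω)) :=
    hm1.comp_aemeasurable (hρc.aemeasurable hUΩ)
  have hpt : ∀ x ∈ U ∩ Ω, ‖fderiv ℝ s x‖ₑ ^ 2 ≤ ((2 * Lθ ^ 2 : NNReal) : ENNReal) *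
      ‖p (ρ x) - c‖ₑ ^ 2 + ((2 * (T * K) ^ 2 : NNReal) : ENNReal) * ‖fderiv ℝ p (ρ x)‖ₑ ^ 2 := by
    intro x hx
    have hle := h.norm_fderiv_reflected_le hT hLθ hp c hx.1
    simp only [← ofReal_norm, ← ENNReal.ofReal_pow (norm_nonneg _),
      ← ENNReal.ofReal_coe_nnreal]
    rw [← ENNReal.ofReal_mul (by positivity), ← ENNReal.ofReal_mul (by positivity),
      ← ENNReal.ofReal_add (by positivity) (by positivity)]
    refine ENNReal.ofReal_le_ofReal ?_
    push_cast
    calc ‖fderiv ℝ s x‖ ^ 2 ≤ (Lθ * ‖p (ρ x) - c‖ + T * K * ‖fderiv ℝ p (ρ x)‖) ^ 2 := by gcongr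
      _ ≤ _ := by
        nlinarith [sq_nonneg ((Lθ : ℝ) * ‖p (ρ x) - c‖ - T * K * ‖fderiv ℝ p (ρ x)‖)]
  set I := ∫⁻ x in U \ closure Ω, ‖fderiv ℝ p x‖ₑ ^ 2 with hI
  calc ∫⁻ x in Ω, ‖fderiv ℝ s x‖ₑ ^ 2 ≤ _ := h1
    _ ≤ ∫⁻ x in U ∩ Ω, (((2 * Lθ ^ 2 : NNReal) : ENNReal) * ‖p (ρ x) - c‖ₑ ^ 2 +
        ((2 * (T * K) ^ 2 : NNReal) : ENNReal) * ‖fderiv ℝ p (ρ x)‖ₑ ^ 2) :=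
      setLIntegral_mono' hUΩ hpt
    _ = ((2 * Lθ ^ 2 : NNReal) : ENNReal) * (∫⁻ x in U ∩ Ω, ‖p (ρ x) - c‖ₑ ^ 2) +
        ((2 * (T * K) ^ 2 : NNReal) : ENNReal) * ∫⁻ x in U ∩ Ω, ‖fderiv ℝ p (ρ x)‖ₑ ^ 2 := by
      rw [lintegral_add_left' (hm1'.const_mul _), lintegral_const_mul' _ _ ENNReal.coe_ne_top,
        lintegral_const_mul' _ _ ENNReal.coe_ne_top]
    _ ≤ ((2 * Lθ ^ 2 : NNReal) : ENNReal) * ((K : ENNReal) ^ 3 * (C * I)) +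
        ((2 * (T * K) ^ 2 : NNReal) : ENNReal) * ((K : ENNReal) ^ 3 * I) := by
      gcongr
      · exact (hcv hm1).trans (by gcongr)
      · exact hcv hm2
    _ = _ := by
      push_cast
      ring

end IsReflectionChart

end Reflection

/-! ### The Poincaré potential of a field -/

section Potential

theorem continuous_fderiv_prodMk {F : R3 × ℝ → ℂ} (hF : ContDiff ℝ 1 F) :
    Continuous fun z : R3 × ℝ => fderiv ℝ (fun x => F (x, z.2)) z.1 := by
  have hc : ContDiff ℝ 1 (Function.uncurry fun (z : R3 × ℝ) (x : R3) => F (x, z.2)) :=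
    hF.comp (contDiff_snd.prodMk (contDiff_snd.comp contDiff_fst))
  exact (hc.fderiv (n := 0) contDiff_fst (by simp)).continuous

theorem hasFDerivAt_intervalIntegral {F : R3 × ℝ → ℂ} (hF : ContDiff ℝ 1 F) (x₀ : R3) :
    HasFDerivAt (fun x => ∫ s in (0 : ℝ)..1, F (x, s))
      (∫ s in (0 : ℝ)..1, fderiv ℝ (fun x => F (x, s)) x₀) x₀ := by
  have hF'c := continuous_fderiv_prodMk hF
  obtain ⟨M, hM⟩ := ((isCompact_closedBall x₀ 1).prod
    (isCompact_Icc (a := (0 : ℝ)) (b := 1))).exists_bound_of_continuousOn hF'c.continuousOn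
  have hcont : ∀ x, Continuous fun s => F (x, s) := fun x =>
    hF.continuous.comp (Continuous.prodMk_right x)
  refine intervalIntegral.hasFDerivAt_integral_of_dominated_of_fderiv_le
    (F' := fun x s => fderiv ℝ (fun x => F (x, s)) x)
    (s := Metric.closedBall x₀ 1) (bound := fun _ => M) (Metric.closedBall_mem_nhds x₀ one_pos)
    (Filter.Eventually.of_forall fun x => (hcont x).aestronglyMeasurable)
    ((hcont x₀).intervalIntegrable 0 1)
    (hF'c.comp (Continuous.prodMk_right x₀)).aestronglyMeasurable ?_
    intervalIntegrable_const ?_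
  · refine Filter.Eventually.of_forall fun s hs x hx => ?_
    rw [Set.uIoc_of_le zero_le_one] at hs
    exact hM (x, s) ⟨hx, hs.1.le, hs.2⟩
  · refine Filter.Eventually.of_forall fun s _ x _ => ?_
    have : ContDiff ℝ 1 fun x => F (x, s) := hF.comp (contDiff_id.prodMk contDiff_const)
    exact (this.differentiable one_ne_zero x).hasFDerivAt

theorem contDiff_intervalIntegral {F : R3 × ℝ → ℂ} (hF : ContDiff ℝ 1 F) :
    ContDiff ℝ 1 fun x => ∫ s in (0 : ℝ)..1, F (x, s) := by
  rw [contDiff_one_iff_fderiv]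
  refine ⟨fun x => (hasFDerivAt_intervalIntegral hF x).differentiableAt, ?_⟩
  rw [funext fun x => (hasFDerivAt_intervalIntegral hF x).fderiv]
  exact intervalIntegral.continuous_parametric_intervalIntegral_of_continuous'
    (f := fun x s => fderiv ℝ (fun x => F (x, s)) x) (continuous_fderiv_prodMk hF) 0 1

theorem pderiv_intervalIntegral {F : R3 × ℝ → ℂ} (hF : ContDiff ℝ 1 F) (i : Fin 3) (x : R3) :
    pderiv i (fun x => ∫ s in (0 : ℝ)..1, F (x, s)) x =
      ∫ s in (0 : ℝ)..1, pderiv i (fun x => F (x, s)) x := by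
  rw [pderiv, (hasFDerivAt_intervalIntegral hF x).fderiv,
    ContinuousLinearMap.intervalIntegral_apply]
  · rfl
  · exact ((continuous_fderiv_prodMk hF).comp (Continuous.prodMk_right x)).intervalIntegrable 0 1

variable {u : R3 → C3}

/-- The integrand of the Poincaré potential, along the segment from the origin parametrised by
`s ↦ s² x`. -/
def potentialKernel (u : R3 → C3) (z : R3 × ℝ) : ℂ :=
  ∑ j, (2 * z.2 * z.1 j) • u (z.2 ^ 2 • z.1) j

/-- The Poincaré potential. -/
def potential (u : R3 → C3) (x : R3) : ℂ := ∫ s in (0 : ℝ)..1, potentialKernel u (x, s)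

theorem contDiff_potentialKernel (hu : ∀ i, ContDiff ℝ ∞ fun x => u x i) :
    ContDiff ℝ 1 (potentialKernel u) := by
  refine ContDiff.sum fun j _ => ?_
  have h1 : ContDiff ℝ 1 fun z : R3 × ℝ => z.1 j :=
    (EuclideanSpace.proj (𝕜 := ℝ) j).contDiff.comp contDiff_fst
  have h2 : ContDiff ℝ 1 fun z : R3 × ℝ => 2 * z.2 * z.1 j := by fun_prop
  have h3 : ContDiff ℝ 1 fun z : R3 × ℝ => u (z.2 ^ 2 • z.1) j :=
    ((hu j).of_le (by simp)).comp ((contDiff_snd.pow 2).smul contDiff_fst)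
  exact h2.smul h3

theorem hasFDerivAt_comp_smul {f : R3 → ℂ} (hf : Differentiable ℝ f) (c : ℝ) (x : R3) :
    HasFDerivAt (fun y => f (c • y)) (c • fderiv ℝ f (c • x)) x := by
  have h1 : HasFDerivAt (fun y : R3 => c • y) (c • ContinuousLinearMap.id ℝ R3) x :=
    (hasFDerivAt_id x).const_smul c
  exact ((hf (c • x)).hasFDerivAt.comp x h1).congr_fderiv (by ext v; simp)

theorem pderiv_potentialKernel (hu : ∀ i, ContDiff ℝ ∞ fun x => u x i) (i : Fin 3) (x : R3)
    (s : ℝ) : pderiv i (fun x => potentialKernel u (x, s)) x =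
      (2 * s) • u (s ^ 2 • x) i +
        ∑ j, (2 * s ^ 3 * x j) • pderiv i (fun y => u y j) (s ^ 2 • x) := by
  have hd : ∀ j, HasFDerivAt (fun x : R3 => (2 * s * x j) • u (s ^ 2 • x) j)
      ((2 * s * x j) • (s ^ 2 • fderiv ℝ (fun y => u y j) (s ^ 2 • x)) +
        ((2 * s) • (EuclideanSpace.proj (𝕜 := ℝ) j : R3 →L[ℝ] ℝ)).smulRight
          (u (s ^ 2 • x) j)) x := fun j => by
    have h1 : HasFDerivAt (fun x : R3 => 2 * s * x j)
        ((2 * s) • (EuclideanSpace.proj (𝕜 := ℝ) j : R3 →L[ℝ] ℝ)) x :=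
      (EuclideanSpace.proj (𝕜 := ℝ) j : R3 →L[ℝ] ℝ).hasFDerivAt.const_mul (2 * s)
    exact h1.smul (hasFDerivAt_comp_smul ((hu j).differentiable (by simp)) (s ^ 2) x)
  have hs := HasFDerivAt.fun_sum (u := Finset.univ) fun j _ => hd j
  rw [pderiv]
  simp only [potentialKernel]
  rw [hs.fderiv, _root_.sum_apply]
  simp only [_root_.add_apply, _root_.smul_apply,
    ContinuousLinearMap.smulRight_apply, Finset.sum_add_distrib, PiLp.proj_apply]
  rw [add_comm]
  congr 1
  · rw [Finset.sum_eq_single i]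
    · simp
    · intro j _ hj
      simp [hj]
    · simp
  · refine Finset.sum_congr rfl fun j _ => ?_
    rw [smul_smul, pderiv]
    congr 1
    ring

/-- The fundamental theorem of calculus for `s ↦ s² f(s² x)`. Its integrand has the same
undifferentiated term as the gradient of the potential, so subtraction leaves only curl components.
-/
theorem eq_integral_of_contDiff {f : R3 → ℂ} (hf : ContDiff ℝ ∞ f) (x : R3) :
    f x = ∫ s in (0 : ℝ)..1, ((2 * s) • f (s ^ 2 • x) +
      ∑ j, (2 * s ^ 3 * x j) • pderiv j f (s ^ 2 • x)) := by
  have hd : ∀ s : ℝ, HasDerivAt (fun s : ℝ => s ^ 2 • f (s ^ 2 • x))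
      ((2 * s) • f (s ^ 2 • x) + ∑ j, (2 * s ^ 3 * x j) • pderiv j f (s ^ 2 • x)) s := by
    intro s
    have h1 : HasDerivAt (fun s : ℝ => s ^ 2) (2 * s) s := by simpa using hasDerivAt_pow 2 s
    have h2 : HasDerivAt (fun s : ℝ => s ^ 2 • x) ((2 * s) • x) s := h1.smul_const x
    have h3 : HasDerivAt (fun s : ℝ => f (s ^ 2 • x)) (fderiv ℝ f (s ^ 2 • x) ((2 * s) • x)) s :=
      ((hf.differentiable (by simp)) (s ^ 2 • x)).hasFDerivAt.comp_hasDerivAt s h2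
    refine (h1.smul h3).congr_deriv ?_
    rw [add_comm, map_smul, fderiv_apply_eq_sum, smul_smul, Finset.smul_sum]
    congr 1
    refine Finset.sum_congr rfl fun j _ => ?_
    rw [smul_smul]
    congr 1
    ring
  rw [intervalIntegral.integral_eq_sub_of_hasDerivAt (fun s _ => hd s)]
  · simp
  · refine Continuous.intervalIntegrable ?_ 0 1
    have hc : Continuous fun s : ℝ => s ^ 2 • x := by fun_prop
    have h1 : Continuous fun s : ℝ => f (s ^ 2 • x) := hf.continuous.comp hc
    have h2 : ∀ j, Continuous fun s : ℝ => pderiv j f (s ^ 2 • x) := fun j =>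
      (contDiff_pderiv hf j).continuous.comp hc
    fun_prop

theorem norm_pderiv_sub_le (u : R3 → C3) (x : R3) (i j : Fin 3) :
    ‖pderiv j (fun y => u y i) x - pderiv i (fun y => u y j) x‖ ≤ ‖curl u x‖ := by
  have h0 : ‖pderiv 1 (fun y => u y 2) x - pderiv 2 (fun y => u y 1) x‖ ≤ ‖curl u x‖ :=
    PiLp.norm_apply_le (curl u x) 0
  have h1 : ‖pderiv 2 (fun y => u y 0) x - pderiv 0 (fun y => u y 2) x‖ ≤ ‖curl u x‖ :=
    PiLp.norm_apply_le (curl u x) 1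
  have h2 : ‖pderiv 0 (fun y => u y 1) x - pderiv 1 (fun y => u y 0) x‖ ≤ ‖curl u x‖ :=
    PiLp.norm_apply_le (curl u x) 2
  fin_cases i <;> fin_cases j <;> simp only [Fin.zero_eta, Fin.mk_one, Fin.reduceFinMk] <;>
    first
    | assumption
    | (rw [norm_sub_rev]; assumption)
    | simp

theorem sub_grad_potential_apply (hu : ∀ i, ContDiff ℝ ∞ fun x => u x i) (x : R3) (i : Fin 3) :
    (u x - grad (potential u) x) i = ∫ s in (0 : ℝ)..1, ∑ j, (2 * s ^ 3 * x j) •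
      (pderiv j (fun y => u y i) (s ^ 2 • x) - pderiv i (fun y => u y j) (s ^ 2 • x)) := by
  have hc : Continuous fun s : ℝ => s ^ 2 • x := by fun_prop
  have h1 : ∀ i, Continuous fun s : ℝ => u (s ^ 2 • x) i := fun i => (hu i).continuous.comp hc
  have h2 : ∀ i j, Continuous fun s : ℝ => pderiv j (fun y => u y i) (s ^ 2 • x) := fun i j =>
    (contDiff_pderiv (hu i) j).continuous.comp hc
  have h3 : ∀ i, Continuous fun s : ℝ => (2 * s) • u (s ^ 2 • x) i := fun i =>
    (by fun_prop : Continuous fun s : ℝ => 2 * s).smul (h1 i)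
  have h4 : ∀ i j k : Fin 3, Continuous fun s : ℝ =>
      (2 * s ^ 3 * x k) • pderiv j (fun y => u y i) (s ^ 2 • x) := fun i j k =>
    (by fun_prop : Continuous fun s : ℝ => 2 * s ^ 3 * x k).smul (h2 i j)
  rw [PiLp.sub_apply, grad_apply]
  change u x i - pderiv i (fun x => ∫ s in (0 : ℝ)..1, potentialKernel u (x, s)) x = _
  rw [pderiv_intervalIntegral (contDiff_potentialKernel hu), eq_integral_of_contDiff (hu i) x,
    ← intervalIntegral.integral_sub]
  · refine intervalIntegral.integral_congr fun s _ => ?_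
    simp only [pderiv_potentialKernel hu, smul_sub, Finset.sum_sub_distrib]
    abel
  · exact ((h3 i).add (continuous_finsetSum _ fun j _ => h4 i j j)).intervalIntegrable 0 1
  · simp only [pderiv_potentialKernel hu]
    exact ((h3 i).add (continuous_finsetSum _ fun j _ => h4 j i j)).intervalIntegrable 0 1

/-- The integrand is a sum of three terms, each at most `2 s³ R` times the norm of the curl. -/
theorem enorm_sub_grad_potential_apply_le (hu : ∀ i, ContDiff ℝ ∞ fun x => u x i) {R : NNReal}
    {x : R3} (hx : ‖x‖ ≤ R) (i : Fin 3) :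
    ‖(u x - grad (potential u) x) i‖ₑ ≤
      ∫⁻ s in Set.Icc (0 : ℝ) 1, ENNReal.ofReal (6 * R * s ^ 3) * ‖curl u (s ^ 2 • x)‖ₑ := by
  rw [sub_grad_potential_apply hu, intervalIntegral.integral_of_le zero_le_one,
    ← integral_Icc_eq_integral_Ioc]
  refine (enorm_integral_le_lintegral_enorm _).trans ?_
  refine setLIntegral_mono' measurableSet_Icc fun s hs => ?_
  have hs0 : 0 ≤ s := hs.1
  rw [← ofReal_norm, ← ofReal_norm, ← ENNReal.ofReal_mul (by positivity)]
  refine ENNReal.ofReal_le_ofReal ((norm_sum_le _ _).trans ?_)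
  have hj : ∀ j ∈ Finset.univ, ‖(2 * s ^ 3 * x j) •
      (pderiv j (fun y => u y i) (s ^ 2 • x) - pderiv i (fun y => u y j) (s ^ 2 • x))‖ ≤
      2 * s ^ 3 * R * ‖curl u (s ^ 2 • x)‖ := fun j _ => by
    rw [norm_smul, norm_mul, Real.norm_of_nonneg (by positivity : 0 ≤ 2 * s ^ 3)]
    gcongr
    · exact (PiLp.norm_apply_le x j).trans hx
    · exact norm_pderiv_sub_le u _ i j
  refine (Finset.sum_le_sum hj).trans ?_
  rw [Finset.sum_const, Finset.card_univ, Fintype.card_fin, nsmul_eq_mul]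
  apply le_of_eq
  push_cast
  ring

/-- The dilation by `s²` has Jacobian `s⁶`, precisely the square of the weight `s³` in the potential
estimate. The parametrisation by `s²` is chosen for this: with `t x` the same argument would leave
the non-integrable weight `1 / t`. -/
theorem lintegral_comp_sq_smul_le {s : ℝ} (hs : 0 < s) {h : R3 → ENNReal} (hh : Measurable h)
    {A : Set R3} (hA : MeasurableSet A) :
    ENNReal.ofReal (s ^ 6) * ∫⁻ x in A, h (s ^ 2 • x) ≤ ∫⁻ x, h x := by
  have hK : ∀ x ∈ A, ∀ y ∈ A, dist x y ≤ (Real.toNNReal (s ^ 2)⁻¹ : NNReal) *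
      dist (s ^ 2 • x) (s ^ 2 • y) := fun x _ y _ => by
    rw [dist_smul₀, Real.coe_toNNReal _ (by positivity), Real.norm_of_nonneg (by positivity),
      inv_mul_cancel_left₀ (by positivity)]
  have key := lintegral_comp_le hA (ψ := fun x => s ^ 2 • x) (B := Set.univ)
    (by fun_prop) (fun x _ => Set.mem_univ _) hK hh
  rw [Measure.restrict_univ] at key
  calc _ ≤ ENNReal.ofReal (s ^ 6) * ((Real.toNNReal (s ^ 2)⁻¹ : ENNReal) ^ 3 * ∫⁻ x, h x) := by
        gcongr
    _ = ENNReal.ofReal (s ^ 6 * (s ^ 2)⁻¹ ^ 3) * ∫⁻ x, h x := by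
        rw [ENNReal.ofReal_mul (by positivity), ENNReal.ofReal_pow (p := (s ^ 2)⁻¹) (by positivity),
          mul_assoc]
        rfl
    _ = ∫⁻ x, h x := by
        have : s ^ 6 * (s ^ 2)⁻¹ ^ 3 = 1 := by field_simp
        rw [this, ENNReal.ofReal_one, one_mul]

theorem enorm_sq_eq_sum (v : C3) : ‖v‖ₑ ^ 2 = ∑ i, ‖v i‖ₑ ^ 2 := by
  simp only [← ofReal_norm, ← ENNReal.ofReal_pow (norm_nonneg _)]
  rw [EuclideanSpace.norm_sq_eq, ENNReal.ofReal_sum_of_nonneg fun i _ => by positivity]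

theorem continuous_curl (hu : ∀ i, ContDiff ℝ ∞ fun x => u x i) :
    Continuous (curl u) := by
  refine (PiLp.continuous_toLp 2 _).comp (continuous_pi fun i => ?_)
  have h : ∀ i j, Continuous (pderiv j fun y => u y i) := fun i j =>
    (contDiff_pderiv (hu i) j).continuous
  fin_cases i
  · exact (h 2 1).sub (h 1 2)
  · exact (h 0 2).sub (h 2 0)
  · exact (h 1 0).sub (h 0 1)

theorem contDiff_potential (hu : ∀ i, ContDiff ℝ ∞ fun x => u x i) : ContDiff ℝ 1 (potential u) :=
  contDiff_intervalIntegral (contDiff_potentialKernel hu)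

/-- Jensen's inequality in `s`, Tonelli, and the dilation bound for each `s`; the factor `3` counts
the components of the field. -/
theorem lintegral_sub_grad_potential_le (hu : ∀ i, ContDiff ℝ ∞ fun x => u x i) (R : NNReal) :
    ∫⁻ x in Metric.closedBall 0 R, ‖u x - grad (potential u) x‖ₑ ^ 2 ≤
      ((3 * (6 * R) ^ 2 : NNReal) : ENNReal) * ∫⁻ x, ‖curl u x‖ₑ ^ 2 := by
  have := isProbabilityMeasure_unitInterval
  have hcc := continuous_curl hu
  have hB : MeasurableSet (Metric.closedBall (0 : R3) R) := measurableSet_closedBall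
  set k : R3 → ℝ → ENNReal := fun x s =>
    ENNReal.ofReal (6 * R * s ^ 3) * ‖curl u (s ^ 2 • x)‖ₑ with hk
  have hkm : Measurable (Function.uncurry k) := by
    have h1 : Measurable fun z : R3 × ℝ => ENNReal.ofReal (6 * R * z.2 ^ 3) :=
      ENNReal.measurable_ofReal.comp (by fun_prop)
    have h2 : Measurable fun z : R3 × ℝ => ‖curl u (z.2 ^ 2 • z.1)‖ₑ :=
      (hcc.comp (by fun_prop : Continuous fun z : R3 × ℝ => z.2 ^ 2 • z.1)).enorm.measurable
    exact h1.mul h2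
  have hpt : ∀ x ∈ Metric.closedBall (0 : R3) R, ‖u x - grad (potential u) x‖ₑ ^ 2 ≤
      3 * ∫⁻ s in Set.Icc (0 : ℝ) 1, k x s ^ 2 := by
    intro x hx
    rw [enorm_sq_eq_sum]
    have hi : ∀ i ∈ Finset.univ, ‖(u x - grad (potential u) x) i‖ₑ ^ 2 ≤
        ∫⁻ s in Set.Icc (0 : ℝ) 1, k x s ^ 2 := fun i _ => by
      refine le_trans ?_ (sq_lintegral_le (hkm.of_uncurry_left (x := x)).aemeasurable)
      gcongr
      exact enorm_sub_grad_potential_apply_le hu (by simpa using hx) i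
    refine (Finset.sum_le_sum hi).trans ?_
    simp
  have hs : ∀ s ∈ Set.Icc (0 : ℝ) 1, ∫⁻ x in Metric.closedBall 0 R, k x s ^ 2 ≤
      (((6 * R) ^ 2 : NNReal) : ENNReal) * ∫⁻ x, ‖curl u x‖ₑ ^ 2 := by
    intro s hs
    have e : ∀ x, k x s ^ 2 = (((6 * R) ^ 2 : NNReal) : ENNReal) *
        (ENNReal.ofReal (s ^ 6) * ‖curl u (s ^ 2 • x)‖ₑ ^ 2) := fun x => by
      simp only [hk]
      rw [mul_pow, ← mul_assoc, ← ENNReal.ofReal_pow (by have := hs.1; positivity),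
        ← ENNReal.ofReal_coe_nnreal, ← ENNReal.ofReal_mul (by positivity)]
      congr 2
      push_cast
      ring
    simp only [e]
    rw [lintegral_const_mul' _ _ ENNReal.coe_ne_top, lintegral_const_mul' _ _ ENNReal.ofReal_ne_top]
    gcongr
    rcases hs.1.eq_or_lt with rfl | hpos
    · simp
    · exact lintegral_comp_sq_smul_le hpos (hcc.enorm.measurable.pow_const 2) hB
  calc _ ≤ ∫⁻ x in Metric.closedBall 0 R, 3 * ∫⁻ s in Set.Icc (0 : ℝ) 1, k x s ^ 2 :=
        setLIntegral_mono' hB hpt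
    _ = 3 * ∫⁻ s in Set.Icc (0 : ℝ) 1, ∫⁻ x in Metric.closedBall 0 R, k x s ^ 2 := by
        rw [lintegral_const_mul' _ _ (by norm_num), lintegral_lintegral_swap]
        exact (hkm.pow_const 2).aemeasurable
    _ ≤ 3 * ∫⁻ s in Set.Icc (0 : ℝ) 1, (((6 * R) ^ 2 : NNReal) : ENNReal) *
          ∫⁻ x, ‖curl u x‖ₑ ^ 2 := by
        gcongr 3 * ?_
        exact setLIntegral_mono' measurableSet_Icc hs
    _ = _ := by
        rw [lintegral_const, measure_univ, mul_one]
        push_cast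
        ring

end Potential

/-! ### The curl estimate -/

section CurlEstimate

variable {Ω : Set R3}

/-- Finitely many reflection charts that cover the boundary, with a subordinate partition of
unity. -/
structure BoundaryCover (Ω : Set R3) (ι : Type*) [Fintype ι] where
  U : ι → Set R3
  ρ : ι → R3 → R3
  K : ι → NNReal
  C : ι → NNReal
  θ : ι → R3 → ℝ
  L : ι → NNReal
  chart : ∀ k, IsReflectionChart Ω (U k) (ρ k) (K k) (C k)
  contDiff : ∀ k, ContDiff ℝ ∞ (θ k)
  tsupport_subset : ∀ k, tsupport (θ k) ⊆ U k
  norm_le_one : ∀ k x, ‖θ k x‖ ≤ (1 : NNReal)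
  lip : ∀ k, LipschitzWith (L k) (θ k)
  sum_eq_one : ∀ x ∈ frontier Ω, ∑ k, θ k x = 1

/-- The boundary is compact, so finitely many charts suffice; bounded charts make the cut-offs
compactly supported and hence Lipschitz. -/
theorem exists_boundaryCover (hb : Bornology.IsBounded Ω) (hΩ : IsWeakLipschitz Ω) :
    ∃ t : Finset (frontier Ω), Nonempty (BoundaryCover Ω t) := by
  choose U ρ K C hmem hchart using fun x : frontier Ω => exists_isReflectionChart hΩ x.2
  have hcomp : IsCompact (frontier Ω) :=
    Metric.isCompact_of_isClosed_isBounded isClosed_frontier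
      (hb.closure.subset frontier_subset_closure)
  obtain ⟨t, ht⟩ := hcomp.elim_finite_subcover U (fun k => (hchart k).isOpen)
    fun x hx => Set.mem_iUnion.2 ⟨⟨x, hx⟩, hmem ⟨x, hx⟩⟩
  obtain ⟨f, hf⟩ := SmoothPartitionOfUnity.exists_isSubordinate (ι := t)
    (modelWithCornersSelf ℝ R3) (isClosed_frontier (s := Ω)) (fun k => U k)
    (fun k => (hchart k).isOpen) (by simpa [Set.iUnion_subtype] using ht)
  have hcd : ∀ k, ContDiff ℝ ∞ (f k) := fun k => (f k).contMDiff.contDiff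
  have hc : ∀ k, HasCompactSupport (f k) := fun k =>
    Metric.isCompact_of_isClosed_isBounded (isClosed_tsupport _)
      ((hchart k).isBounded.subset (hf k))
  choose L hL using fun k => ContDiff.lipschitzWith_of_hasCompactSupport (hc k) (hcd k) (by simp)
  refine ⟨t, ⟨{
    U := fun k => U k
    ρ := fun k => ρ k
    K := fun k => K k
    C := fun k => C k
    θ := fun k => f k
    L := L
    chart := fun k => hchart k
    contDiff := hcd
    tsupport_subset := hf
    norm_le_one := fun k x => ?_
    lip := hL
    sum_eq_one := fun x hx => ?_ }⟩⟩
  · rw [Real.norm_of_nonneg (f.nonneg k x)]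
    exact f.le_one k x
  · rw [← finsum_eq_sum_of_fintype]
    exact f.sum_eq_one hx

theorem enorm_sq_eq_lintegral {X E : Type*} [MeasurableSpace X] {μ : Measure X}
    [NormedAddCommGroup E] (a : Lp E 2 μ) : ‖a‖ₑ ^ 2 = ∫⁻ x, ‖a x‖ₑ ^ 2 ∂μ := by
  have h := eLpNorm_nnreal_pow_eq_lintegral (μ := μ) (f := a) (p := 2) two_ne_zero
  rw [Lp.enorm_def]
  simpa using h

theorem norm_le_of_lintegral_le {X E F : Type*} [MeasurableSpace X] {μ : Measure X}
    [NormedAddCommGroup E] [NormedAddCommGroup F] {a : Lp E 2 μ} {b : Lp F 2 μ} {f : X → E}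
    {g : X → F} (ha : a =ᵐ[μ] f) (hb : b =ᵐ[μ] g) {D : NNReal}
    (h : ∫⁻ x, ‖f x‖ₑ ^ 2 ∂μ ≤ D * ∫⁻ x, ‖g x‖ₑ ^ 2 ∂μ) : ‖a‖ ≤ √D * ‖b‖ := by
  have h1 : ‖a‖ₑ ^ 2 ≤ D * ‖b‖ₑ ^ 2 := by
    rw [enorm_sq_eq_lintegral, enorm_sq_eq_lintegral,
      lintegral_congr_ae (g := fun x => ‖f x‖ₑ ^ 2) (ha.mono fun x hx => by simp only [hx]),
      lintegral_congr_ae (f := fun x => ‖b x‖ₑ ^ 2) (g := fun x => ‖g x‖ₑ ^ 2)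
        (hb.mono fun x hx => by simp only [hx])]
    exact h
  have h2 : ‖a‖ ^ 2 ≤ D * ‖b‖ ^ 2 := by
    rw [← ofReal_norm, ← ofReal_norm, ← ENNReal.ofReal_pow (norm_nonneg _),
      ← ENNReal.ofReal_pow (norm_nonneg _), ← ENNReal.ofReal_coe_nnreal,
      ← ENNReal.ofReal_mul (by positivity)] at h1
    exact (ENNReal.ofReal_le_ofReal_iff (by positivity)).1 h1
  refine le_of_sq_le_sq ?_ (by positivity)
  rw [mul_pow, Real.sq_sqrt (by positivity)]
  exact h2

theorem IsTest.contDiff_apply {u : R3 → C3} (hu : IsTest Ω u) (i : Fin 3) :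
    ContDiff ℝ ∞ fun x => u x i :=
  (hu.apply i).1

/-- A compactly supported function that agrees with the Poincaré potential on a given ball. -/
theorem exists_compactSupport_potential {u : R3 → C3} (hu : ∀ i, ContDiff ℝ ∞ fun x => u x i)
    (R : NNReal) : ∃ p : R3 → ℂ, ContDiff ℝ 1 p ∧ HasCompactSupport p ∧
      ∀ x ∈ Metric.closedBall (0 : R3) R, grad p x = grad (potential u) x := by
  let ζ : ContDiffBump (0 : R3) := ⟨R + 1, R + 2, by positivity, by linarith⟩
  refine ⟨fun x => ζ x • potential u x, ζ.contDiff.smul (contDiff_potential hu),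
    ζ.hasCompactSupport.smul_right, fun x hx => ?_⟩
  have hev : (fun x => ζ x • potential u x) =ᶠ[𝓝 x] potential u := by
    have hxb : x ∈ Metric.ball (0 : R3) (R + 1) := by
      have : dist x 0 ≤ R := hx
      exact Metric.mem_ball.2 (by linarith)
    filter_upwards [Metric.isOpen_ball.mem_nhds hxb] with y hy
    rw [ζ.one_of_mem_closedBall (Metric.ball_subset_closedBall hy), one_smul]
  ext i
  rw [grad_apply, grad_apply, pderiv, pderiv, hev.fderiv_eq]

namespace BoundaryCover

variable {ι : Type*} [Fintype ι] (B : BoundaryCover Ω ι)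

/-- The partition of unity, complex valued. -/
def θc (k : ι) (x : R3) : ℂ := B.θ k x

theorem contDiff_θc (k : ι) : ContDiff ℝ ∞ (B.θc k) :=
  Complex.ofRealCLM.contDiff.comp (B.contDiff k)

theorem lipschitzWith_θc (k : ι) : LipschitzWith (B.L k) (B.θc k) :=
  LipschitzWith.of_dist_le_mul fun x y => by
    rw [θc, θc, Complex.dist_eq, ← Complex.ofReal_sub, Complex.norm_real, ← dist_eq_norm]
    exact (B.lip k).dist_le_mul x y

/-- The function `p` minus its reflected extension. -/
def corrected (p : R3 → ℂ) (c : ι → ℂ) (x : R3) : ℂ :=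
  p x - ∑ k, (reflected (B.θ k) (B.ρ k) p (c k) x + c k * B.θc k x)

/-- On the boundary reflection is the identity, so each summand reduces to `θₖ p`, and the `θₖ` sum
to one. -/
theorem corrected_eq_zero (p : R3 → ℂ) (c : ι → ℂ) {x : R3} (hx : x ∈ frontier Ω) :
    B.corrected p c x = 0 := by
  have h : ∀ k, reflected (B.θ k) (B.ρ k) p (c k) x + c k * B.θc k x = B.θc k x * p x := by
    intro k
    rw [(B.chart k).reflected_eq_of_mem_frontier (B.tsupport_subset k) (c k) hx, θc,
      Complex.real_smul]
    ring
  rw [corrected, Finset.sum_congr rfl fun k _ => h k, ← Finset.sum_mul]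
  have : ∑ k, B.θc k x = 1 := by
    simp only [θc]
    rw [← Complex.ofReal_sum, B.sum_eq_one x hx, Complex.ofReal_one]
  rw [this, one_mul, sub_self]

theorem exists_lipschitzWith_reflected {p : R3 → ℂ} {P : NNReal} (hp : LipschitzWith P p)
    (c : ι → ℂ) (k : ι) :
    ∃ D : NNReal, LipschitzWith D (reflected (B.θ k) (B.ρ k) p (c k)) :=
  (B.chart k).exists_lipschitzWith_reflected (B.tsupport_subset k) (B.norm_le_one k) (B.lip k) hp _

theorem exists_lipschitzWith_corrected {p : R3 → ℂ} {P : NNReal} (hp : LipschitzWith P p)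
    (c : ι → ℂ) : ∃ D : NNReal, LipschitzWith D (B.corrected p c) := by
  choose D hD using B.exists_lipschitzWith_reflected hp c
  have h1 : ∀ k, LipschitzWith (‖c k‖₊ * B.L k) fun x => c k * B.θc k x := fun k =>
    (lipschitzWith_smul (c k)).comp (B.lipschitzWith_θc k)
  have h2 : ∀ s : Finset ι, ∃ E : NNReal, LipschitzWith E fun x =>
      ∑ k ∈ s, (reflected (B.θ k) (B.ρ k) p (c k) x + c k * B.θc k x) := by
    classical
    intro s
    induction s using Finset.induction_on with
    | empty => exact ⟨0, by simp⟩
    | insert k s hk ih =>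
      obtain ⟨E, hE⟩ := ih
      refine ⟨D k + ‖c k‖₊ * B.L k + E, ?_⟩
      simp only [Finset.sum_insert hk]
      exact ((hD k).add (h1 k)).add hE
  obtain ⟨E, hE⟩ := h2 Finset.univ
  exact ⟨P + E, hp.sub hE⟩

theorem grad_corrected {p : R3 → ℂ} (c : ι → ℂ) {x : R3} (hp : DifferentiableAt ℝ p x)
    (hr : ∀ k, DifferentiableAt ℝ (reflected (B.θ k) (B.ρ k) p (c k)) x) :
    grad (B.corrected p c) x = grad p x -
      ∑ k, (grad (reflected (B.θ k) (B.ρ k) p (c k)) x + c k • grad (B.θc k) x) := by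
  have hθ : ∀ k, DifferentiableAt ℝ (B.θc k) x := fun k =>
    (B.contDiff_θc k).differentiable (by simp) x
  have hf : HasFDerivAt (B.corrected p c) (fderiv ℝ p x - ∑ k,
      (fderiv ℝ (reflected (B.θ k) (B.ρ k) p (c k)) x + c k • fderiv ℝ (B.θc k) x)) x :=
    hp.hasFDerivAt.sub (HasFDerivAt.fun_sum fun k _ =>
      (hr k).hasFDerivAt.add ((hθ k).hasFDerivAt.const_mul (c k)))
  ext i
  rw [grad_apply, pderiv, hf.fderiv, PiLp.sub_apply, WithLp.ofLp_sum, Finset.sum_apply]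
  simp [pderiv]

/-- The reflection estimate in terms of Euclidean gradients; the factor `4` is the square of the
constant in `norm_grad_le`. -/
theorem exists_lintegral_grad_reflected_le (hΩ : IsOpen Ω) {p : R3 → ℂ} (hp : ContDiff ℝ 1 p)
    (k : ι) : ∃ c : ℂ,
    ∫⁻ x in Ω, ‖grad (reflected (B.θ k) (B.ρ k) p c) x‖ₑ ^ 2 ≤
      ((4 * (2 * B.L k ^ 2 * B.K k ^ 3 * B.C k + 2 * (1 * B.K k) ^ 2 * B.K k ^ 3) : NNReal) :
        ENNReal) * ∫⁻ x in B.U k \ closure Ω, ‖grad p x‖ₑ ^ 2 := by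
  obtain ⟨c, hc⟩ := (B.chart k).exists_lintegral_reflected_le (B.tsupport_subset k)
    (B.norm_le_one k) (B.lip k) hΩ hp
  refine ⟨c, ?_⟩
  have h1 : ∀ x, ‖grad (reflected (B.θ k) (B.ρ k) p c) x‖ₑ ^ 2 ≤
      4 * ‖fderiv ℝ (reflected (B.θ k) (B.ρ k) p c) x‖ₑ ^ 2 := fun x => by
    have h := norm_grad_le (reflected (B.θ k) (B.ρ k) p c) x
    have e : (4 : ENNReal) = ENNReal.ofReal 4 := by simp
    rw [← ofReal_norm, ← ofReal_norm, ← ENNReal.ofReal_pow (norm_nonneg _),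
      ← ENNReal.ofReal_pow (norm_nonneg _), e, ← ENNReal.ofReal_mul (by norm_num)]
    refine ENNReal.ofReal_le_ofReal ?_
    calc _ ≤ (2 * ‖fderiv ℝ (reflected (B.θ k) (B.ρ k) p c) x‖) ^ 2 := by gcongr
      _ = _ := by ring
  calc _ ≤ ∫⁻ x in Ω, 4 * ‖fderiv ℝ (reflected (B.θ k) (B.ρ k) p c) x‖ₑ ^ 2 :=
        lintegral_mono h1
    _ = 4 * ∫⁻ x in Ω, ‖fderiv ℝ (reflected (B.θ k) (B.ρ k) p c) x‖ₑ ^ 2 :=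
        lintegral_const_mul' _ _ (by norm_num)
    _ ≤ 4 * (_ * ∫⁻ x in B.U k \ closure Ω, ‖fderiv ℝ p x‖ₑ ^ 2) := by gcongr 4 * ?_
    _ ≤ 4 * (_ * ∫⁻ x in B.U k \ closure Ω, ‖grad p x‖ₑ ^ 2) := by
        gcongr 4 * (_ * ?_)
        refine lintegral_mono fun x => ?_
        gcongr
        exact enorm_le_iff_norm_le.2 (norm_fderiv_le p x)
    _ = _ := by
        rw [← mul_assoc]
        push_cast
        rfl

include B in
-- On `Ω` the field splits as `(φ - ∇p) + ∇(corrected p) + ∑ ∇rₖ + ∑ cₖ ∇θₖ`. The second term lies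
-- in `g₀` and the last in the span of the `∇θₖ`; the others are controlled by the curl. No bound on
-- the constants `cₖ` is needed.
theorem hasCurlEstimate (hΩ : IsOpen Ω) (hb : Bornology.IsBounded Ω) : HasCurlEstimate Ω := by
  obtain ⟨R, hRΩ, hRU⟩ : ∃ R : NNReal, Ω ⊆ Metric.closedBall 0 R ∧
      ∀ k, B.U k ⊆ Metric.closedBall 0 R := by
    have hbU : Bornology.IsBounded (Ω ∪ ⋃ k, B.U k) :=
      hb.union (Bornology.isBounded_iUnion.2 fun k => (B.chart k).isBounded)
    obtain ⟨R, hR0, hR⟩ := hbU.subset_closedBall_lt 0 0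
    exact ⟨⟨R, hR0.le⟩, Set.subset_union_left.trans hR,
      fun k => (Set.subset_iUnion B.U k).trans (Set.subset_union_right.trans hR)⟩
  have hmθ : ∀ k, MemLp (grad (B.θc k)) 2 (volume.restrict Ω) := fun k =>
    memLp_grad_of_lipschitz hb (B.lipschitzWith_θc k)
  let b : ι → L2v Ω := fun k => (hmθ k).toLp
  -- `A` is the constant of the potential estimate on a ball containing `Ω` and all charts, and `D
  -- k` that of reflection in chart `k`.
  set A : NNReal := 3 * (6 * R) ^ 2 with hA
  let D : ι → NNReal := fun k =>
    4 * (2 * B.L k ^ 2 * B.K k ^ 3 * B.C k + 2 * (1 * B.K k) ^ 2 * B.K k ^ 3)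
  refine ⟨√A + ∑ k, √(D k * A : NNReal), Submodule.span ℂ (Set.range b),
    FiniteDimensional.span_of_finite ℂ (Set.finite_range b), ?_⟩
  rintro q ⟨φ, hφ, h1, h2⟩
  have hu := hφ.contDiff_apply
  obtain ⟨p, hp, hpc, hpgrad⟩ := exists_compactSupport_potential hu R
  obtain ⟨P, hP⟩ := ContDiff.lipschitzWith_of_hasCompactSupport hpc hp one_ne_zero
  choose c hc using B.exists_lintegral_grad_reflected_le hΩ hp
  choose E hE using B.exists_lipschitzWith_reflected hP c
  obtain ⟨Q, hQ⟩ := B.exists_lipschitzWith_corrected hP c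
  have hQ' := lipschitzWith_indicator hQ fun x hx => B.corrected_eq_zero p c hx
  have hmQ := memLp_grad_of_lipschitz hb hQ'
  have hmr : ∀ k, MemLp (grad (reflected (B.θ k) (B.ρ k) p (c k))) 2 (volume.restrict Ω) :=
    fun k => memLp_grad_of_lipschitz hb (hE k)
  have hmv : MemLp (φ - grad p) 2 (volume.restrict Ω) :=
    (hφ.memLp _).sub (memLp_grad_of_lipschitz hb hP)
  have hcurl : ∫⁻ x, ‖curl φ x‖ₑ ^ 2 = ∫⁻ x in Ω, ‖curl φ x‖ₑ ^ 2 := by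
    rw [← lintegral_indicator hΩ.measurableSet]
    refine lintegral_congr fun x => ?_
    by_cases hx : x ∈ Ω
    · simp [hx]
    · simp [hx, hφ.curl.eq_zero hx]
  have hv : ∫⁻ x in Metric.closedBall 0 R, ‖(φ - grad p) x‖ₑ ^ 2 ≤
      A * ∫⁻ x in Ω, ‖curl φ x‖ₑ ^ 2 := by
    rw [← hcurl]
    refine le_trans (le_of_eq ?_) (lintegral_sub_grad_potential_le hu R)
    refine setLIntegral_congr_fun measurableSet_closedBall fun x hx => ?_
    simp only [Pi.sub_apply, hpgrad x hx]
  have hvΩ : ∫⁻ x in Ω, ‖(φ - grad p) x‖ₑ ^ 2 ≤ A * ∫⁻ x in Ω, ‖curl φ x‖ₑ ^ 2 :=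
    (lintegral_mono_set hRΩ).trans hv
  have hr : ∀ k, ∫⁻ x in Ω, ‖grad (reflected (B.θ k) (B.ρ k) p (c k)) x‖ₑ ^ 2 ≤
      ((D k * A : NNReal) : ENNReal) * ∫⁻ x in Ω, ‖curl φ x‖ₑ ^ 2 := by
    intro k
    have hm : MeasurableSet (B.U k \ closure Ω) :=
      (B.chart k).isOpen.measurableSet.diff isClosed_closure.measurableSet
    -- Here the zero extension enters: outside `Ω` the gradient of `p` equals `-(φ - ∇p)`.
    have e : ∫⁻ x in B.U k \ closure Ω, ‖grad p x‖ₑ ^ 2 =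
        ∫⁻ x in B.U k \ closure Ω, ‖(φ - grad p) x‖ₑ ^ 2 := by
      refine setLIntegral_congr_fun hm fun x hx => ?_
      have : φ x = 0 := hφ.eq_zero fun hx' => hx.2 (subset_closure hx')
      simp only [Pi.sub_apply, this, zero_sub, enorm_neg]
    calc _ ≤ (D k : ENNReal) * ∫⁻ x in B.U k \ closure Ω, ‖grad p x‖ₑ ^ 2 := hc k
      _ ≤ (D k : ENNReal) * (A * ∫⁻ x in Ω, ‖curl φ x‖ₑ ^ 2) := by
          rw [e]
          gcongr
          exact (lintegral_mono_set (Set.sdiff_subset.trans (hRU k))).trans hv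
      _ = _ := by rw [ENNReal.coe_mul (D k) A, mul_assoc]
  refine ⟨hmQ.toLp, grad_mem_gZero_of_lipschitz hΩ hb hQ' (fun x hx => by simp [hx])
    hmQ.coeFn_toLp, ∑ k, c k • b k,
    Submodule.sum_mem _ fun k _ => Submodule.smul_mem _ _ (Submodule.subset_span ⟨k, rfl⟩), ?_⟩
  have hdecomp : q.1 - hmQ.toLp - ∑ k, c k • b k = hmv.toLp + ∑ k, (hmr k).toLp := by
    have hsub : q.1 - hmQ.toLp = hmv.toLp + ∑ k, ((hmr k).toLp + c k • b k) := by
      refine Lp.ext ?_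
      -- The decomposition of gradients holds where all reflected functions are differentiable,
      -- which is almost everywhere by Rademacher's theorem.
      filter_upwards [Lp.coeFn_sub q.1 hmQ.toLp, h1, hmQ.coeFn_toLp,
        Lp.coeFn_add hmv.toLp (∑ k, ((hmr k).toLp + c k • b k)), hmv.coeFn_toLp,
        Lp.coeFn_finsetSum Finset.univ fun k => (hmr k).toLp + c k • b k,
        ae_all_iff.2 fun k => Lp.coeFn_add (hmr k).toLp (c k • b k),
        ae_all_iff.2 fun k => Lp.coeFn_smul (c k) (b k),
        ae_all_iff.2 fun k => (hmr k).coeFn_toLp, ae_all_iff.2 fun k => (hmθ k).coeFn_toLp,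
        ae_restrict_mem hΩ.measurableSet,
        ae_restrict_of_ae (ae_all_iff.2 fun k => (hE k).ae_differentiableAt)]
        with x e1 e2 e3 e4 e5 e6 e7 e8 e9 e10 hx hd
      have hind : grad (Ω.indicator (B.corrected p c)) x = grad (B.corrected p c) x := by
        have hev : Ω.indicator (B.corrected p c) =ᶠ[𝓝 x] B.corrected p c := by
          filter_upwards [hΩ.mem_nhds hx] with y hy
          simp [hy]
        ext i
        rw [grad_apply, grad_apply, pderiv, pderiv, hev.fderiv_eq]
      have hk : ∀ k, ((hmr k).toLp + c k • b k : L2v Ω) x =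
          grad (reflected (B.θ k) (B.ρ k) p (c k)) x + c k • grad (B.θc k) x := fun k => by
        rw [e7 k, Pi.add_apply, e9 k, e8 k, Pi.smul_apply]
        congr 2
        exact e10 k
      rw [e1, Pi.sub_apply, e2, e3, hind,
        B.grad_corrected c (hp.differentiable one_ne_zero x) hd, e4, Pi.add_apply, e5, e6,
        Finset.sum_apply, Finset.sum_congr rfl fun k _ => hk k, Pi.sub_apply]
      abel
    rw [hsub, Finset.sum_add_distrib]
    abel
  rw [hdecomp, add_mul, Finset.sum_mul]
  refine (norm_add_le _ _).trans (add_le_add ?_ ((norm_sum_le _ _).trans ?_))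
  · exact norm_le_of_lintegral_le hmv.coeFn_toLp h2 hvΩ
  · exact Finset.sum_le_sum fun k _ => norm_le_of_lintegral_le (hmr k).coeFn_toLp h2 (hr k)

end BoundaryCover

theorem hasCurlEstimate_of_isWeakLipschitz (hΩ : IsOpen Ω) (hb : Bornology.IsBounded Ω)
    (hL : IsWeakLipschitz Ω) : HasCurlEstimate Ω := by
  obtain ⟨t, ⟨B⟩⟩ := exists_boundaryCover hb hL
  exact B.hasCurlEstimate hΩ hb

end CurlEstimate

end NonlocalH

end

/-! ### The compactness theorem on standard domains -/

theorem mainTheorem11 (Ω : Set NonlocalH.R3) (hΩ : NonlocalH.IsStandardDomain Ω)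
    (α β : ℝ) (hα : 0 < α) (hαβ : α < β)
    (B : Set (NonlocalH.L2v Ω →L[ℂ] NonlocalH.L2v Ω))
    (hBM : B ⊆ NonlocalH.admissible α β Ω) (hB : Bornology.IsBounded B) :
    IsCompact (closure {a : NonlocalH.Coeff α β Ω | a.toCLM ∈ B}) ∧
      TopologicalSpace.MetrizableSpace
        (closure {a : NonlocalH.Coeff α β Ω | a.toCLM ∈ B}) := by
  have hG : IsClosed (NonlocalH.gZero Ω : Set (NonlocalH.L2v Ω)) :=
    NonlocalH.isClosed_gZero hΩ.isOpen hΩ.isBounded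
  have : CompleteSpace (NonlocalH.gZero Ω) := hG.completeSpace_coe
  have hC : NonlocalH.cRange Ω = (NonlocalH.gZero Ω)ᗮ :=
    NonlocalH.cRange_eq_orthogonal hΩ.topologicallyTrivial
      (NonlocalH.hasCurlEstimate_of_isWeakLipschitz hΩ.isOpen hΩ.isBounded hΩ.weakLipschitz)
  have : CompleteSpace (NonlocalH.cRange Ω) := by
    rw [hC]; infer_instance
  have : Fact ((2 : ENNReal) ≠ ⊤) := ⟨by norm_num⟩
  -- Separability of `L²` passes to `g₀` and `c` and supplies the dense sequences for metrisability.
  have hsep : SecondCountableTopology (NonlocalH.L2v Ω) :=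
    MeasureTheory.Lp.SecondCountableTopology
  exact NonlocalH.compact_metrizable_closure hα (hα.trans hαβ) hC
    (A := NonlocalH.Coeff.toCLM) (fun a b h => by cases a; cases b; congr)
    (Set.ext fun a => ⟨fun ⟨x, hx⟩ => hx ▸ x.mem, fun h => ⟨⟨a, h⟩, rfl⟩⟩)
    (NonlocalH.isInducing_components α β Ω) hB
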